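/- **Proposition 3.1 (propagation of positivity).** Let $d\ge 1$, $0<\alpha\le 2$, $T>0$, and let $q,r\in[1,\infty]$ satisfy $\frac1q+\frac1r=1$. Let $(-\Delta)^{\alpha/2}$ denote the Fourier multiplier by $|\xi|^\alpha$ on $\mathbb{R}^d$. Let $\mathbf v:[0,T]\times\mathbb{R}^d\to\mathbb{R}^d$ be a transport field such that $$\mathbf v\in L^1\big(0,T;W^{1,r}_{\mathrm{loc}}(\mathbb{R}^d)\big)\qquad\text{and}\qquad \mathbf v\in(1+|x|)\,\big(L^1(0,T;L^r(\mathbb{R}^d))+L^1(0,T;L^\infty(\mathbb{R}^d))\big)$$ (for $q=\infty$, $r=1$ these are a $W^{1,1}_{\mathrm{loc}}$ field and growth in $(1+|x|)(L^1+L^\infty)$; no condition is put on $\operatorname{div}\mathbf v$). Let $\psi_0\in L^1\cap L^q(\mathbb{R}^d)$ be real-valued and let $\psi$ be a weak solution on $[0,T]$ of $$\partial_s\psi+(-\Delta)^{\alpha/2}\psi=-\operatorname{div}(\mathbf v\,\psi),\qquad \psi(0,\cdot)=\psi_0,$$ that is: $\psi$ is real-valued and measurable on $[0,T]\times\mathbb{R}^d$,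 $\psi(s)\in L^1\cap L^q(\mathbb{R}^d)$ for every $s\in[0,T]$ with norms bounded uniformly in $s$, and for every $\varphi\in C_c^\infty(\mathbb{R}^d)$ and every $s\in[0,T]$, $$\int\psi(s,x)\varphi(x)\,dx=\int\psi_0(x)\varphi(x)\,dx+\int_0^s\!\!\int\psi(\tau,x)\Big(\mathbf v(\tau,x)\cdot\nabla\varphi(x)-(-\Delta)^{\alpha/2}\varphi(x)\Big)dx\,d\tau .$$ If $\psi_0\ge0$ almost everywhere, then for every $s\in[0,T]$ one has $\psi(s,\cdot)\ge0$ almost everywhere on $\mathbb{R}^d$. (As $T$ is arbitrary, a solution on $[0,\infty)$ stays nonnegative for all $s\ge0$.) -/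

import Mathlib

open MeasureTheory Set
open scoped ENNReal NNReal FourierTransform

noncomputable section

/-- The fractional Laplacian `(-Δ)^{α/2}` of a real function on `ℝ^d`, as the Fourier multiplier by
`|ξ|^α`. In Mathlib's normalisation `𝓕 f ξ = ∫ exp (-2πi⟨x, ξ⟩) f x dx`, the frequency variable is
`2πξ`. It is only applied below to smooth compactly supported functions `f`, for which
`ξ ↦ (2π|ξ|)^α 𝓕 f ξ` is integrable and the inverse transform is real-valued. -/
def fracLaplacian {d : ℕ} (α : ℝ) (f : EuclideanSpace ℝ (Fin d) → ℝ) :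
    EuclideanSpace ℝ (Fin d) → ℝ :=
  fun x => (𝓕⁻ (fun ξ : EuclideanSpace ℝ (Fin d) =>
    (((2 * Real.pi * ‖ξ‖) ^ α : ℝ) : ℂ) *
      𝓕 (fun y : EuclideanSpace ℝ (Fin d) => (f y : ℂ)) ξ) x).re

/-- `G` is the weak (distributional) gradient of the vector field `w` on `ℝ^d`: both are locally
integrable and `∫ φ ∂_e w = - ∫ (∂_e φ) w` for all test functions `φ` and directions `e`, where
`∂_e w (x) = G x e`. -/
def HasWeakGradient {d : ℕ} (w : EuclideanSpace ℝ (Fin d) → EuclideanSpace ℝ (Fin d))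
    (G : EuclideanSpace ℝ (Fin d) → EuclideanSpace ℝ (Fin d) →L[ℝ] EuclideanSpace ℝ (Fin d)) :
    Prop :=
  LocallyIntegrable w ∧ LocallyIntegrable G ∧
    ∀ φ : EuclideanSpace ℝ (Fin d) → ℝ, ContDiff ℝ ((⊤ : ℕ∞) : WithTop ℕ∞) φ → HasCompactSupport φ →
      ∀ e : EuclideanSpace ℝ (Fin d),
        ∫ x, φ x • G x e = - ∫ x, (fderiv ℝ φ x e) • w x

/-- The class `L¹(0,T; L^r(μ))` for functions `f(s, x)` of time `s ∈ [0,T]` and `x ∈ ℝ^d`. -/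
def MemL1TimeLp {d : ℕ} {F : Type*} [NormedAddCommGroup F] (T : ℝ) (r : ℝ≥0∞)
    (μ : Measure (EuclideanSpace ℝ (Fin d))) (f : ℝ → EuclideanSpace ℝ (Fin d) → F) : Prop :=
  AEStronglyMeasurable (Function.uncurry f) ((volume.restrict (Icc 0 T)).prod μ) ∧
    ∫⁻ s in Icc 0 T, eLpNorm (f s) r μ < ∞

/-- Transport fields of Sobolev regularity on the time interval `[0,T]`: `v` belongs to
`L¹(0,T; W^{1,r}_loc(ℝ^d))` and has the mild growth `v ∈ (1+|x|) (L¹(0,T; L^r) + L¹(0,T; L^∞))`. -/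
structure IsTransportField {d : ℕ} (T : ℝ) (r : ℝ≥0∞)
    (v : ℝ → EuclideanSpace ℝ (Fin d) → EuclideanSpace ℝ (Fin d)) : Prop where
  memLp_loc : ∀ R : ℝ, MemL1TimeLp T r (volume.restrict (Metric.ball 0 R)) v
  weakGradient : ∃ G : ℝ → EuclideanSpace ℝ (Fin d) →
      EuclideanSpace ℝ (Fin d) →L[ℝ] EuclideanSpace ℝ (Fin d),
    (∀ᵐ s ∂(volume.restrict (Icc 0 T)), HasWeakGradient (v s) (G s)) ∧
      ∀ R : ℝ, MemL1TimeLp T r (volume.restrict (Metric.ball 0 R)) G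
  growth : ∃ a b : ℝ → EuclideanSpace ℝ (Fin d) → EuclideanSpace ℝ (Fin d),
    MemL1TimeLp T r volume a ∧ MemL1TimeLp T ∞ volume b ∧
      ∀ᵐ s ∂(volume.restrict (Icc 0 T)), ∀ᵐ x, v s x = (1 + ‖x‖) • (a s x + b s x)

/-- `ψ` is a weak solution on `[0,T]`, bounded in `L¹ ∩ L^q`, of the Cauchy problem
`∂_s ψ + (-Δ)^{α/2} ψ = - div (v ψ)`, `ψ(0) = ψ₀`: for every test function `φ ∈ C_c^∞(ℝ^d)` and
every time `s ∈ [0,T]`,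
`∫ ψ(s) φ = ∫ ψ₀ φ + ∫₀ˢ ∫ ψ(τ) (v(τ)·∇φ - (-Δ)^{α/2} φ) dx dτ`. -/
structure IsWeakSolution {d : ℕ} (α T : ℝ) (q : ℝ≥0∞)
    (v : ℝ → EuclideanSpace ℝ (Fin d) → EuclideanSpace ℝ (Fin d))
    (ψ₀ : EuclideanSpace ℝ (Fin d) → ℝ) (ψ : ℝ → EuclideanSpace ℝ (Fin d) → ℝ) : Prop where
  init_memLp_one : MemLp ψ₀ 1
  init_memLp : MemLp ψ₀ q
  aestronglyMeasurable :
    AEStronglyMeasurable (Function.uncurry ψ) ((volume.restrict (Icc 0 T)).prod volume)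
  memLp_one : ∀ s ∈ Icc 0 T, MemLp (ψ s) 1
  memLp : ∀ s ∈ Icc 0 T, MemLp (ψ s) q
  bounded : ∃ C : ℝ≥0, ∀ s ∈ Icc 0 T, eLpNorm (ψ s) 1 volume ≤ C ∧ eLpNorm (ψ s) q volume ≤ C
  weak_eq : ∀ φ : EuclideanSpace ℝ (Fin d) → ℝ, ContDiff ℝ ((⊤ : ℕ∞) : WithTop ℕ∞) φ → HasCompactSupport φ →
    ∀ s ∈ Icc 0 T,
      ∫ x, ψ s x * φ x = (∫ x, ψ₀ x * φ x) +
        ∫ τ in 0..s, ∫ x, ψ τ x * (fderiv ℝ φ x (v τ x) - fracLaplacian α φ x)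

end

open Filter Topology

/-! ### Continuity of translations in Lebesgue spaces and of products of translates. -/

section Translation

variable {E F : Type*} [NormedAddCommGroup E] [NormedSpace ℝ E] [FiniteDimensional ℝ E]
  [MeasurableSpace E] [BorelSpace E] {μ : Measure E} [μ.IsAddHaarMeasure]
  [NormedAddCommGroup F]

/-! The proof is a renormalisation argument in the manner of DiPerna and Lions. Formally, multiply
the equation by `β'(ψ)` with `β` the negative part and integrate. The negative part is convex, so
the diffusion can only decrease `∫ β(ψ)`. It is homogeneous of degree one, so `β(ψ) - ψ β'(ψ) = 0`
and `div v` drops out of the transport term, which is why no condition on the divergence is needed.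
Hence `∫ β(ψ(s)) ≤ ∫ β(ψ₀) = 0`.

To justify this, the equation is tested with translates of a mollifier. The mollified density `u` is
smooth in space and absolutely continuous in time, so the chain rule applies with a smooth convex `β
= smoothNegPart δ`, whose homogeneity defect is at most `δ`. What mollification costs is the
commutator between convolution and transport. A Sobolev field satisfies the fundamental theorem of
calculus along almost every segment (`HasWeakGradient.sub_translate_eq`), so the commutator is
controlled by the `L¹` modulus of the products `f(x - z) ∇w(x - θz)`
(`HasWeakGradient.lintegral_defect_le`). This modulus tends to zero for all dual exponents,
endpoints included (`tendsto_eLpNorm_translate_smul_sub`).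

The diffusion is handled on the Fourier side. The tangent line inequality for `β` says that a
certain correlation function is largest at the origin. Such a function pairs nonnegatively with
every symbol `1 - exp (-t|ξ|²)`, and by subordination with `|ξ|^α` for `0 < α ≤ 2`
(`integral_rpow_norm_mul_re_nonneg`). This gives an integrated convexity inequality,
`neg_integral_mul_fracLaplacian_le`, without any kernel representation of the fractional Laplacian.

These ingredients meet in `ofReal_integral_mul_mollifiedFlux_le`. Letting the mollification scale
and `δ` tend to zero, with domination in time by the `L¹(0,T)` norms of the field and its gradient,
yields `IsTransportData.lintegral_neg_le`: the localised negative part is bounded by a flux through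
the gradient of the cutoff and by the fractional Laplacian of the cutoff. Dilating the cutoff kills
both (`IsTransportData.ae_nonneg`): its gradient decays like `1/(1+|x|)`, which absorbs the growth
of the field, and its fractional Laplacian scales like a negative power of the radius. -/

theorem tendsto_eLpNorm_translate_sub {p : ℝ≥0∞} (hp1 : 1 ≤ p) (hp : p ≠ ∞) {f : E → F}
    (hf : MemLp f p μ) :
    Tendsto (fun a : E => eLpNorm (fun x => f (x - a) - f x) p μ) (𝓝 0) (𝓝 0) := by
  have : Fact (1 ≤ p) := ⟨hp1⟩
  have hmp : ∀ a : E, MeasurePreserving (fun x : E => x - a) μ μ :=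
    fun a => measurePreserving_sub_right μ a
  -- Translations form a continuous family in the compact-open topology, and composition with
  -- measure preserving maps is continuous on `L^p`, `p < ∞`, along such a family.
  let T : C(E, C(E, E)) := ContinuousMap.curry ⟨fun p : E × E => p.2 - p.1, by fun_prop⟩
  have hT : Continuous T := T.continuous
  have h := (continuous_const (y := hf.toLp f)).compMeasurePreservingLp (μ := μ) (ν := μ) hT
    (fun a => hmp a) hp
  have h0 := h.tendsto 0
  rw [tendsto_iff_edist_tendsto_0] at h0
  refine h0.congr fun a => ?_
  rw [Lp.edist_def]
  refine eLpNorm_congr_ae ?_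
  have e1 := Lp.coeFn_compMeasurePreserving (hf.toLp f) (hmp a)
  have e2 := Lp.coeFn_compMeasurePreserving (hf.toLp f) (hmp 0)
  have e3 := (hmp a).quasiMeasurePreserving.ae_eq_comp hf.coeFn_toLp
  have e4 := (hmp 0).quasiMeasurePreserving.ae_eq_comp hf.coeFn_toLp
  filter_upwards [e1, e2, e3, e4] with x h1 h2 h3 h4
  have h1' : (Lp.compMeasurePreserving (T a) (hmp a) (hf.toLp f)) x = f (x - a) := by
    exact h1.trans h3
  have h2' : (Lp.compMeasurePreserving (T 0) (hmp 0) (hf.toLp f)) x = f x := by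
    exact (h2.trans h4).trans (by simp)
  simp only [Pi.sub_apply]
  rw [← h1', ← h2']

end Translation

section Translation

variable {E F : Type*} [NormedAddCommGroup E] [MeasurableSpace E] [BorelSpace E] {μ : Measure E}
  [μ.IsAddRightInvariant] [NormedAddCommGroup F]

theorem eLpNorm_comp_sub {p : ℝ≥0∞} {f : E → F} (hf : AEStronglyMeasurable f μ) (a : E) :
    eLpNorm (fun x => f (x - a)) p μ = eLpNorm f p μ :=
  eLpNorm_comp_measurePreserving hf (measurePreserving_sub_right μ a)

theorem MemLp.comp_sub {p : ℝ≥0∞} {f : E → F} (hf : MemLp f p μ) (a : E) :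
    MemLp (fun x => f (x - a)) p μ :=
  hf.comp_measurePreserving (measurePreserving_sub_right μ a)

end Translation

section Translation

variable {E F : Type*} [NormedAddCommGroup E] [NormedSpace ℝ E] [FiniteDimensional ℝ E]
  [MeasurableSpace E] [BorelSpace E] {μ : Measure E} [μ.IsAddHaarMeasure]
  [NormedAddCommGroup F] [NormedSpace ℝ F]

set_option maxHeartbeats 400000 in
/-- Products of translates of functions in dual Lebesgue spaces depend continuously in `L¹` on the
translation vectors, including the endpoint exponents. -/
theorem tendsto_eLpNorm_translate_smul_sub {q r : ℝ≥0∞} [hqr : ENNReal.HolderConjugate q r]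
    {f : E → ℝ} {h : E → F} (hf : MemLp f q μ) (hh : MemLp h r μ) :
    Tendsto (fun p : E × E => eLpNorm (fun x => f (x - p.1) • h (x - p.2) - f x • h x) 1 μ)
      (𝓝 0) (𝓝 0) := by
  have hfh : MemLp (fun x => f x • h x) 1 μ :=
    MemLp.smul (p := q) (q := r) (r := 1) hh hf
  have t1 : Tendsto (fun a : E => eLpNorm (fun x => f (x - a) • h (x - a) - f x • h x) 1 μ)
      (𝓝 0) (𝓝 0) := tendsto_eLpNorm_translate_sub (f := fun x => f x • h x) le_rfl
        ENNReal.one_ne_top hfh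
  have hq1 : 1 ≤ q := ENNReal.HolderConjugate.one_le q r
  have hr1 : 1 ≤ r := ENNReal.HolderConjugate.one_le r q
  have hsub : Tendsto (fun p : E × E => p.1 - p.2) (𝓝 0) (𝓝 0) := by
    have : Continuous (fun p : E × E => p.1 - p.2) := by fun_prop
    simpa using this.tendsto 0
  have hsub' : Tendsto (fun p : E × E => p.2 - p.1) (𝓝 0) (𝓝 0) := by
    have : Continuous (fun p : E × E => p.2 - p.1) := by fun_prop
    simpa using this.tendsto 0
  -- Translation is not continuous in `L^∞`. At most one of two dual exponents is infinite, so the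
  -- difference of translates is always placed on the factor with finite exponent.
  by_cases hq : q = ∞
  · have hr : r ≠ ∞ := by
      subst hq
      have : r = 1 := by
        have := ENNReal.HolderConjugate.inv_add_inv_eq_one ∞ r
        simpa using this
      simp [this]
    have t2 := (tendsto_eLpNorm_translate_sub hr1 hr hh).comp hsub'
    have t3 : Tendsto (fun p : E × E => eLpNorm f q μ *
        eLpNorm (fun x => h (x - (p.2 - p.1)) - h x) r μ +
        eLpNorm (fun x => f (x - p.1) • h (x - p.1) - f x • h x) 1 μ) (𝓝 0) (𝓝 0) := by
      have a1 := ENNReal.Tendsto.const_mul t2 (a := eLpNorm f q μ) (Or.inr hf.2.ne)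
      have a2 : Tendsto (fun p : E × E => p.1) (𝓝 0) (𝓝 (0 : E)) := continuous_fst.tendsto _
      simpa using a1.add (t1.comp a2)
    refine tendsto_of_tendsto_of_tendsto_of_le_of_le tendsto_const_nhds t3 (fun _ => zero_le) ?_
    rintro ⟨a, b⟩
    have hfa := MemLp.comp_sub hf a
    have hhb := MemLp.comp_sub hh b
    have hha := MemLp.comp_sub hh a
    -- Align the translate of `h` with that of `f`. What remains is a translate of the product `f •
    -- h`, which lies in `L¹`, where translation is continuous.
    have e : (fun x => f (x - a) • h (x - b) - f x • h x) =
        (fun x => f (x - a) • (h (x - b) - h (x - a))) +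
        (fun x => f (x - a) • h (x - a) - f x • h x) := by
      ext x; simp [smul_sub]
    dsimp only
    rw [e]
    refine (eLpNorm_add_le ?_ ?_ le_rfl).trans (add_le_add ?_ le_rfl)
    · exact hfa.1.smul (hhb.1.sub hha.1)
    · exact (hfa.1.smul hha.1).sub (hf.1.smul hh.1)
    · refine (eLpNorm_smul_le_mul_eLpNorm (p := q) (q := r) (hhb.1.sub hha.1) hfa.1).trans ?_
      refine mul_le_mul' (eLpNorm_comp_sub hf.1 a).le ?_
      have := eLpNorm_comp_sub (μ := μ) (p := r) (f := fun x => h (x - (b - a)) - h x)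
        ((MemLp.comp_sub hh _).1.sub hh.1) a
      rw [← this]
      refine (congrArg (fun g => eLpNorm g r μ) ?_).le
      ext x; simp [sub_sub]
  · have t2 := (tendsto_eLpNorm_translate_sub hq1 hq hf).comp hsub
    have t3 : Tendsto (fun p : E × E =>
        eLpNorm (fun x => f (x - (p.1 - p.2)) - f x) q μ * eLpNorm h r μ +
        eLpNorm (fun x => f (x - p.2) • h (x - p.2) - f x • h x) 1 μ) (𝓝 0) (𝓝 0) := by
      have a1 := ENNReal.Tendsto.mul_const t2 (b := eLpNorm h r μ) (Or.inr hh.2.ne)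
      have a2 : Tendsto (fun p : E × E => p.2) (𝓝 0) (𝓝 (0 : E)) := continuous_snd.tendsto _
      simpa using a1.add (t1.comp a2)
    refine tendsto_of_tendsto_of_tendsto_of_le_of_le tendsto_const_nhds t3 (fun _ => zero_le) ?_
    rintro ⟨a, b⟩
    have hfa := MemLp.comp_sub hf a
    have hfb := MemLp.comp_sub hf b
    have hhb := MemLp.comp_sub hh b
    have e : (fun x => f (x - a) • h (x - b) - f x • h x) =
        (fun x => (f (x - a) - f (x - b)) • h (x - b)) +
        (fun x => f (x - b) • h (x - b) - f x • h x) := by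
      ext x; simp [sub_smul]
    dsimp only
    rw [e]
    refine (eLpNorm_add_le ?_ ?_ le_rfl).trans (add_le_add ?_ le_rfl)
    · exact (hfa.1.sub hfb.1).smul hhb.1
    · exact (hfb.1.smul hhb.1).sub (hf.1.smul hh.1)
    · refine (eLpNorm_smul_le_mul_eLpNorm (p := q) (q := r) hhb.1 (hfa.1.sub hfb.1)).trans ?_
      refine mul_le_mul' ?_ (eLpNorm_comp_sub hh.1 b).le
      have := eLpNorm_comp_sub (μ := μ) (p := q) (f := fun x => f (x - (a - b)) - f x)
        ((MemLp.comp_sub hf _).1.sub hf.1) b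
      rw [← this]
      refine (congrArg (fun g => eLpNorm g q μ) ?_).le
      ext x; simp [sub_sub]

end Translation

/-! ### Fields with weak gradient along segments. -/

section WeakGradient

variable {d : ℕ}

theorem setLIntegral_ball_comp_sub_le {g : EuclideanSpace ℝ (Fin d) → ℝ≥0∞} {R ε : ℝ}
    {a : EuclideanSpace ℝ (Fin d)} (ha : ‖a‖ ≤ ε) :
    ∫⁻ x in Metric.ball 0 R, g (x - a) ≤ ∫⁻ x in Metric.ball 0 (R + ε), g x := by
  rw [← lintegral_indicator measurableSet_ball, ← lintegral_indicator measurableSet_ball,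
    ← lintegral_sub_right_eq_self ((Metric.ball 0 (R + ε)).indicator g) a]
  refine lintegral_mono fun x => ?_
  by_cases hx : x ∈ Metric.ball 0 R
  · have : x - a ∈ Metric.ball 0 (R + ε) := by
      simp only [mem_ball_zero_iff] at hx ⊢
      linarith [norm_sub_le x a]
    simp [indicator_of_mem hx, indicator_of_mem this]
  · simp [indicator_of_notMem hx]

theorem LocallyIntegrable.integrableOn_ball {F : Type*} [NormedAddCommGroup F]
    {H : EuclideanSpace ℝ (Fin d) → F} (hH : LocallyIntegrable H) (R : ℝ) :
    IntegrableOn H (Metric.ball 0 R) :=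
  (hH.integrableOn_isCompact (isCompact_closedBall 0 R)).mono_set Metric.ball_subset_closedBall

/-- Tonelli with the space integral inside: for each `θ` the translated integral over the ball is at
most the integral over the ball enlarged by `‖a‖`. This supplies the Fubini hypotheses and the
integrability along almost every segment. -/
theorem integrable_prod_translate {F : Type*} [NormedAddCommGroup F]
    {H : EuclideanSpace ℝ (Fin d) → F} (hHm : StronglyMeasurable H) (hH : LocallyIntegrable H)
    (a : EuclideanSpace ℝ (Fin d)) (R : ℝ) :
    Integrable (fun p : EuclideanSpace ℝ (Fin d) × ℝ => H (p.1 - p.2 • a))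
      ((volume.restrict (Metric.ball 0 R)).prod (volume.restrict (Ioc 0 1))) := by
  have hm : StronglyMeasurable
      (fun p : EuclideanSpace ℝ (Fin d) × ℝ => H (p.1 - p.2 • a)) :=
    hHm.comp_measurable (by fun_prop)
  refine ⟨hm.aestronglyMeasurable, ?_⟩
  rw [HasFiniteIntegral, lintegral_prod_symm _ hm.enorm.aemeasurable]
  have : ∫⁻ x in Metric.ball 0 (R + ‖a‖), ‖H x‖ₑ < ∞ :=
    (LocallyIntegrable.integrableOn_ball hH _).2
  calc ∫⁻ θ in Ioc (0 : ℝ) 1, ∫⁻ x in Metric.ball 0 R, ‖H (x - θ • a)‖ₑ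
      ≤ ∫⁻ θ in Ioc (0 : ℝ) 1, ∫⁻ x in Metric.ball 0 (R + ‖a‖), ‖H x‖ₑ := by
        refine setLIntegral_mono' measurableSet_Ioc fun θ hθ => ?_
        refine setLIntegral_ball_comp_sub_le (g := fun x => ‖H x‖ₑ) ?_
        rw [norm_smul, Real.norm_of_nonneg hθ.1.le]
        exact mul_le_of_le_one_left (norm_nonneg _) hθ.2
    _ < ∞ := by simpa using this

theorem ae_of_forall_ae_ball {p : EuclideanSpace ℝ (Fin d) → Prop}
    (h : ∀ n : ℕ, ∀ᵐ x ∂(volume.restrict (Metric.ball 0 (n : ℝ))), p x) : ∀ᵐ x, p x := by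
  have := ae_restrict_iUnion_iff (μ := volume)
    (fun n : ℕ => Metric.ball (0 : EuclideanSpace ℝ (Fin d)) n) p
  rw [Metric.iUnion_ball_nat, Measure.restrict_univ] at this
  exact this.2 h

theorem ae_intervalIntegrable_translate {F : Type*} [NormedAddCommGroup F]
    {H : EuclideanSpace ℝ (Fin d) → F} (hHm : StronglyMeasurable H) (hH : LocallyIntegrable H)
    (a : EuclideanSpace ℝ (Fin d)) :
    ∀ᵐ x, IntervalIntegrable (fun θ : ℝ => H (x - θ • a)) volume 0 1 := by
  refine ae_of_forall_ae_ball fun n => ?_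
  filter_upwards [(integrable_prod_translate hHm hH a n).prod_right_ae] with x hx
  rwa [intervalIntegrable_iff_integrableOn_Ioc_of_le zero_le_one]

theorem locallyIntegrable_of_forall_ball {F : Type*} [NormedAddCommGroup F]
    {H : EuclideanSpace ℝ (Fin d) → F} (h : ∀ R, IntegrableOn H (Metric.ball 0 R)) :
    LocallyIntegrable H := fun x =>
  ⟨Metric.ball 0 (‖x‖ + 1), Metric.isOpen_ball.mem_nhds (by simp), h _⟩

theorem HasCompactSupport.exists_support_subset_ball {F : Type*} [NormedAddCommGroup F]
    {η : EuclideanSpace ℝ (Fin d) → F} (hη : HasCompactSupport η) :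
    ∃ R > 0, tsupport η ⊆ Metric.ball 0 R := by
  obtain ⟨R, hR⟩ := (hη.isCompact.isBounded).subset_ball 0
  exact ⟨max R 1, by positivity, hR.trans (Metric.ball_subset_ball (le_max_left _ _))⟩

/-- A field with weak gradient satisfies the fundamental theorem of calculus along almost every
segment with a given direction vector. -/
theorem HasWeakGradient.sub_translate_eq
    {w : EuclideanSpace ℝ (Fin d) → EuclideanSpace ℝ (Fin d)}
    {H : EuclideanSpace ℝ (Fin d) → EuclideanSpace ℝ (Fin d) →L[ℝ] EuclideanSpace ℝ (Fin d)}
    (hwH : HasWeakGradient w H) (hwm : StronglyMeasurable w) (hHm : StronglyMeasurable H)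
    (a : EuclideanSpace ℝ (Fin d)) :
    ∀ᵐ x, w x - w (x - a) = ∫ θ in (0 : ℝ)..1, H (x - θ • a) a := by
  obtain ⟨hw, hH, hweak⟩ := hwH
  have hHa : LocallyIntegrable (fun x => H x a) := by
    refine locallyIntegrable_of_forall_ball fun R => ?_
    exact (LocallyIntegrable.integrableOn_ball hH R).apply_continuousLinearMap a
  have hHam : StronglyMeasurable (fun x => H x a) :=
    (ContinuousLinearMap.apply ℝ _ a).continuous.comp_stronglyMeasurable hHm
  have hwa : LocallyIntegrable (fun x => w (x - a)) := by
    refine locallyIntegrable_of_forall_ball fun R => ?_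
    refine ⟨(hwm.comp_measurable (by fun_prop)).aestronglyMeasurable, ?_⟩
    exact (setLIntegral_ball_comp_sub_le (g := fun x => ‖w x‖ₑ) le_rfl).trans_lt
      (LocallyIntegrable.integrableOn_ball hw _).2
  -- Two locally integrable functions agree almost everywhere once they agree against test
  -- functions; the translation can then be moved to the smooth side.
  refine ae_eq_of_integral_contDiff_smul_eq (hw.sub hwa) ?_ ?_
  · refine locallyIntegrable_of_forall_ball fun R => ?_
    have := (integrable_prod_translate hHam hHa a R).integral_prod_left
    simpa only [intervalIntegral.integral_of_le zero_le_one] using! this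
  intro η hη hηc
  obtain ⟨R, hR0, hR⟩ := HasCompactSupport.exists_support_subset_ball hηc
  have hη1 : ContDiff ℝ 1 η := hη.of_le (by exact_mod_cast le_top)
  have hDη : Continuous (fderiv ℝ η) := hη1.continuous_fderiv (by simp)
  have hDηc : HasCompactSupport (fderiv ℝ η) := hηc.fderiv ℝ
  obtain ⟨C, hC⟩ := hDη.bounded_above_of_compact_support hDηc
  have hηx : ∀ x, x ∉ Metric.ball 0 R → η x = 0 := fun x hx =>
    image_eq_zero_of_notMem_tsupport fun h => hx (hR h)
  have hDηx : ∀ x, x ∉ Metric.ball 0 R → fderiv ℝ η x = 0 := fun x hx =>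
    image_eq_zero_of_notMem_tsupport fun h => hx (hR (tsupport_fderiv_subset ℝ h))
  -- translating the test function
  have i1 : Integrable (fun x => η x • w x) :=
    hw.integrable_smul_left_of_hasCompactSupport hη.continuous hηc
  have i2 : Integrable (fun x => η x • w (x - a)) :=
    hwa.integrable_smul_left_of_hasCompactSupport hη.continuous hηc
  have i2' : Integrable (fun x => η (x + a) • w x) := by
    simpa using i2.comp_add_right a
  have s1 : ∫ x, η x • (w - fun x => w (x - a)) x = -∫ x, (η (x + a) - η x) • w x := by
    have e2 : ∫ x, η x • w (x - a) = ∫ x, η (x + a) • w x := by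
      rw [← integral_add_right_eq_self _ a]; simp
    simp only [Pi.sub_apply, smul_sub, sub_smul]
    rw [integral_sub i1 i2, integral_sub i2' i1, e2]
    abel
  have s2 : ∀ x, η (x + a) - η x = ∫ θ in (0 : ℝ)..1, fderiv ℝ η (x + θ • a) a := by
    intro x
    have hd : ∀ θ ∈ uIcc (0 : ℝ) 1,
        HasDerivAt (fun θ : ℝ => η (x + θ • a)) (fderiv ℝ η (x + θ • a) a) θ := by
      intro θ _
      have h1 := (hη1.differentiable (by simp) (x + θ • a)).hasFDerivAt
      have h2 : HasDerivAt (fun θ : ℝ => x + θ • a) a θ := by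
        simpa using ((hasDerivAt_id θ).smul_const a).const_add x
      exact h1.comp_hasDerivAt θ h2
    rw [intervalIntegral.integral_eq_sub_of_hasDerivAt hd]
    · simp
    · exact Continuous.intervalIntegrable (by fun_prop) _ _
  have i3 : Integrable (fun p : EuclideanSpace ℝ (Fin d) × ℝ =>
      (fderiv ℝ η (p.1 + p.2 • a) a) • w p.1) (volume.prod (volume.restrict (Ioc 0 1))) := by
    have hb : Integrable (fun p : EuclideanSpace ℝ (Fin d) × ℝ =>
        (Metric.ball 0 (R + ‖a‖)).indicator w p.1) (volume.prod (volume.restrict (Ioc 0 1))) :=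
      ((integrable_indicator_iff measurableSet_ball).2
        (LocallyIntegrable.integrableOn_ball hw _)).comp_fst _
    refine Integrable.mono' (hb.norm.const_mul (C * ‖a‖)) ?_ ?_
    · have c1 : StronglyMeasurable (fun p : EuclideanSpace ℝ (Fin d) × ℝ =>
          fderiv ℝ η (p.1 + p.2 • a) a) := Continuous.stronglyMeasurable (by fun_prop)
      exact (c1.smul (hwm.comp_measurable measurable_fst)).aestronglyMeasurable
    · have hz : ∀ᵐ p : EuclideanSpace ℝ (Fin d) × ℝ
          ∂(volume.prod (volume.restrict (Ioc 0 1))), p.2 ∈ Ioc (0 : ℝ) 1 :=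
        Measure.quasiMeasurePreserving_snd.ae (ae_restrict_mem measurableSet_Ioc)
      filter_upwards [hz] with p hp
      rw [norm_smul]
      by_cases hx : p.1 ∈ Metric.ball 0 (R + ‖a‖)
      · rw [indicator_of_mem hx]
        gcongr
        exact ((fderiv ℝ η _).le_opNorm a).trans (by gcongr; exact hC _)
      · rw [hDηx]
        · simp only [zero_apply, norm_zero, zero_mul]
          have : 0 ≤ C := (norm_nonneg _).trans (hC 0)
          positivity
        · intro h
          apply hx
          simp only [mem_ball_zero_iff] at h ⊢
          have h3 : ‖p.2 • a‖ ≤ ‖a‖ := by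
            rw [norm_smul, Real.norm_of_nonneg hp.1.le]
            exact mul_le_of_le_one_left (norm_nonneg _) hp.2
          have h4 : ‖p.1‖ ≤ ‖p.1 + p.2 • a‖ + ‖p.2 • a‖ := by
            simpa using norm_sub_le (p.1 + p.2 • a) (p.2 • a)
          linarith
  have i4 : Integrable (fun p : EuclideanSpace ℝ (Fin d) × ℝ =>
      η p.1 • H (p.1 - p.2 • a) a) (volume.prod (volume.restrict (Ioc 0 1))) := by
    have h0 := integrable_prod_translate hHam hHa a R
    obtain ⟨D, hD⟩ := hη.continuous.bounded_above_of_compact_support hηc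
    have h1 : Integrable (fun p : EuclideanSpace ℝ (Fin d) × ℝ =>
      η p.1 • H (p.1 - p.2 • a) a)
        ((volume.restrict (Metric.ball 0 R)).prod (volume.restrict (Ioc 0 1))) :=
      h0.bdd_smul D (Continuous.aestronglyMeasurable (by fun_prop))
        (Eventually.of_forall fun p => hD p.1)
    have hmeq : (volume.restrict (Metric.ball (0 : EuclideanSpace ℝ (Fin d)) R)).prod
        (volume.restrict (Ioc (0 : ℝ) 1)) =
        ((volume : Measure (EuclideanSpace ℝ (Fin d))).prod
          (volume.restrict (Ioc (0 : ℝ) 1))).restrict (Metric.ball 0 R ×ˢ univ) := by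
      rw [← Measure.prod_restrict, Measure.restrict_univ]
    rw [hmeq] at h1
    refine (integrableOn_iff_integrable_of_support_subset ?_).1 h1
    intro p hp
    refine ⟨?_, mem_univ _⟩
    by_contra hx
    exact hp (by simp [hηx _ hx])
  calc ∫ x, η x • (w - fun x => w (x - a)) x
      = -∫ x, ∫ θ in Ioc (0 : ℝ) 1, (fderiv ℝ η (x + θ • a) a) • w x := by
        rw [s1]
        congr 2 with x
        rw [s2, intervalIntegral.integral_of_le zero_le_one, integral_smul_const]
    _ = ∫ θ in Ioc (0 : ℝ) 1, ∫ x, η x • H (x - θ • a) a := by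
        rw [integral_integral_swap i3, ← integral_neg]
        congr 1 with θ
        -- For fixed `θ`, the weak gradient identity is applied to the test function translated by
        -- `-θa`, in the direction `a`; translating back puts the shift on `H`.
        have hθ := hweak (fun x => η (x + θ • a))
          (hη.comp (contDiff_id.add contDiff_const))
          (hηc.comp_homeomorph (Homeomorph.addRight (θ • a))) a
        have e5 : ∀ x, fderiv ℝ (fun x => η (x + θ • a)) x = fderiv ℝ η (x + θ • a) :=
          fun x => fderiv_comp_add_right _
        simp only [e5] at hθ
        rw [← hθ, ← integral_add_right_eq_self (fun x => η x • H (x - θ • a) a) (θ • a)]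
        simp
    _ = ∫ x, η x • ∫ θ in (0 : ℝ)..1, H (x - θ • a) a := by
        rw [← integral_integral_swap i4]
        congr 1 with x
        rw [intervalIntegral.integral_of_le zero_le_one, integral_smul]

/-- The `L¹` norm on a ball of the difference quotient defect in a commutator with direction `z` is
controlled by the `L¹` modulus of continuity of products of translates. -/
theorem HasWeakGradient.lintegral_defect_le
    {w : EuclideanSpace ℝ (Fin d) → EuclideanSpace ℝ (Fin d)}
    {H : EuclideanSpace ℝ (Fin d) → EuclideanSpace ℝ (Fin d) →L[ℝ] EuclideanSpace ℝ (Fin d)}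
    (hwH : HasWeakGradient w H) (hwm : StronglyMeasurable w) (hHm : StronglyMeasurable H)
    {f : EuclideanSpace ℝ (Fin d) → ℝ} (hf : StronglyMeasurable f)
    (s : Set (EuclideanSpace ℝ (Fin d)))
    (z : EuclideanSpace ℝ (Fin d)) (M : ℝ≥0∞)
    (hM : ∀ θ ∈ Ioc (0 : ℝ) 1, ∫⁻ x in s, ‖f (x - z) • H (x - θ • z) - f x • H x‖ₑ ≤ M) :
    ∫⁻ x in s, ‖f (x - z) • (w x - w (x - z)) - f x • H x z‖ₑ ≤ ‖z‖ₑ * M := by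
  have h1 : ∀ᵐ x, ‖f (x - z) • (w x - w (x - z)) - f x • H x z‖ₑ ≤
      ∫⁻ θ in Ioc (0 : ℝ) 1, ‖z‖ₑ * ‖f (x - z) • H (x - θ • z) - f x • H x‖ₑ := by
    filter_upwards [hwH.sub_translate_eq hwm hHm z,
      ae_intervalIntegrable_translate hHm hwH.2.1 z] with x hx hi
    rw [hx]
    have hi' : IntegrableOn (fun θ : ℝ => H (x - θ • z)) (Ioc 0 1) := hi.1
    -- The interval has length one, so the term independent of `θ` may be put under the average as
    -- well.
    have e : f (x - z) • (∫ θ in (0 : ℝ)..1, H (x - θ • z) z) - f x • H x z =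
        ∫ θ in Ioc (0 : ℝ) 1, (f (x - z) • H (x - θ • z) - f x • H x) z := by
      have : ∀ θ : ℝ, (f (x - z) • H (x - θ • z) - f x • H x) z =
          f (x - z) • H (x - θ • z) z - f x • H x z := fun θ => by simp
      simp_rw [this]
      have i1 : IntegrableOn (fun θ : ℝ => f (x - z) • H (x - θ • z) z) (Ioc 0 1) :=
        by exact Integrable.smul (f (x - z)) (hi'.apply_continuousLinearMap z)
      rw [integral_sub i1 (integrable_const _), integral_smul,
        intervalIntegral.integral_of_le zero_le_one]
      simp
    rw [e]
    refine (enorm_integral_le_lintegral_enorm _).trans (lintegral_mono fun θ => ?_)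
    rw [mul_comm]
    exact ContinuousLinearMap.le_opENorm _ _
  refine (lintegral_mono_ae (ae_restrict_of_ae h1)).trans ?_
  have hm : Measurable (fun p : EuclideanSpace ℝ (Fin d) × ℝ =>
      ‖f (p.1 - z) • H (p.1 - p.2 • z) - f p.1 • H p.1‖ₑ) := by
    refine StronglyMeasurable.enorm (StronglyMeasurable.sub ?_ ?_)
    · exact (hf.comp_measurable (by fun_prop)).smul (hHm.comp_measurable (by fun_prop))
    · exact (hf.comp_measurable (by fun_prop)).smul (hHm.comp_measurable (by fun_prop))
  rw [lintegral_lintegral_swap (hm.const_mul _).aemeasurable]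
  calc ∫⁻ θ in Ioc (0 : ℝ) 1, ∫⁻ x in s, ‖z‖ₑ * ‖f (x - z) • H (x - θ • z) - f x • H x‖ₑ
      ≤ ∫⁻ θ in Ioc (0 : ℝ) 1, ‖z‖ₑ * M := by
        refine setLIntegral_mono' measurableSet_Ioc fun θ hθ => ?_
        rw [lintegral_const_mul _ (by
          exact hm.comp (f := fun x => (x, θ)) (by fun_prop))]
        gcongr
        exact hM θ hθ
    _ = ‖z‖ₑ * M := by simp

end WeakGradient

/-! ### The chain rule in time for absolutely continuous functions. -/

section ChainRule

theorem AbsolutelyContinuousOnInterval.lipschitz_comp {β U : ℝ → ℝ} {a b : ℝ} {K : ℝ≥0}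
    (hU : AbsolutelyContinuousOnInterval U a b) (hβ : LipschitzWith K β) :
    AbsolutelyContinuousOnInterval (fun t => β (U t)) a b := by
  unfold AbsolutelyContinuousOnInterval at hU ⊢
  have h := hU.const_mul (K : ℝ)
  rw [mul_zero] at h
  refine squeeze_zero (fun _ => Finset.sum_nonneg fun _ _ => dist_nonneg) (fun E => ?_) h
  rw [Finset.mul_sum]
  exact Finset.sum_le_sum fun i _ => hβ.dist_le_mul _ _

/-- The mollified flux is merely integrable in time, so the primitive is only absolutely continuous.
A Lipschitz `β` preserves absolute continuity, and the pointwise chain rule holds at almost every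
time, where the primitive is differentiable. -/
theorem integral_deriv_comp_mul_eq_sub {β F : ℝ → ℝ} {s u₀ : ℝ} {K : ℝ≥0}
    (hβ : LipschitzWith K β) (hβd : Differentiable ℝ β) (hF : IntervalIntegrable F volume 0 s) :
    ∫ t in 0..s, deriv β (u₀ + ∫ τ in 0..t, F τ) * F t =
      β (u₀ + ∫ τ in 0..s, F τ) - β u₀ := by
  have hc : AbsolutelyContinuousOnInterval (fun _ : ℝ => u₀) 0 s :=
    (LipschitzWith.const u₀).lipschitzOnWith.absolutelyContinuousOnInterval
  have hU : AbsolutelyContinuousOnInterval (fun t => u₀ + ∫ τ in 0..t, F τ) 0 s :=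
    hc.fun_add (hF.absolutelyContinuousOnInterval_intervalIntegral left_mem_uIcc)
  have := (hU.lipschitz_comp hβ).integral_deriv_eq_sub
  simp only [intervalIntegral.integral_same, add_zero] at this
  rw [← this]
  refine intervalIntegral.integral_congr_ae ?_
  filter_upwards [hF.ae_hasDerivAt_integral] with t ht hts
  have h1 := (ht (uIoc_subset_uIcc hts) 0 left_mem_uIcc).const_add u₀
  exact ((hβd _).hasDerivAt.comp t h1).deriv.symm

end ChainRule

/-! ### A smooth convex substitute for the negative part. -/

section SmoothNegPart

/-- A smooth convex approximation of the negative part. -/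
noncomputable def smoothNegPart (δ u : ℝ) : ℝ := (√(u ^ 2 + δ ^ 2) - δ - u) / 2

variable {δ : ℝ}

theorem smoothNegPart_zero (hδ : 0 < δ) : smoothNegPart δ 0 = 0 := by
  simp [smoothNegPart, Real.sqrt_sq hδ.le]

theorem contDiff_smoothNegPart (hδ : 0 < δ) {n : WithTop ℕ∞} : ContDiff ℝ n (smoothNegPart δ) := by
  unfold smoothNegPart
  have : ContDiff ℝ n (fun u : ℝ => √(u ^ 2 + δ ^ 2)) :=
    ContDiff.sqrt (by fun_prop) fun u => by positivity
  exact ((this.sub contDiff_const).sub contDiff_id).div_const 2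

theorem hasDerivAt_smoothNegPart (hδ : 0 < δ) (u : ℝ) :
    HasDerivAt (smoothNegPart δ) ((u / √(u ^ 2 + δ ^ 2) - 1) / 2) u := by
  have h1 : HasDerivAt (fun u : ℝ => u ^ 2 + δ ^ 2) (2 * u) u := by
    simpa using (hasDerivAt_pow 2 u).add_const (δ ^ 2)
  have h2 := h1.sqrt (by positivity)
  have h3 := ((h2.sub_const δ).sub (hasDerivAt_id u)).div_const 2
  refine h3.congr_deriv ?_
  have : √(u ^ 2 + δ ^ 2) ≠ 0 := by positivity
  field_simp

theorem deriv_smoothNegPart (hδ : 0 < δ) (u : ℝ) :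
    deriv (smoothNegPart δ) u = (u / √(u ^ 2 + δ ^ 2) - 1) / 2 :=
  (hasDerivAt_smoothNegPart hδ u).deriv

theorem abs_le_sqrt_sq_add (δ u : ℝ) : |u| ≤ √(u ^ 2 + δ ^ 2) :=
  Real.abs_le_sqrt (by nlinarith [sq_nonneg δ])

theorem abs_deriv_smoothNegPart_le (hδ : 0 < δ) (u : ℝ) : |deriv (smoothNegPart δ) u| ≤ 1 := by
  rw [deriv_smoothNegPart hδ]
  have h0 : 0 < √(u ^ 2 + δ ^ 2) := by positivity
  have h1 : |u / √(u ^ 2 + δ ^ 2)| ≤ 1 := by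
    rw [abs_div, abs_of_pos h0, div_le_one h0]
    exact abs_le_sqrt_sq_add δ u
  rw [abs_le] at h1 ⊢
  constructor <;> linarith

theorem lipschitzWith_smoothNegPart (hδ : 0 < δ) : LipschitzWith 1 (smoothNegPart δ) :=
  lipschitzWith_of_nnnorm_deriv_le (fun u => (hasDerivAt_smoothNegPart hδ u).differentiableAt)
    fun u => by
      rw [← NNReal.coe_le_coe]
      simpa using abs_deriv_smoothNegPart_le hδ u

theorem abs_smoothNegPart_le (hδ : 0 < δ) (u : ℝ) : |smoothNegPart δ u| ≤ |u| := by
  have := (lipschitzWith_smoothNegPart hδ).dist_le_mul u 0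
  simpa [smoothNegPart_zero hδ, Real.dist_eq] using this

/-- The shift by `-δ` in the definition gives the sign for nonnegative arguments, so nonnegative
initial data contribute nothing positive to the energy. -/
theorem smoothNegPart_nonpos (hδ : 0 < δ) {u : ℝ} (hu : 0 ≤ u) : smoothNegPart δ u ≤ 0 := by
  have : √(u ^ 2 + δ ^ 2) ≤ u + δ := Real.sqrt_le_iff.2 ⟨by positivity, by nlinarith⟩
  unfold smoothNegPart
  linarith

theorem max_neg_zero_le_smoothNegPart (hδ : 0 < δ) (u : ℝ) :
    max (-u) 0 ≤ smoothNegPart δ u + δ := by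
  have := abs_le_sqrt_sq_add δ u
  unfold smoothNegPart
  rw [abs_le'] at this
  refine max_le ?_ ?_ <;> linarith

/-- With `s = √(u² + δ²) ≥ δ` the defect of homogeneity is exactly `(δ²/s - δ)/2`. In the energy
inequality this factor multiplies the divergence of the field, so a divergence that is merely
locally integrable is harmless as `δ → 0`. -/
theorem abs_mul_deriv_smoothNegPart_sub_le (hδ : 0 < δ) (u : ℝ) :
    |smoothNegPart δ u - u * deriv (smoothNegPart δ) u| ≤ δ := by
  rw [deriv_smoothNegPart hδ]
  unfold smoothNegPart
  have h0 : 0 < √(u ^ 2 + δ ^ 2) := by positivity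
  have h2 : √(u ^ 2 + δ ^ 2) ^ 2 = u ^ 2 + δ ^ 2 := Real.sq_sqrt (by positivity)
  have h3 : δ ≤ √(u ^ 2 + δ ^ 2) := Real.le_sqrt_of_sq_le (by nlinarith [sq_nonneg u])
  set s := √(u ^ 2 + δ ^ 2)
  have e : (s - δ - u) / 2 - u * ((u / s - 1) / 2) = (δ * (δ / s) - δ) / 2 := by
    field_simp
    linear_combination h2
  have h4 : δ / s ≤ 1 := (div_le_one h0).2 h3
  have h5 : 0 ≤ δ / s := by positivity
  rw [e, abs_le]
  constructor <;> nlinarith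

/-- This tangent line inequality reduces to Cauchy–Schwarz for the plane vectors `(u, δ)` and `(v,
δ)`; the gap between the squares is `(δ(u - v))²`. -/
theorem deriv_smoothNegPart_mul_sub_le (hδ : 0 < δ) (u v : ℝ) :
    deriv (smoothNegPart δ) u * (v - u) ≤ smoothNegPart δ v - smoothNegPart δ u := by
  rw [deriv_smoothNegPart hδ]
  unfold smoothNegPart
  have h0 : 0 < √(u ^ 2 + δ ^ 2) := by positivity
  have h2 : √(u ^ 2 + δ ^ 2) ^ 2 = u ^ 2 + δ ^ 2 := Real.sq_sqrt (by positivity)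
  have h3 : u * v + δ ^ 2 ≤ √(u ^ 2 + δ ^ 2) * √(v ^ 2 + δ ^ 2) := by
    rw [← Real.sqrt_mul (by positivity)]
    refine Real.le_sqrt_of_sq_le ?_
    nlinarith [sq_nonneg (δ * (u - v))]
  set s := √(u ^ 2 + δ ^ 2)
  have e : (u / s - 1) / 2 * (v - u) = ((u * v + δ ^ 2) / s - s - v + u) / 2 := by
    field_simp
    linear_combination h2
  have h4 : (u * v + δ ^ 2) / s ≤ √(v ^ 2 + δ ^ 2) := by
    rw [div_le_iff₀ h0]; linarith
  rw [e]
  linarith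

end SmoothNegPart

/-! ### Mollifiers and the divergence. -/

section Mollifier

variable {d : ℕ}

/-- The divergence at a point of a vector field with the given derivative. -/
noncomputable def divergence (L : EuclideanSpace ℝ (Fin d) →L[ℝ] EuclideanSpace ℝ (Fin d)) : ℝ :=
  ∑ i, L (EuclideanSpace.single i 1) i

theorem continuous_divergence : Continuous (divergence (d := d)) := by
  unfold divergence
  fun_prop

theorem norm_divergence_le (L : EuclideanSpace ℝ (Fin d) →L[ℝ] EuclideanSpace ℝ (Fin d)) :
    ‖divergence L‖ ≤ d * ‖L‖ := by
  unfold divergence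
  refine (norm_sum_le _ _).trans ?_
  have : ∀ i ∈ Finset.univ, ‖L (EuclideanSpace.single i 1) i‖ ≤ ‖L‖ := fun i _ =>
    (PiLp.norm_apply_le _ i).trans ((L.le_opNorm _).trans (by simp))
  simpa using Finset.sum_le_sum this

/-- `ρ` is an even smooth probability density supported in the closed ball of radius `ε`. -/
structure IsMollifier (ρ : EuclideanSpace ℝ (Fin d) → ℝ) (ε : ℝ) : Prop where
  contDiff : ContDiff ℝ ((⊤ : ℕ∞) : WithTop ℕ∞) ρ
  hasCompactSupport : HasCompactSupport ρ
  nonneg : ∀ x, 0 ≤ ρ x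
  even : ∀ x, ρ (-x) = ρ x
  integral_eq_one : ∫ x, ρ x = 1
  eq_zero : ∀ x, ε < ‖x‖ → ρ x = 0

namespace IsMollifier

variable {ρ : EuclideanSpace ℝ (Fin d) → ℝ} {ε : ℝ}

theorem contDiff_one (h : IsMollifier ρ ε) : ContDiff ℝ 1 ρ :=
  h.contDiff.of_le (by exact_mod_cast le_top)

theorem continuous_fderiv (h : IsMollifier ρ ε) : Continuous (fderiv ℝ ρ) :=
  h.contDiff_one.continuous_fderiv (by simp)

theorem continuous (h : IsMollifier ρ ε) : Continuous ρ := h.contDiff.continuous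

theorem fderiv_eq_zero (h : IsMollifier ρ ε) {x : EuclideanSpace ℝ (Fin d)} (hx : ε < ‖x‖) :
    fderiv ℝ ρ x = 0 := by
  have : ρ =ᶠ[𝓝 x] fun _ => 0 := by
    filter_upwards [(isOpen_lt continuous_const continuous_norm).mem_nhds hx] with y hy
    exact h.eq_zero y hy
  rw [this.fderiv_eq]
  simp

theorem integrable (h : IsMollifier ρ ε) : Integrable ρ :=
  h.continuous.integrable_of_hasCompactSupport h.hasCompactSupport

theorem lintegral_enorm (h : IsMollifier ρ ε) : ∫⁻ x, ‖ρ x‖ₑ = 1 := by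
  have := ofReal_integral_norm_eq_lintegral_enorm h.integrable
  rw [← this]
  simp_rw [Real.norm_of_nonneg (h.nonneg _)]
  simp [h.integral_eq_one]

/-- Integration by parts against a linear field. -/
theorem integral_fderiv_apply_eq_neg_divergence (h : IsMollifier ρ ε)
    (L : EuclideanSpace ℝ (Fin d) →L[ℝ] EuclideanSpace ℝ (Fin d)) :
    ∫ z, fderiv ℝ ρ z (L z) = -divergence L := by
  have hc : ∀ v i, HasCompactSupport fun z => fderiv ℝ ρ z v * L z i := fun v i =>
    (h.hasCompactSupport.fderiv_apply (𝕜 := ℝ) v).mul_right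
  have hD := h.continuous_fderiv
  have hi : ∀ v i, Integrable fun z => fderiv ℝ ρ z v * L z i := fun v i =>
    Continuous.integrable_of_hasCompactSupport (by fun_prop) (hc v i)
  have e : ∀ z, fderiv ℝ ρ z (L z) =
      ∑ i, fderiv ℝ ρ z (EuclideanSpace.single i 1) * L z i := by
    intro z
    conv_lhs => rw [← (EuclideanSpace.basisFun (Fin d) ℝ).sum_repr (L z)]
    simp [mul_comm]
  simp_rw [e]
  rw [integral_finsetSum _ fun i _ => hi _ _, divergence, ← Finset.sum_neg_distrib]
  refine Finset.sum_congr rfl fun i _ => ?_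
  have hl : ∀ z v, fderiv ℝ (fun z => L z i) z v = L v i := by
    intro z v
    have : (fun z => L z i) = ⇑((EuclideanSpace.proj i).comp L) := rfl
    rw [this, ContinuousLinearMap.fderiv]
    rfl
  have hLd : Differentiable ℝ fun z => L z i := ((EuclideanSpace.proj i).comp L).differentiable
  have hLc : Continuous fun z => L z i := hLd.continuous
  have := integral_mul_fderiv_eq_neg_fderiv_mul_of_integrable (μ := volume) (f := fun z => L z i)
    (g := ρ) (v := EuclideanSpace.single i 1) ?_ ?_ ?_ (fun x _ => hLd x)
    (fun x _ => h.contDiff_one.differentiable (by simp) x)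
  · simp_rw [mul_comm _ (L _ i)]
    rw [this]
    simp_rw [hl]
    rw [integral_const_mul, h.integral_eq_one, mul_one]
  · simp_rw [hl]
    exact h.integrable.const_mul _
  · simp_rw [mul_comm (L _ i)]
    exact hi _ _
  · exact (hLc.mul h.continuous).integrable_of_hasCompactSupport h.hasCompactSupport.mul_left

end IsMollifier

/-- The scaling family of mollifiers generated by a fixed bump function. -/
theorem exists_isMollifier_seq (d : ℕ) :
    ∃ (ρ : ℕ → EuclideanSpace ℝ (Fin d) → ℝ) (C : ℝ≥0∞), C ≠ ∞ ∧
      ∀ n, IsMollifier (ρ n) (1 / (n + 1)) ∧ ∫⁻ z, ‖fderiv ℝ (ρ n) z‖ₑ * ‖z‖ₑ = C := by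
  let b : ContDiffBump (0 : EuclideanSpace ℝ (Fin d)) := ⟨1 / 2, 1, by norm_num, by norm_num⟩
  let ρ := b.normed volume
  have hρ : ContDiff ℝ ((⊤ : ℕ∞) : WithTop ℕ∞) ρ := b.contDiff_normed
  have hnn : ∀ x, 0 ≤ ρ x := b.nonneg_normed
  have hneg : ∀ x, ρ (-x) = ρ x := b.normed_neg
  have hint : ∫ x, ρ x = 1 := b.integral_normed
  have hs : Function.support ρ = Metric.ball 0 1 := b.support_normed_eq
  have hρc : HasCompactSupport ρ := b.hasCompactSupport_normed
  clear_value ρ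
  have hρ1 : ContDiff ℝ 1 ρ := hρ.of_le (by exact_mod_cast le_top)
  have hDc : Continuous (fderiv ℝ ρ) := hρ1.continuous_fderiv (by simp)
  have hk : ∀ n : ℕ, (0 : ℝ) < n + 1 := fun n => by positivity
  refine ⟨fun n x => ((n : ℝ) + 1) ^ d * ρ (((n : ℝ) + 1) • x),
    ∫⁻ z, ‖fderiv ℝ ρ z‖ₑ * ‖z‖ₑ, ?_, fun n => ⟨⟨?_, ?_, ?_, ?_, ?_, ?_⟩, ?_⟩⟩
  · have : Integrable (fun z => ‖fderiv ℝ ρ z‖ * ‖z‖) :=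
      Continuous.integrable_of_hasCompactSupport (by fun_prop) (hρc.fderiv ℝ).norm.mul_right
    have h2 := this.2
    simp only [HasFiniteIntegral, enorm_mul, enorm_norm] at h2
    exact h2.ne
  · exact contDiff_const.mul (hρ.comp (contDiff_const_smul _))
  · exact (hρc.comp_homeomorph (Homeomorph.smulOfNeZero _ (hk n).ne')).mul_left
  · intro x
    exact mul_nonneg (pow_nonneg (hk n).le _) (hnn _)
  · intro x
    simp only [smul_neg, hneg]
  · rw [integral_const_mul, Measure.integral_comp_smul_of_nonneg volume ρ _ (hR := (hk n).le), hint]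
    have := hk n
    simp
    field_simp
  · intro x hx
    have : ρ (((n : ℝ) + 1) • x) = 0 := by
      by_contra h0
      have h1 : ((n : ℝ) + 1) • x ∈ Metric.ball 0 1 := hs ▸ h0
      rw [mem_ball_zero_iff, norm_smul, Real.norm_of_nonneg (hk n).le] at h1
      rw [div_lt_iff₀ (hk n)] at hx
      linarith
    simp only [this, mul_zero]
  · have hD : ∀ z, fderiv ℝ (fun x => ((n : ℝ) + 1) ^ d * ρ (((n : ℝ) + 1) • x)) z =
        (((n : ℝ) + 1) ^ d * ((n : ℝ) + 1)) • fderiv ℝ ρ (((n : ℝ) + 1) • z) := by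
      intro z
      rw [fderiv_const_mul, fderiv_comp_smul, smul_smul]
      exact (hρ1.differentiable (by simp)).differentiableAt.comp z
        (differentiableAt_id.const_smul ((n : ℝ) + 1))
    -- Differentiating costs a factor `n + 1`, which is absorbed by `‖z‖` written in the rescaled
    -- variable. The first moment of the gradient is therefore scale invariant, which is what makes
    -- the commutator estimate uniform in `n`.
    have e : ∀ z, ‖fderiv ℝ (fun x => ((n : ℝ) + 1) ^ d * ρ (((n : ℝ) + 1) • x)) z‖ₑ * ‖z‖ₑ =
        ENNReal.ofReal (((n : ℝ) + 1) ^ d) * (fun y => ‖fderiv ℝ ρ y‖ₑ * ‖y‖ₑ)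
          (((n : ℝ) + 1) • z) := by
      intro z
      simp only []
      rw [hD, enorm_smul, enorm_mul, enorm_smul, Real.enorm_eq_ofReal (pow_nonneg (hk n).le _)]
      ring
    simp_rw [e]
    rw [lintegral_const_mul _ (by fun_prop)]
    have hmp := Measure.map_addHaar_smul (volume : Measure (EuclideanSpace ℝ (Fin d))) (hk n).ne'
    have hl := lintegral_map (μ := volume) (f := fun y => ‖fderiv ℝ ρ y‖ₑ * ‖y‖ₑ)
      (g := fun z => ((n : ℝ) + 1) • z) (by fun_prop) (by fun_prop)
    rw [← hl, hmp, lintegral_smul_measure, smul_eq_mul, ← mul_assoc,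
      ← ENNReal.ofReal_mul (pow_nonneg (hk n).le _)]
    have hf : Module.finrank ℝ (EuclideanSpace ℝ (Fin d)) = d := by simp
    rw [hf, abs_of_pos (by have := hk n; positivity), mul_inv_cancel₀ (pow_pos (hk n) d).ne']
    simp

end Mollifier

/-! ### Subordination of powers to exponentials. -/

section Bernstein

theorem one_sub_exp_neg_le (t : ℝ) : 1 - Real.exp (-t) ≤ t := by
  linarith [Real.add_one_le_exp (-t)]

/-- The integrand is at most `t ^ (-p)` near zero, which needs `p < 1`, and at most `t ^ (-1 - p)`
at infinity, which needs `p > 0`. -/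
theorem integrableOn_one_sub_exp_mul_rpow {p : ℝ} (hp0 : 0 < p) (hp1 : p < 1) :
    IntegrableOn (fun t : ℝ => (1 - Real.exp (-t)) * t ^ (-1 - p)) (Ioi 0) := by
  rw [← Ioc_union_Ioi_eq_Ioi zero_le_one, integrableOn_union]
  have hm : ∀ s : Set ℝ, AEStronglyMeasurable
      (fun t : ℝ => (1 - Real.exp (-t)) * t ^ (-1 - p)) (volume.restrict s) := fun s =>
    Measurable.aestronglyMeasurable (by fun_prop)
  constructor
  · have h : IntegrableOn (fun t : ℝ => t ^ (-p)) (Ioc 0 1) := by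
      rw [← intervalIntegrable_iff_integrableOn_Ioc_of_le zero_le_one]
      exact intervalIntegral.intervalIntegrable_rpow' (by linarith)
    refine Integrable.mono' h (hm _) ?_
    filter_upwards [ae_restrict_mem measurableSet_Ioc] with t ht
    have h1 : 0 ≤ 1 - Real.exp (-t) := by
      have := Real.exp_le_one_iff.2 (neg_nonpos.2 ht.1.le); linarith
    have h2 : 0 ≤ t ^ (-1 - p) := Real.rpow_nonneg ht.1.le _
    rw [Real.norm_of_nonneg (mul_nonneg h1 h2)]
    calc (1 - Real.exp (-t)) * t ^ (-1 - p) ≤ t ^ (1 : ℝ) * t ^ (-1 - p) := by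
          gcongr; simpa using one_sub_exp_neg_le t
      _ = t ^ (-p) := by rw [← Real.rpow_add ht.1]; congr 1; ring
  · refine Integrable.mono' (integrableOn_Ioi_rpow_of_lt (a := -1 - p) (by linarith) one_pos)
      (hm _) ?_
    filter_upwards [ae_restrict_mem measurableSet_Ioi] with t ht
    have ht0 : 0 < t := one_pos.trans ht
    have h1 : 0 ≤ 1 - Real.exp (-t) := by
      have := Real.exp_le_one_iff.2 (neg_nonpos.2 ht0.le); linarith
    have h2 : 0 ≤ t ^ (-1 - p) := Real.rpow_nonneg ht0.le _
    rw [Real.norm_of_nonneg (mul_nonneg h1 h2)]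
    exact mul_le_of_le_one_left h2 (by linarith [Real.exp_pos (-t)])

theorem integral_one_sub_exp_mul_rpow_pos {p : ℝ} (hp0 : 0 < p) (hp1 : p < 1) :
    0 < ∫ t in Ioi (0 : ℝ), (1 - Real.exp (-t)) * t ^ (-1 - p) := by
  have hpos : ∀ t ∈ Ioi (0 : ℝ), 0 < (1 - Real.exp (-t)) * t ^ (-1 - p) := fun t ht => by
    have h1 : Real.exp (-t) < 1 := by
      simpa using ht
    exact mul_pos (by linarith) (Real.rpow_pos_of_pos ht _)
  rw [setIntegral_pos_iff_support_of_nonneg_ae]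
  · have : Ioi (0 : ℝ) ⊆ (Function.support fun t : ℝ => (1 - Real.exp (-t)) * t ^ (-1 - p)) ∩
        Ioi 0 := fun t ht => ⟨(hpos t ht).ne', ht⟩
    exact lt_of_lt_of_le (by simp) (measure_mono this)
  · filter_upwards [ae_restrict_mem measurableSet_Ioi] with t ht using (hpos t ht).le
  · exact integrableOn_one_sub_exp_mul_rpow hp0 hp1

/-- The substitution `t ↦ l t` produces the power `l ^ p`: up to a positive constant, a power with
exponent in `(0, 1)` is a positive superposition of the functions `1 - exp (-t l)`. For `l = 0` both
sides vanish. -/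
theorem integrableOn_one_sub_exp_mul_rpow_scaled {p : ℝ} (hp0 : 0 < p) (hp1 : p < 1) {l : ℝ}
    (hl : 0 ≤ l) :
    IntegrableOn (fun t : ℝ => (1 - Real.exp (-(t * l))) * t ^ (-1 - p)) (Ioi 0) ∧
    ∫ t in Ioi (0 : ℝ), (1 - Real.exp (-(t * l))) * t ^ (-1 - p) =
      (∫ t in Ioi (0 : ℝ), (1 - Real.exp (-t)) * t ^ (-1 - p)) * l ^ p := by
  rcases hl.eq_or_lt with rfl | hl
  · simp [Real.zero_rpow hp0.ne']
  have e : ∀ t ∈ Ioi (0 : ℝ), (1 - Real.exp (-(t * l))) * t ^ (-1 - p) =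
      l ^ (1 + p) * (fun t => (1 - Real.exp (-t)) * t ^ (-1 - p)) (l * t) := by
    intro t ht
    have h0 : l ^ (1 + p) * l ^ (-1 - p) = 1 := by
      rw [← Real.rpow_add hl]; ring_nf; simp
    dsimp only
    rw [Real.mul_rpow hl.le (le_of_lt ht), mul_comm t l]
    linear_combination (-(1 - Real.exp (-(l * t))) * t ^ (-1 - p)) * h0
  constructor
  · rw [integrableOn_congr_fun e measurableSet_Ioi]
    refine Integrable.const_mul ?_ _
    have := (integrableOn_Ioi_comp_mul_left_iff
      (fun t : ℝ => (1 - Real.exp (-t)) * t ^ (-1 - p)) 0 hl).2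
    rw [mul_zero] at this
    exact this (integrableOn_one_sub_exp_mul_rpow hp0 hp1)
  · rw [setIntegral_congr_fun measurableSet_Ioi e, integral_const_mul,
      integral_comp_mul_left_Ioi (fun t => (1 - Real.exp (-t)) * t ^ (-1 - p)) _ hl, mul_zero, smul_eq_mul, Real.rpow_add hl, Real.rpow_one]
    field_simp

/-- Subordination: positivity against all the functions `1 - exp (-t λ)` implies positivity
against the Bernstein functions `λ ^ p`, `0 < p ≤ 1`. -/
theorem integral_rpow_mul_nonneg_of_forall_exp {X : Type*} [MeasurableSpace X] {μ : Measure X}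
    [SFinite μ] {l h : X → ℝ} (hl : Measurable l) (hl0 : ∀ x, 0 ≤ l x) (hh : Integrable h μ)
    (hlh : Integrable (fun x => l x * h x) μ)
    (hexp : ∀ t, 0 < t → 0 ≤ ∫ x, (1 - Real.exp (-(t * l x))) * h x ∂μ)
    {p : ℝ} (hp0 : 0 < p) (hp1 : p ≤ 1) : 0 ≤ ∫ x, l x ^ p * h x ∂μ := by
  have hE0 : ∀ t, 0 ≤ t → ∀ x, 0 ≤ 1 - Real.exp (-(t * l x)) := fun t ht x => by
    have := Real.exp_le_one_iff.2 (neg_nonpos.2 (mul_nonneg ht (hl0 x))); linarith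
  rcases hp1.lt_or_eq with hp1 | rfl
  · set K := ∫ t in Ioi (0 : ℝ), (1 - Real.exp (-t)) * t ^ (-1 - p) with hK
    have hKpos : 0 < K := integral_one_sub_exp_mul_rpow_pos hp0 hp1
    have hlp : Integrable (fun x => l x ^ p * h x) μ := by
      refine Integrable.mono' (hh.norm.add hlh.norm)
        ((hl.pow_const p).aestronglyMeasurable.mul hh.1) (Eventually.of_forall fun x => ?_)
      have h1 : l x ^ p ≤ 1 + l x := by
        rcases le_total (l x) 1 with h | h
        · have := Real.rpow_le_one (hl0 x) h hp0.le
          linarith [hl0 x]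
        · have := Real.rpow_le_rpow_of_exponent_le h hp1.le
          rw [Real.rpow_one] at this
          linarith
      simp only [Pi.add_apply, norm_mul]
      rw [Real.norm_of_nonneg (hl0 x), Real.norm_of_nonneg (Real.rpow_nonneg (hl0 x) _)]
      nlinarith [norm_nonneg (h x)]
    have hint : Integrable (fun q : X × ℝ => (1 - Real.exp (-(q.2 * l q.1))) * q.2 ^ (-1 - p) *
        h q.1) (μ.prod (volume.restrict (Ioi 0))) := by
      have hm : AEStronglyMeasurable (fun q : X × ℝ =>
          (1 - Real.exp (-(q.2 * l q.1))) * q.2 ^ (-1 - p) * h q.1)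
          (μ.prod (volume.restrict (Ioi 0))) := by
        refine AEStronglyMeasurable.mul ?_ hh.1.comp_fst
        have hl' : Measurable fun q : X × ℝ => l q.1 := hl.comp measurable_fst
        exact Measurable.aestronglyMeasurable (by fun_prop)
      rw [integrable_prod_iff hm]
      constructor
      · exact Eventually.of_forall fun x =>
          (integrableOn_one_sub_exp_mul_rpow_scaled hp0 hp1 (hl0 x)).1.mul_const (h x)
      · refine (hlp.norm.const_mul K).congr (Eventually.of_forall fun x => ?_)
        dsimp only
        have : ∀ t ∈ Ioi (0 : ℝ), ‖(1 - Real.exp (-(t * l x))) * t ^ (-1 - p) * h x‖ =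
            (1 - Real.exp (-(t * l x))) * t ^ (-1 - p) * ‖h x‖ := fun t ht => by
          rw [norm_mul, Real.norm_of_nonneg
            (mul_nonneg (hE0 t (le_of_lt ht) x) (Real.rpow_nonneg (le_of_lt ht) _))]
        rw [setIntegral_congr_fun measurableSet_Ioi this, integral_mul_const,
          (integrableOn_one_sub_exp_mul_rpow_scaled hp0 hp1 (hl0 x)).2, norm_mul,
          Real.norm_of_nonneg (Real.rpow_nonneg (hl0 x) _)]
        ring
    have e1 : K * ∫ x, l x ^ p * h x ∂μ =
        ∫ x, (∫ t in Ioi (0 : ℝ), (1 - Real.exp (-(t * l x))) * t ^ (-1 - p) * h x) ∂μ := by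
      rw [← integral_const_mul]
      congr 1 with x
      rw [integral_mul_const, (integrableOn_one_sub_exp_mul_rpow_scaled hp0 hp1 (hl0 x)).2]
      ring
    rw [integral_integral_swap hint] at e1
    have e2 : 0 ≤ K * ∫ x, l x ^ p * h x ∂μ := by
      rw [e1]
      refine setIntegral_nonneg measurableSet_Ioi fun t ht => ?_
      have : ∀ x, (1 - Real.exp (-(t * l x))) * t ^ (-1 - p) * h x =
          t ^ (-1 - p) * ((1 - Real.exp (-(t * l x))) * h x) := fun x => by ring
      simp_rw [this]
      rw [integral_const_mul]
      exact mul_nonneg (Real.rpow_nonneg (le_of_lt ht) _) (hexp t ht)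
    exact nonneg_of_mul_nonneg_right e2 hKpos
  · simp only [Real.rpow_one]
    -- For `p = 1` the subordination integral diverges at zero. The function `λ` is instead the
    -- limit of `(1 - exp (-t λ)) / t` as `t → 0`, with `λ` itself as a majorant.
    let t : ℕ → ℝ := fun n => 1 / ((n : ℝ) + 1)
    have ht0 : ∀ n, 0 < t n := fun n => Nat.one_div_pos_of_nat
    have htt : Tendsto t atTop (𝓝 0) := tendsto_one_div_add_atTop_nhds_zero_nat
    have hlim : Tendsto (fun n => ∫ x, (t n)⁻¹ * ((1 - Real.exp (-(t n * l x))) * h x) ∂μ) atTop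
        (𝓝 (∫ x, l x * h x ∂μ)) := by
      refine tendsto_integral_of_dominated_convergence (fun x => ‖l x * h x‖) (fun n => ?_)
        hlh.norm (fun n => Eventually.of_forall fun x => ?_) (Eventually.of_forall fun x => ?_)
      · refine AEStronglyMeasurable.const_mul (AEStronglyMeasurable.mul ?_ hh.1) _
        exact Measurable.aestronglyMeasurable (by fun_prop)
      · rw [← mul_assoc, norm_mul, norm_mul]
        rw [norm_mul (l x)]
        refine mul_le_mul_of_nonneg_right ?_ (norm_nonneg _)
        rw [← norm_mul, Real.norm_of_nonneg (mul_nonneg (inv_nonneg.2 (ht0 n).le) (hE0 _ (ht0 n).le x)),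
          Real.norm_of_nonneg (hl0 x), inv_mul_le_iff₀ (ht0 n)]
        exact one_sub_exp_neg_le _
      · have hd : HasDerivAt (fun s : ℝ => 1 - Real.exp (-(s * l x))) (l x) 0 := by
          have h1 : HasDerivAt (fun s : ℝ => -(s * l x)) (-(1 * l x)) 0 :=
            ((hasDerivAt_id 0).mul_const (l x)).neg
          simpa using h1.exp.const_sub 1
        have htt' : Tendsto t atTop (𝓝[≠] 0) :=
          tendsto_nhdsWithin_iff.2 ⟨htt, Eventually.of_forall fun n => (ht0 n).ne'⟩
        have := (hasDerivAt_iff_tendsto_slope_zero.1 hd).comp htt'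
        simp only [Function.comp_def, zero_add, zero_mul, neg_zero, Real.exp_zero, sub_self,
          sub_zero, smul_eq_mul] at this
        simpa only [mul_assoc] using this.mul_const (h x)
    refine ge_of_tendsto' hlim fun n => ?_
    rw [integral_const_mul]
    exact mul_nonneg (inv_nonneg.2 (ht0 n).le) (hexp _ (ht0 n))

end Bernstein

/-! ### Positivity of fractional symbols against functions with a maximum at the origin. -/

section FourierPositivity

variable {d : ℕ}

theorem integral_fourierInv_mul_eq_flip {f g : EuclideanSpace ℝ (Fin d) → ℂ} (hf : Integrable f)
    (hg : Integrable g) : ∫ x, 𝓕⁻ f x * g x = ∫ x, f x * 𝓕⁻ g x := by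
  have hL : (-innerₗ (EuclideanSpace ℝ (Fin d))).flip = -innerₗ (EuclideanSpace ℝ (Fin d)) := by
    ext x y; simp [real_inner_comm]
  have := VectorFourier.integral_fourierIntegral_smul_eq_flip
    (L := -innerₗ (EuclideanSpace ℝ (Fin d))) (μ := volume) (ν := volume)
    Real.continuous_fourierChar (by simpa using! continuous_inner.neg) hf hg
  rw [hL] at this
  exact this

theorem integral_fourier_mul_eq_flip {f g : EuclideanSpace ℝ (Fin d) → ℂ} (hf : Integrable f)
    (hg : Integrable g) : ∫ x, 𝓕 f x * g x = ∫ x, f x * 𝓕 g x := by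
  have := VectorFourier.integral_fourierIntegral_smul_eq_flip
    (L := innerₗ (EuclideanSpace ℝ (Fin d))) (μ := volume) (ν := volume)
    Real.continuous_fourierChar (by simpa using continuous_inner) hf hg
  rw [flip_innerₗ] at this
  exact this

/-- If the real part of the inverse Fourier transform of `H` is maximal at the origin, then `H` is
nonnegative against the symbols of the fractional Laplacians. -/
theorem integral_rpow_norm_mul_re_nonneg {H : EuclideanSpace ℝ (Fin d) → ℂ} (hH : Integrable H)
    (hH2 : Integrable fun ξ => (‖ξ‖ ^ 2 : ℝ) • H ξ) (hmax : ∀ z, (𝓕⁻ H z).re ≤ (𝓕⁻ H 0).re)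
    {α : ℝ} (hα₀ : 0 < α) (hα₂ : α ≤ 2) :
    0 ≤ ∫ ξ, (2 * Real.pi * ‖ξ‖) ^ α * (H ξ).re := by
  have e : ∀ ξ : EuclideanSpace ℝ (Fin d),
      (2 * Real.pi * ‖ξ‖) ^ α = ((2 * Real.pi * ‖ξ‖) ^ 2) ^ (α / 2) := by
    intro ξ
    rw [← Real.rpow_natCast, ← Real.rpow_mul (by positivity)]
    congr 1
    push_cast
    ring
  simp_rw [e]
  refine integral_rpow_mul_nonneg_of_forall_exp (by fun_prop) (fun ξ => by positivity) hH.re ?_ ?_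
    (by positivity) (by linarith)
  · refine (hH2.re.const_mul ((2 * Real.pi) ^ 2)).congr (Eventually.of_forall fun ξ => ?_)
    simp only [RCLike.re_to_complex, Complex.real_smul, Complex.re_ofReal_mul]
    ring
  intro t ht
  -- This width makes the inverse transform of the Gaussian equal to `c exp (-t (2π‖w‖)²)`. The
  -- constant `c` is also the total mass of the Gaussian, so it cancels at the end.
  let b : ℝ := 1 / (4 * t)
  have hb : 0 < b := by positivity
  let c : ℝ := (Real.pi / b) ^ ((Module.finrank ℝ (EuclideanSpace ℝ (Fin d)) : ℝ) / 2)
  have hc : 0 < c := by positivity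
  let γ : EuclideanSpace ℝ (Fin d) → ℂ := fun v => Complex.exp (-(b : ℂ) * ‖v‖ ^ 2)
  have hγr : ∀ v, γ v = ((Real.exp (-b * ‖v‖ ^ 2) : ℝ) : ℂ) := fun v => by
    simp [γ]
  have hγ : Integrable γ := by
    have := GaussianFourier.integrable_cexp_neg_mul_sq_norm_add (V := EuclideanSpace ℝ (Fin d))
      (b := b) (by simpa using hb) 0 0
    simpa [γ] using this
  have hFγ : ∀ w, 𝓕⁻ γ w = ((c * Real.exp (-(t * (2 * Real.pi * ‖w‖) ^ 2)) : ℝ) : ℂ) := by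
    intro w
    rw [Real.fourierInv_eq_fourier_neg, fourier_gaussian_innerProductSpace (by simpa using hb)]
    rw [Complex.ofReal_mul, Complex.ofReal_cpow (by positivity)]
    congr 1
    · push_cast; rfl
    · push_cast
      congr 1
      have : (t : ℂ) ≠ 0 := by exact_mod_cast ht.ne'
      simp only [b, norm_neg]
      push_cast
      field_simp
      ring
  have hFHc : Continuous (𝓕⁻ H) :=
    VectorFourier.fourierIntegral_continuous Real.continuous_fourierChar
      (by simpa using! continuous_inner.neg) hH
  have hFHb : ∀ z, ‖𝓕⁻ H z‖ ≤ ∫ ξ, ‖H ξ‖ := fun z =>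
    VectorFourier.norm_fourierIntegral_le_integral_norm _ _ _ _ _
  have key := integral_fourierInv_mul_eq_flip hγ hH
  have i1 : Integrable (fun x => γ x * 𝓕⁻ H x) volume :=
    hγ.mul_bdd (g := 𝓕⁻ H) (c := ∫ ξ, ‖H ξ‖) hFHc.aestronglyMeasurable
      (Eventually.of_forall fun z => hFHb z)
  have hcγ : ∫ x : EuclideanSpace ℝ (Fin d), Real.exp (-b * ‖x‖ ^ 2) = c := by
    rw [GaussianFourier.integral_rexp_neg_mul_sq_norm hb]
  have hγi : Integrable fun x : EuclideanSpace ℝ (Fin d) => Real.exp (-b * ‖x‖ ^ 2) := by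
    refine hγ.re.congr (Eventually.of_forall fun x => ?_)
    simp only [hγr, RCLike.re_to_complex, Complex.ofReal_re]
  have h0 : (𝓕⁻ H 0).re = ∫ ξ, (H ξ).re := by
    rw [Real.fourierInv_eq]
    simp only [inner_zero_right, AddChar.map_zero_eq_one, one_smul]
    exact (integral_re hH).symm
  have i2 : Integrable fun ξ => Real.exp (-(t * (2 * Real.pi * ‖ξ‖) ^ 2)) * (H ξ).re := by
    refine hH.re.bdd_mul (c := 1) (Continuous.aestronglyMeasurable (by fun_prop))
      (Eventually.of_forall fun ξ => ?_)
    rw [Real.norm_of_nonneg (Real.exp_pos _).le]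
    exact Real.exp_le_one_iff.2 (by simp; positivity)
  have lhs : (∫ x, 𝓕⁻ γ x * H x).re =
      c * ∫ ξ, Real.exp (-(t * (2 * Real.pi * ‖ξ‖) ^ 2)) * (H ξ).re := by
    have hi : Integrable fun x => 𝓕⁻ γ x * H x := by
      refine hH.bdd_mul (c := ∫ ξ, ‖γ ξ‖) ?_ (Eventually.of_forall fun z =>
        VectorFourier.norm_fourierIntegral_le_integral_norm _ _ _ _ _)
      rw [funext hFγ]
      exact Continuous.aestronglyMeasurable (by fun_prop)
    have : ∫ x, (𝓕⁻ γ x * H x).re = (∫ x, 𝓕⁻ γ x * H x).re := integral_re hi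
    rw [← this, ← integral_const_mul]
    congr 1 with ξ
    rw [hFγ, Complex.re_ofReal_mul, mul_assoc]
  -- Averaging against a positive kernel of mass `c` cannot exceed `c` times the maximum, and the
  -- value at the origin is the integral of `H`.
  have rhs : (∫ x, γ x * 𝓕⁻ H x).re ≤ c * ∫ ξ, (H ξ).re := by
    have : ∫ x, (γ x * 𝓕⁻ H x).re = (∫ x, γ x * 𝓕⁻ H x).re := integral_re i1
    rw [← this, ← h0, ← hcγ, ← integral_mul_const]
    refine integral_mono ?_ (hγi.mul_const _) fun x => ?_
    · exact i1.re
    · dsimp only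
      rw [hγr, Complex.re_ofReal_mul]
      exact mul_le_mul_of_nonneg_left (hmax x) (Real.exp_pos _).le
  rw [← key, lhs] at rhs
  have := le_of_mul_le_mul_left rhs hc
  have hHre : Integrable fun ξ => (H ξ).re := hH.re
  simp only [RCLike.re_to_complex, sub_mul, one_mul]
  rw [integral_sub hHre i2]
  exact sub_nonneg.2 this

end FourierPositivity

/-! ### Fourier transforms of test functions and Parseval identities. -/

section TestFourier

variable {d : ℕ}

theorem integrable_complex_ofReal {W : EuclideanSpace ℝ (Fin d) → ℝ} (hW : Integrable W) :
    Integrable fun y => (W y : ℂ) := hW.ofReal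

theorem integrable_pow_mul_fourier_of_test {g : EuclideanSpace ℝ (Fin d) → ℝ}
    (hg : ContDiff ℝ ((⊤ : ℕ∞) : WithTop ℕ∞) g) (hgc : HasCompactSupport g) (k : ℕ) :
    Integrable fun ξ => ‖ξ‖ ^ k * ‖𝓕 (fun y => (g y : ℂ)) ξ‖ := by
  have h1 : ContDiff ℝ ((⊤ : ℕ∞) : WithTop ℕ∞) fun y => (g y : ℂ) :=
    Complex.ofRealCLM.contDiff.comp hg
  have h2 : HasCompactSupport fun y => (g y : ℂ) := hgc.comp_left Complex.ofReal_zero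
  exact (𝓕 (h2.toSchwartzMap h1)).integrable_pow_mul volume k

theorem continuous_fourier_of_integrable {g : EuclideanSpace ℝ (Fin d) → ℂ} (hg : Integrable g) :
    Continuous (𝓕 g) :=
  VectorFourier.fourierIntegral_continuous Real.continuous_fourierChar
    (by simpa using! continuous_inner) hg

theorem continuous_fourierInv_of_integrable {g : EuclideanSpace ℝ (Fin d) → ℂ}
    (hg : Integrable g) : Continuous (𝓕⁻ g) :=
  VectorFourier.fourierIntegral_continuous Real.continuous_fourierChar
    (by simpa using! continuous_inner.neg) hg

theorem norm_fourier_le {g : EuclideanSpace ℝ (Fin d) → ℂ} (ξ : EuclideanSpace ℝ (Fin d)) :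
    ‖𝓕 g ξ‖ ≤ ∫ y, ‖g y‖ :=
  VectorFourier.norm_fourierIntegral_le_integral_norm _ _ _ _ _

theorem norm_fourierInv_le {g : EuclideanSpace ℝ (Fin d) → ℂ} (ξ : EuclideanSpace ℝ (Fin d)) :
    ‖𝓕⁻ g ξ‖ ≤ ∫ y, ‖g y‖ :=
  VectorFourier.norm_fourierIntegral_le_integral_norm _ _ _ _ _

theorem integrable_fourier_of_test {g : EuclideanSpace ℝ (Fin d) → ℝ}
    (hg : ContDiff ℝ ((⊤ : ℕ∞) : WithTop ℕ∞) g) (hgc : HasCompactSupport g) :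
    Integrable (𝓕 fun y => (g y : ℂ)) := by
  have h := integrable_pow_mul_fourier_of_test hg hgc 0
  simp only [pow_zero, one_mul] at h
  refine (integrable_norm_iff ?_).1 h
  exact (continuous_fourier_of_integrable
    (hg.continuous.integrable_of_hasCompactSupport hgc).ofReal).aestronglyMeasurable

theorem fourierInv_fourier_of_test {g : EuclideanSpace ℝ (Fin d) → ℝ}
    (hg : ContDiff ℝ ((⊤ : ℕ∞) : WithTop ℕ∞) g) (hgc : HasCompactSupport g)
    (y : EuclideanSpace ℝ (Fin d)) : 𝓕⁻ (𝓕 fun y => (g y : ℂ)) y = g y := by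
  have hc : Continuous fun y => (g y : ℂ) := Complex.continuous_ofReal.comp hg.continuous
  rw [hc.fourierInv_fourier_eq (hg.continuous.integrable_of_hasCompactSupport hgc).ofReal
    (integrable_fourier_of_test hg hgc)]

theorem fourier_comp_sub (g : EuclideanSpace ℝ (Fin d) → ℂ) (x ξ : EuclideanSpace ℝ (Fin d)) :
    𝓕 (fun y => g (y - x)) ξ = Real.fourierChar (-inner ℝ ξ x) • 𝓕 g ξ := by
  have := congrFun (VectorFourier.fourierIntegral_comp_add_right Real.fourierChar volume
    (innerₗ (EuclideanSpace ℝ (Fin d))) g (-x)) ξ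
  have e : (g ∘ fun v => v + -x) = fun y => g (y - x) := by ext y; simp [sub_eq_add_neg]
  rw [e] at this
  have h2 : (innerₗ (EuclideanSpace ℝ (Fin d))) (-x) ξ = -inner ℝ ξ x := by
    simp [real_inner_comm]
  rw [h2] at this
  exact this

theorem fourierInv_char_smul (K : EuclideanSpace ℝ (Fin d) → ℂ) (z y : EuclideanSpace ℝ (Fin d)) :
    𝓕⁻ (fun ξ => Real.fourierChar (inner ℝ ξ z) • K ξ) y = 𝓕⁻ K (y + z) := by
  simp_rw [Real.fourierInv_eq, smul_smul, ← AddChar.map_add_eq_mul, inner_add_right]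

theorem integral_mul_fourierInv_re {W : EuclideanSpace ℝ (Fin d) → ℝ}
    {K : EuclideanSpace ℝ (Fin d) → ℂ} (hW : Integrable W) (hK : Integrable K) :
    ∫ y, W y * (𝓕⁻ K y).re = (∫ ξ, K ξ * 𝓕⁻ (fun y => (W y : ℂ)) ξ).re := by
  rw [← integral_fourierInv_mul_eq_flip hK (integrable_complex_ofReal hW)]
  have hi : Integrable fun y => 𝓕⁻ K y * (W y : ℂ) :=
    (integrable_complex_ofReal hW).bdd_mul (c := ∫ y, ‖K y‖) (continuous_fourierInv_of_integrable hK).aestronglyMeasurable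
      (Eventually.of_forall fun ξ => norm_fourierInv_le ξ)
  have : ∫ y, (𝓕⁻ K y * (W y : ℂ)).re = (∫ y, 𝓕⁻ K y * (W y : ℂ)).re := integral_re hi
  rw [← this]
  congr 1 with y
  rw [Complex.re_mul_ofReal, mul_comm]

theorem integral_mul_fourier_re {W : EuclideanSpace ℝ (Fin d) → ℝ}
    {K : EuclideanSpace ℝ (Fin d) → ℂ} (hW : Integrable W) (hK : Integrable K) :
    ∫ y, W y * (𝓕 K y).re = (∫ ξ, K ξ * 𝓕 (fun y => (W y : ℂ)) ξ).re := by
  rw [← integral_fourier_mul_eq_flip hK (integrable_complex_ofReal hW)]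
  have hi : Integrable fun y => 𝓕 K y * (W y : ℂ) :=
    (integrable_complex_ofReal hW).bdd_mul (c := ∫ y, ‖K y‖) (continuous_fourier_of_integrable hK).aestronglyMeasurable
      (Eventually.of_forall fun ξ => norm_fourier_le ξ)
  have : ∫ y, (𝓕 K y * (W y : ℂ)).re = (∫ y, 𝓕 K y * (W y : ℂ)).re := integral_re hi
  rw [← this]
  congr 1 with y
  rw [Complex.re_mul_ofReal, mul_comm]

/-- Parseval identity for a Fourier multiplier with symbol `m` acting on the translates of `ρ`. -/
theorem integral_mul_integral_mul_multiplier {χ f ρ : EuclideanSpace ℝ (Fin d) → ℝ}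
    (hχ : Integrable χ) (hf : Integrable f)
    {m : EuclideanSpace ℝ (Fin d) → ℂ}
    (hm : Integrable fun ξ => m ξ * 𝓕 (fun y => (ρ y : ℂ)) ξ) :
    ∫ x, χ x * ∫ y, f y * (𝓕⁻ (fun ξ => m ξ * 𝓕 (fun y => ((ρ (y - x) : ℝ) : ℂ)) ξ) y).re =
      (∫ ξ, m ξ * (𝓕 (fun y => (ρ y : ℂ)) ξ * 𝓕⁻ (fun y => (f y : ℂ)) ξ *
        𝓕 (fun y => (χ y : ℂ)) ξ)).re := by
  have hK : Integrable fun ξ =>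
      m ξ * 𝓕 (fun y => (ρ y : ℂ)) ξ * 𝓕⁻ (fun y => (f y : ℂ)) ξ :=
    hm.mul_bdd (c := ∫ y, ‖(f y : ℂ)‖)
      (continuous_fourierInv_of_integrable (integrable_complex_ofReal hf)).aestronglyMeasurable
      (Eventually.of_forall fun ξ => norm_fourierInv_le ξ)
  have e1 : ∀ x, ∫ y, f y *
      (𝓕⁻ (fun ξ => m ξ * 𝓕 (fun y => ((ρ (y - x) : ℝ) : ℂ)) ξ) y).re =
      (𝓕 (fun ξ => m ξ * 𝓕 (fun y => (ρ y : ℂ)) ξ * 𝓕⁻ (fun y => (f y : ℂ)) ξ) x).re := by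
    intro x
    have e2 : (fun ξ => m ξ * 𝓕 (fun y => ((ρ (y - x) : ℝ) : ℂ)) ξ) = fun ξ =>
        Real.fourierChar (-inner ℝ ξ x) • (m ξ * 𝓕 (fun y => (ρ y : ℂ)) ξ) := by
      ext ξ
      rw [fourier_comp_sub (fun y => (ρ y : ℂ)), Circle.smul_def, Circle.smul_def, smul_eq_mul,
        smul_eq_mul]
      ring
    rw [e2, integral_mul_fourierInv_re hf, Real.fourier_eq]
    · simp only [smul_mul_assoc]
    · exact (Real.fourierIntegral_convergent_iff x).2 hm
  simp_rw [e1]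
  rw [integral_mul_fourier_re hχ hK]
  simp only [mul_assoc]

end TestFourier

/-! ### Mollified densities and the convexity inequality for the fractional Laplacian. -/

section Mollified

variable {d : ℕ}

/-- The mollification of `f` by `ρ`. -/
noncomputable def mollify (ρ f : EuclideanSpace ℝ (Fin d) → ℝ) (x : EuclideanSpace ℝ (Fin d)) : ℝ :=
  ∫ y, f y * ρ (x - y)

namespace IsMollifier

open scoped Convolution

variable {ρ f : EuclideanSpace ℝ (Fin d) → ℝ} {ε : ℝ}

theorem mollify_eq_convolution (ρ f : EuclideanSpace ℝ (Fin d) → ℝ) :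
    mollify ρ f = f ⋆[ContinuousLinearMap.lsmul ℝ ℝ, volume] ρ := by
  ext x
  simp [mollify, convolution_def]

theorem integrable_mollify (h : IsMollifier ρ ε) (hf : Integrable f) :
    Integrable (mollify ρ f) := by
  rw [mollify_eq_convolution]
  exact hf.integrable_convolution _ h.integrable

theorem contDiff_mollify (h : IsMollifier ρ ε) (hf : Integrable f) :
    ContDiff ℝ ((⊤ : ℕ∞) : WithTop ℕ∞) (mollify ρ f) := by
  rw [mollify_eq_convolution]
  exact h.hasCompactSupport.contDiff_convolution_right _ hf.locallyIntegrable h.contDiff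

theorem fderiv_mollify (h : IsMollifier ρ ε) (hf : Integrable f)
    (x e : EuclideanSpace ℝ (Fin d)) :
    fderiv ℝ (mollify ρ f) x e = ∫ y, f y * fderiv ℝ ρ (x - y) e := by
  rw [mollify_eq_convolution, (h.hasCompactSupport.hasFDerivAt_convolution_right
    (ContinuousLinearMap.lsmul ℝ ℝ) hf.locallyIntegrable h.contDiff_one x).fderiv]
  have hc := (h.hasCompactSupport.fderiv ℝ).convolutionExists_right
    (ContinuousLinearMap.precompR (EuclideanSpace ℝ (Fin d)) (ContinuousLinearMap.lsmul ℝ ℝ))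
    hf.locallyIntegrable h.continuous_fderiv x
  rw [convolution_def, ContinuousLinearMap.integral_apply hc]
  simp

end IsMollifier

variable {ρ f φ : EuclideanSpace ℝ (Fin d) → ℝ} {ε : ℝ}

theorem rpow_le_one_add_sq {s α : ℝ} (hs : 0 ≤ s) (hα₀ : 0 < α) (hα₂ : α ≤ 2) :
    s ^ α ≤ 1 + s ^ 2 := by
  rcases le_total s 1 with h | h
  · have := Real.rpow_le_one hs h hα₀.le
    nlinarith
  · have := Real.rpow_le_rpow_of_exponent_le h hα₂
    rw [Real.rpow_two] at this
    linarith

theorem integrable_rpow_mul_fourier_of_test {g : EuclideanSpace ℝ (Fin d) → ℝ}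
    (hg : ContDiff ℝ ((⊤ : ℕ∞) : WithTop ℕ∞) g) (hgc : HasCompactSupport g)
    {α : ℝ} (hα₀ : 0 < α) (hα₂ : α ≤ 2) :
    Integrable fun ξ : EuclideanSpace ℝ (Fin d) =>
      (((2 * Real.pi * ‖ξ‖) ^ α : ℝ) : ℂ) * 𝓕 (fun y => (g y : ℂ)) ξ := by
  have h0 := integrable_fourier_of_test hg hgc
  have h2 := integrable_pow_mul_fourier_of_test hg hgc 2
  refine Integrable.mono' (h0.norm.add (h2.const_mul ((2 * Real.pi) ^ 2))) ?_ ?_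
  · refine AEStronglyMeasurable.mul ?_ h0.1
    exact Measurable.aestronglyMeasurable (by fun_prop)
  · refine Eventually.of_forall fun ξ => ?_
    rw [norm_mul, Complex.norm_real, Real.norm_of_nonneg (by positivity)]
    have := rpow_le_one_add_sq (s := 2 * Real.pi * ‖ξ‖) (by positivity) hα₀ hα₂
    simp only [Pi.add_apply]
    calc _ ≤ (1 + (2 * Real.pi * ‖ξ‖) ^ 2) * ‖𝓕 (fun y => (g y : ℂ)) ξ‖ := by gcongr
      _ = _ := by ring

/-- The Córdoba–Córdoba inequality for the convex function `smoothNegPart δ`, integrated against a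
nonnegative test function and transposed. -/
theorem neg_integral_mul_fracLaplacian_le (hρ : IsMollifier ρ ε) (hf : Integrable f)
    (hφ : ContDiff ℝ ((⊤ : ℕ∞) : WithTop ℕ∞) φ) (hφc : HasCompactSupport φ) (hφ0 : ∀ x, 0 ≤ φ x)
    {δ α : ℝ} (hδ : 0 < δ) (hα₀ : 0 < α) (hα₂ : α ≤ 2) :
    -∫ x, φ x * deriv (smoothNegPart δ) (mollify ρ f x) *
        ∫ y, f y * fracLaplacian α (fun y => ρ (x - y)) y ≤
      -∫ x, smoothNegPart δ (mollify ρ f x) * fracLaplacian α φ x := by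
  set u := mollify ρ f with hu
  have huc : Continuous u := (hρ.contDiff_mollify hf).continuous
  have hui : Integrable u := hρ.integrable_mollify hf
  have hβc : Continuous (smoothNegPart δ) := (contDiff_smoothNegPart hδ (n := 0)).continuous
  have hβ'c : Continuous (deriv (smoothNegPart δ)) :=
    (contDiff_smoothNegPart hδ (n := 1)).continuous_deriv (by simp)
  set χ : EuclideanSpace ℝ (Fin d) → ℝ := fun x => φ x * deriv (smoothNegPart δ) (u x) with hχdef
  set W : EuclideanSpace ℝ (Fin d) → ℝ := fun x => smoothNegPart δ (u x) with hWdef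
  have hχc : Continuous χ := hφ.continuous.mul (hβ'c.comp huc)
  have hχs : HasCompactSupport χ := hφc.mul_right
  have hχ : Integrable χ := hχc.integrable_of_hasCompactSupport hχs
  have hWc : Continuous W := hβc.comp huc
  have hW : Integrable W := by
    refine Integrable.mono hui hWc.aestronglyMeasurable (Eventually.of_forall fun x => ?_)
    exact abs_smoothNegPart_le hδ _
  have hρx : ∀ x, (fun y => ρ (x - y)) = fun y => ρ (y - x) := fun x => by
    ext y; rw [← hρ.even, neg_sub]
  -- `H1` and `H2` are the frequency densities of the pairings of `χ` with `u` and of `φ` with `W`.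
  -- Inserting a character as multiplier gives the correlations with translates; inserting `|2πξ|^α`
  -- gives the two fractional Laplacian terms.
  let H1 : EuclideanSpace ℝ (Fin d) → ℂ := fun ξ => 𝓕 (fun y => (ρ y : ℂ)) ξ *
    𝓕⁻ (fun y => (f y : ℂ)) ξ * 𝓕 (fun y => (χ y : ℂ)) ξ
  let H2 : EuclideanSpace ℝ (Fin d) → ℂ := fun ξ => 𝓕 (fun y => (φ y : ℂ)) ξ *
    𝓕⁻ (fun y => (W y : ℂ)) ξ
  have hb1 : ∀ m : EuclideanSpace ℝ (Fin d) → ℂ,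
      Integrable (fun ξ => m ξ * 𝓕 (fun y => (ρ y : ℂ)) ξ) → Integrable fun ξ => m ξ * H1 ξ := by
    intro m hm
    have h1 := hm.mul_bdd (c := ∫ y, ‖(f y : ℂ)‖)
      (continuous_fourierInv_of_integrable (integrable_complex_ofReal hf)).aestronglyMeasurable
      (Eventually.of_forall fun ξ => norm_fourierInv_le ξ)
    have h2 := h1.mul_bdd (c := ∫ y, ‖(χ y : ℂ)‖)
      (continuous_fourier_of_integrable (integrable_complex_ofReal hχ)).aestronglyMeasurable
      (Eventually.of_forall fun ξ => norm_fourier_le ξ)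
    exact h2.congr (Eventually.of_forall fun ξ => by simp only [H1]; ring)
  have hb2 : ∀ m : EuclideanSpace ℝ (Fin d) → ℂ,
      Integrable (fun ξ => m ξ * 𝓕 (fun y => (φ y : ℂ)) ξ) → Integrable fun ξ => m ξ * H2 ξ := by
    intro m hm
    have h1 := hm.mul_bdd (c := ∫ y, ‖(W y : ℂ)‖)
      (continuous_fourierInv_of_integrable (integrable_complex_ofReal hW)).aestronglyMeasurable
      (Eventually.of_forall fun ξ => norm_fourierInv_le ξ)
    exact h1.congr (Eventually.of_forall fun ξ => by simp only [H2]; ring)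
  have hFρ := integrable_fourier_of_test hρ.contDiff hρ.hasCompactSupport
  have hFφ := integrable_fourier_of_test hφ hφc
  have hH1 : Integrable H1 := by simpa using hb1 (fun _ => 1) (by simpa using hFρ)
  have hH2 : Integrable H2 := by simpa using hb2 (fun _ => 1) (by simpa using hFφ)
  have hsq : ∀ {g : EuclideanSpace ℝ (Fin d) → ℝ}, ContDiff ℝ ((⊤ : ℕ∞) : WithTop ℕ∞) g →
      HasCompactSupport g → Integrable fun ξ : EuclideanSpace ℝ (Fin d) =>
        ((‖ξ‖ ^ 2 : ℝ) : ℂ) * 𝓕 (fun y => (g y : ℂ)) ξ := by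
    intro g hg hgc
    refine (integrable_norm_iff ?_).1 ?_
    · refine AEStronglyMeasurable.mul ?_ (integrable_fourier_of_test hg hgc).1
      exact Continuous.aestronglyMeasurable (by fun_prop)
    · refine (integrable_pow_mul_fourier_of_test hg hgc 2).congr
        (Eventually.of_forall fun ξ => ?_)
      simp
  have hHsq : Integrable fun ξ => (‖ξ‖ ^ 2 : ℝ) • (H1 ξ - H2 ξ) := by
    refine ((hb1 _ (hsq hρ.contDiff hρ.hasCompactSupport)).sub (hb2 _ (hsq hφ hφc))).congr
      (Eventually.of_forall fun ξ => ?_)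
    simp only [Pi.sub_apply, Complex.real_smul]
    ring
  have hFinv : ∀ z, (𝓕⁻ (fun ξ => H1 ξ - H2 ξ) z).re =
      ∫ x, (χ x * u (x - z) - φ x * W (x - z)) := by
    intro z
    have c1 : ∀ K : EuclideanSpace ℝ (Fin d) → ℂ, Integrable K →
        Integrable fun ξ => (Real.fourierChar (inner ℝ ξ z) : ℂ) * K ξ := by
      intro K hK
      have := (Real.fourierIntegral_convergent_iff (-z)).2 hK
      simpa [Circle.smul_def] using this
    have a1 := integral_mul_integral_mul_multiplier (ρ := ρ) hχ hf (c1 _ hFρ)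
    have a2 := integral_mul_fourierInv_re hW (c1 _ hFφ)
    have t1 : ∀ x y, 𝓕⁻ (fun ξ => (Real.fourierChar (inner ℝ ξ z) : ℂ) *
        𝓕 (fun y => ((ρ (y - x) : ℝ) : ℂ)) ξ) y = (ρ (x - z - y) : ℝ) := by
      intro x y
      have h := fourierInv_char_smul (𝓕 (fun y => ((ρ (y - x) : ℝ) : ℂ))) z y
      simp only [Circle.smul_def, smul_eq_mul] at h
      rw [h, fourierInv_fourier_of_test (g := fun y => ρ (y - x))
        (hρ.contDiff.comp (contDiff_id.sub contDiff_const))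
        (hρ.hasCompactSupport.comp_homeomorph (Homeomorph.subRight x))]
      congr 1
      rw [← hρ.even]
      congr 1
      abel
    have t2 : ∀ y, 𝓕⁻ (fun ξ => (Real.fourierChar (inner ℝ ξ z) : ℂ) *
        𝓕 (fun y => (φ y : ℂ)) ξ) y = φ (y + z) := by
      intro y
      have h := fourierInv_char_smul (𝓕 (fun y => (φ y : ℂ))) z y
      simp only [Circle.smul_def, smul_eq_mul] at h
      rw [h, fourierInv_fourier_of_test hφ hφc]
    simp only [t1, t2, Complex.ofReal_re] at a1 a2
    have a3 : ∫ y, W y * φ (y + z) = ∫ x, φ x * W (x - z) := by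
      rw [← integral_add_right_eq_self (fun x => φ x * W (x - z)) z]
      congr 1 with y
      rw [add_sub_cancel_right, mul_comm]
    rw [a3] at a2
    rw [integral_sub, a2]
    · have a4 : ∫ x, χ x * u (x - z) = _ := a1
      rw [a4, ← Complex.sub_re, ← integral_sub]
      · rw [Real.fourierInv_eq]
        congr 2 with ξ
        simp only [Circle.smul_def, smul_eq_mul, H1, H2]
        ring
      · exact c1 _ hH1
      · exact (c1 _ hH2).congr (Eventually.of_forall fun ξ => by simp only [H2]; ring)
    · exact Continuous.integrable_of_hasCompactSupport (by fun_prop) hχs.mul_right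
    · exact Continuous.integrable_of_hasCompactSupport
        (hφ.continuous.mul (by fun_prop)) hφc.mul_right
  -- Convexity enters here: the tangent line inequality between the values `u x` and `u (x - z)`,
  -- multiplied by `φ x ≥ 0` and integrated in `x`.
  have hmax : ∀ z, (𝓕⁻ (fun ξ => H1 ξ - H2 ξ) z).re ≤ (𝓕⁻ (fun ξ => H1 ξ - H2 ξ) 0).re := by
    intro z
    rw [hFinv, hFinv]
    have hc : ∀ z, Integrable fun x => χ x * u (x - z) - φ x * W (x - z) := fun z =>
      (Continuous.integrable_of_hasCompactSupport (by fun_prop) hχs.mul_right).sub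
        (Continuous.integrable_of_hasCompactSupport
          (hφ.continuous.mul (by fun_prop)) hφc.mul_right)
    refine integral_mono (hc z) (hc 0) fun x => ?_
    simp only [sub_zero, hχdef, hWdef]
    have := mul_le_mul_of_nonneg_left
      (deriv_smoothNegPart_mul_sub_le hδ (u x) (u (x - z))) (hφ0 x)
    linarith
  have hpos := integral_rpow_norm_mul_re_nonneg (hH1.sub hH2) hHsq hmax hα₀ hα₂
  have i1 := integrable_rpow_mul_fourier_of_test hρ.contDiff hρ.hasCompactSupport hα₀ hα₂
  have i2 := integrable_rpow_mul_fourier_of_test hφ hφc hα₀ hα₂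
  have r1 := integral_mul_integral_mul_multiplier (ρ := ρ) hχ hf i1
  have r2 := integral_mul_fourierInv_re hW i2
  have l1 : ∫ x, χ x * ∫ y, f y * fracLaplacian α (fun y => ρ (x - y)) y =
      (∫ ξ : EuclideanSpace ℝ (Fin d), (((2 * Real.pi * ‖ξ‖) ^ α : ℝ) : ℂ) * H1 ξ).re := by
    rw [← r1]
    simp only [hρx]
    rfl
  have l2 : ∫ x, W x * fracLaplacian α φ x =
      (∫ ξ : EuclideanSpace ℝ (Fin d), (((2 * Real.pi * ‖ξ‖) ^ α : ℝ) : ℂ) * H2 ξ).re := by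
    simp only [H2, ← mul_assoc]
    exact r2
  rw [l1, l2, neg_le_neg_iff, ← sub_nonneg, ← Complex.sub_re, ← integral_sub (hb1 _ i1) (hb2 _ i2)]
  have : ∫ ξ : EuclideanSpace ℝ (Fin d), ((((2 * Real.pi * ‖ξ‖) ^ α : ℝ) : ℂ) * H1 ξ -
      (((2 * Real.pi * ‖ξ‖) ^ α : ℝ) : ℂ) * H2 ξ).re = _ :=
    integral_re ((hb1 _ i1).sub (hb2 _ i2))
  refine hpos.trans_eq (Eq.trans ?_ this)
  congr 1 with ξ
  rw [← mul_sub, Complex.re_ofReal_mul]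
  rfl

end Mollified

/-! ### The energy inequality at a fixed time. -/

section FixedTime

variable {d : ℕ} {ρ f φ : EuclideanSpace ℝ (Fin d) → ℝ} {ε : ℝ}
  {w : EuclideanSpace ℝ (Fin d) → EuclideanSpace ℝ (Fin d)}
  {H : EuclideanSpace ℝ (Fin d) → EuclideanSpace ℝ (Fin d) →L[ℝ] EuclideanSpace ℝ (Fin d)}

/-- A bound for the fractional Laplacian of a test function. -/
noncomputable def fracLaplacianBound (α : ℝ) (g : EuclideanSpace ℝ (Fin d) → ℝ) : ℝ :=
  ∫ ξ : EuclideanSpace ℝ (Fin d), (2 * Real.pi * ‖ξ‖) ^ α * ‖𝓕 (fun y => (g y : ℂ)) ξ‖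

theorem abs_fracLaplacian_le (α : ℝ) (g : EuclideanSpace ℝ (Fin d) → ℝ)
    (x : EuclideanSpace ℝ (Fin d)) : |fracLaplacian α g x| ≤ fracLaplacianBound α g := by
  unfold fracLaplacian fracLaplacianBound
  refine (Complex.abs_re_le_norm _).trans ((norm_fourierInv_le x).trans_eq ?_)
  congr 1 with ξ
  rw [norm_mul, Complex.norm_real, Real.norm_of_nonneg (by positivity)]

theorem IsMollifier.comp_sub_left (h : IsMollifier ρ ε) (x : EuclideanSpace ℝ (Fin d)) :
    (fun y => ρ (x - y)) = fun y => ρ (y - x) := by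
  ext y; rw [← h.even, neg_sub]

theorem IsMollifier.contDiff_comp_sub (h : IsMollifier ρ ε) (x : EuclideanSpace ℝ (Fin d)) :
    ContDiff ℝ ((⊤ : ℕ∞) : WithTop ℕ∞) fun y => ρ (x - y) :=
  h.contDiff.comp (contDiff_const.sub contDiff_id)

theorem IsMollifier.hasCompactSupport_comp_sub (h : IsMollifier ρ ε)
    (x : EuclideanSpace ℝ (Fin d)) : HasCompactSupport fun y => ρ (x - y) := by
  rw [h.comp_sub_left]
  exact h.hasCompactSupport.comp_homeomorph (Homeomorph.subRight x)

theorem fracLaplacianBound_comp_sub (h : IsMollifier ρ ε) (α : ℝ)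
    (x : EuclideanSpace ℝ (Fin d)) :
    fracLaplacianBound α (fun y => ρ (x - y)) = fracLaplacianBound α ρ := by
  unfold fracLaplacianBound
  rw [h.comp_sub_left]
  congr 1 with ξ
  rw [fourier_comp_sub (fun y => (ρ y : ℂ)), Circle.norm_smul]

theorem continuous_fracLaplacian {g : EuclideanSpace ℝ (Fin d) → ℝ}
    (hg : ContDiff ℝ ((⊤ : ℕ∞) : WithTop ℕ∞) g) (hgc : HasCompactSupport g)
    {α : ℝ} (hα₀ : 0 < α) (hα₂ : α ≤ 2) : Continuous (fracLaplacian α g) :=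
  Complex.continuous_re.comp
    (continuous_fourierInv_of_integrable (integrable_rpow_mul_fourier_of_test hg hgc hα₀ hα₂))

theorem fracLaplacian_comp_sub (h : IsMollifier ρ ε) (α : ℝ)
    (x y : EuclideanSpace ℝ (Fin d)) :
    fracLaplacian α (fun y => ρ (x - y)) y = fracLaplacian α ρ (y - x) := by
  unfold fracLaplacian
  rw [h.comp_sub_left]
  have := fourierInv_char_smul (fun ξ : EuclideanSpace ℝ (Fin d) =>
    (((2 * Real.pi * ‖ξ‖) ^ α : ℝ) : ℂ) * 𝓕 (fun y => (ρ y : ℂ)) ξ) (-x) y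
  rw [← sub_eq_add_neg] at this
  rw [← this]
  refine congrArg (fun F : EuclideanSpace ℝ (Fin d) → ℂ => (𝓕⁻ F y).re) (funext fun ξ => ?_)
  rw [fourier_comp_sub (fun y => (ρ y : ℂ)), inner_neg_right, Circle.smul_def, Circle.smul_def,
    smul_eq_mul, smul_eq_mul]
  ring

theorem integrable_mul_fracLaplacian (h : IsMollifier ρ ε) (hf : Integrable f)
    {α : ℝ} (hα₀ : 0 < α) (hα₂ : α ≤ 2) (x : EuclideanSpace ℝ (Fin d)) :
    Integrable fun y => f y * fracLaplacian α (fun y => ρ (x - y)) y := by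
  refine hf.mul_bdd (c := fracLaplacianBound α fun y => ρ (x - y)) ?_
    (Eventually.of_forall fun y => abs_fracLaplacian_le α _ y)
  exact (continuous_fracLaplacian (h.contDiff_comp_sub x) (h.hasCompactSupport_comp_sub x)
    hα₀ hα₂).aestronglyMeasurable

theorem continuous_integral_mul_fracLaplacian (h : IsMollifier ρ ε) (hf : Integrable f)
    {α : ℝ} (hα₀ : 0 < α) (hα₂ : α ≤ 2) :
    Continuous fun x => ∫ y, f y * fracLaplacian α (fun y => ρ (x - y)) y := by
  have hc := continuous_fracLaplacian h.contDiff h.hasCompactSupport hα₀ hα₂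
  refine continuous_of_dominated (bound := fun y => ‖f y‖ * fracLaplacianBound α ρ) (fun x => ?_)
    (fun x => Eventually.of_forall fun y => ?_) (hf.norm.mul_const _)
    (Eventually.of_forall fun y => ?_)
  · exact (integrable_mul_fracLaplacian h hf hα₀ hα₂ x).1
  · rw [norm_mul]
    gcongr
    rw [← fracLaplacianBound_comp_sub h α x]
    exact abs_fracLaplacian_le α _ y
  · simp_rw [fracLaplacian_comp_sub h]
    fun_prop

theorem IsMollifier.fderiv_comp_sub_left_apply (h : IsMollifier ρ ε)
    (x y e : EuclideanSpace ℝ (Fin d)) :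
    fderiv ℝ (fun y => ρ (x - y)) y e = -fderiv ℝ ρ (x - y) e := by
  have h1 := (h.contDiff_one.differentiable (by simp) (x - y)).hasFDerivAt
  have h2 : HasFDerivAt (fun y => x - y) (-ContinuousLinearMap.id ℝ (EuclideanSpace ℝ (Fin d))) y :=
    (hasFDerivAt_id y).const_sub x
  have h3 : HasFDerivAt (fun y => ρ (x - y)) _ y := h1.comp y h2
  rw [h3.fderiv]
  simp

open scoped Convolution in
theorem IsMollifier.integrable_mul_fderiv (h : IsMollifier ρ ε)
    (hfw : LocallyIntegrable fun y => f y • w y) (x : EuclideanSpace ℝ (Fin d)) :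
    Integrable fun y => f y * fderiv ℝ ρ (x - y) (w y) := by
  have := (h.hasCompactSupport.fderiv ℝ).convolutionExists_right
    (ContinuousLinearMap.apply ℝ ℝ) hfw h.continuous_fderiv x
  refine this.integrable.congr (Eventually.of_forall fun y => ?_)
  simp

open scoped Convolution in
theorem IsMollifier.continuous_integral_mul_fderiv (h : IsMollifier ρ ε)
    (hfw : LocallyIntegrable fun y => f y • w y) :
    Continuous fun x => ∫ y, f y * fderiv ℝ ρ (x - y) (w y) := by
  have := (h.hasCompactSupport.fderiv ℝ).continuous_convolution_right
    (ContinuousLinearMap.apply ℝ ℝ) hfw h.continuous_fderiv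
  convert! this using 2 with x
  simp [convolution_def]

/-- The mollified right hand side of the transport-diffusion equation. -/
noncomputable def mollifiedFlux (α : ℝ) (ρ : EuclideanSpace ℝ (Fin d) → ℝ)
    (w : EuclideanSpace ℝ (Fin d) → EuclideanSpace ℝ (Fin d))
    (f : EuclideanSpace ℝ (Fin d) → ℝ) (x : EuclideanSpace ℝ (Fin d)) : ℝ :=
  ∫ y, f y * (fderiv ℝ (fun y => ρ (x - y)) y (w y) - fracLaplacian α (fun y => ρ (x - y)) y)

theorem mollifiedFlux_eq (h : IsMollifier ρ ε) (hf : Integrable f)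
    (hfw : LocallyIntegrable fun y => f y • w y) {α : ℝ} (hα₀ : 0 < α) (hα₂ : α ≤ 2)
    (x : EuclideanSpace ℝ (Fin d)) :
    mollifiedFlux α ρ w f x = -(∫ y, f y * fderiv ℝ ρ (x - y) (w y)) -
      ∫ y, f y * fracLaplacian α (fun y => ρ (x - y)) y := by
  unfold mollifiedFlux
  have i1 := h.integrable_mul_fderiv hfw x
  have i2 := integrable_mul_fracLaplacian h hf hα₀ hα₂ x
  have i1n : Integrable fun y => -(f y * fderiv ℝ ρ (x - y) (w y)) := i1.neg
  rw [← integral_neg, ← integral_sub i1n i2]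
  congr 1 with y
  rw [h.fderiv_comp_sub_left_apply]
  ring

/-- The integrated size of the commutator integrand at a point. -/
noncomputable def commutatorDefect (ρ f : EuclideanSpace ℝ (Fin d) → ℝ)
    (w : EuclideanSpace ℝ (Fin d) → EuclideanSpace ℝ (Fin d))
    (H : EuclideanSpace ℝ (Fin d) → EuclideanSpace ℝ (Fin d) →L[ℝ] EuclideanSpace ℝ (Fin d))
    (x : EuclideanSpace ℝ (Fin d)) : ℝ≥0∞ :=
  ∫⁻ z, ‖fderiv ℝ ρ z‖ₑ * ‖f (x - z) • (w x - w (x - z)) - f x • H x z‖ₑ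

/-- The commutator of mollification and transport is bounded by the defect. -/
theorem enorm_commutator_le (h : IsMollifier ρ ε) (hf : Integrable f)
    (hfw : LocallyIntegrable fun y => f y • w y) (x : EuclideanSpace ℝ (Fin d)) :
    ‖-(∫ y, f y * fderiv ℝ ρ (x - y) (w y)) + fderiv ℝ (mollify ρ f) x (w x) +
      f x * divergence (H x)‖ₑ ≤ commutatorDefect ρ f w H x := by
  have i1 := h.integrable_mul_fderiv hfw x
  have i2 : Integrable fun y => f y * fderiv ℝ ρ (x - y) (w x) :=
    h.integrable_mul_fderiv (w := fun _ => w x)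
      (locallyIntegrable_of_forall_ball fun R => hf.integrableOn.smul_const _) x
  have i3 : Integrable fun z => f x * fderiv ℝ ρ z (H x z) := by
    have hD := h.continuous_fderiv
    refine Continuous.integrable_of_hasCompactSupport (by fun_prop) ?_
    refine HasCompactSupport.mul_left ?_
    refine (h.hasCompactSupport.fderiv ℝ).mono fun z hz => ?_
    intro h0
    exact hz (by simp [h0])
  have i4 : Integrable fun y => -(f y * fderiv ℝ ρ (x - y) (w y)) +
      f y * fderiv ℝ ρ (x - y) (w x) := i1.neg.add i2
  have i1n : Integrable fun y => -(f y * fderiv ℝ ρ (x - y) (w y)) := i1.neg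
  have i5 : Integrable fun z => -(f (x - z) * fderiv ℝ ρ z (w (x - z))) +
      f (x - z) * fderiv ℝ ρ z (w x) := by
    simpa using i4.comp_sub_left x
  have e1 : -(∫ y, f y * fderiv ℝ ρ (x - y) (w y)) + fderiv ℝ (mollify ρ f) x (w x) =
      ∫ z, (-(f (x - z) * fderiv ℝ ρ z (w (x - z))) + f (x - z) * fderiv ℝ ρ z (w x)) := by
    rw [h.fderiv_mollify hf, ← integral_neg, ← integral_add i1n i2,
      ← integral_sub_left_eq_self _ volume x]
    simp
  -- Writing the divergence as an average of `H x z` against the gradient of the mollifier lets it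
  -- cancel the first order term of the difference `w x - w (x - z)` under one integral.
  have e2 : f x * divergence (H x) = -∫ z, f x * fderiv ℝ ρ z (H x z) := by
    rw [integral_const_mul, h.integral_fderiv_apply_eq_neg_divergence]
    ring
  rw [e1, e2, ← sub_eq_add_neg, ← integral_sub i5 i3]
  refine (enorm_integral_le_lintegral_enorm _).trans (lintegral_mono fun z => ?_)
  have e3 : -(f (x - z) * fderiv ℝ ρ z (w (x - z))) + f (x - z) * fderiv ℝ ρ z (w x) -
      f x * fderiv ℝ ρ z (H x z) =
      fderiv ℝ ρ z (f (x - z) • (w x - w (x - z)) - f x • H x z) := by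
    simp only [map_sub, map_smul, smul_eq_mul]
    ring
  rw [e3]
  exact ContinuousLinearMap.le_opENorm _ _

theorem IsMollifier.lintegral_enorm_mollify_le (h : IsMollifier ρ ε) (hf : Measurable f) :
    ∫⁻ x, ‖mollify ρ f x‖ₑ ≤ ∫⁻ x, ‖f x‖ₑ := by
  have hρ := h.continuous.measurable
  calc ∫⁻ x, ‖mollify ρ f x‖ₑ ≤ ∫⁻ x, ∫⁻ y, ‖f y‖ₑ * ‖ρ (x - y)‖ₑ := by
        refine lintegral_mono fun x => (enorm_integral_le_lintegral_enorm _).trans_eq ?_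
        simp_rw [enorm_mul]
    _ = ∫⁻ y, ∫⁻ x, ‖f y‖ₑ * ‖ρ (x - y)‖ₑ :=
        lintegral_lintegral_swap (Measurable.aemeasurable (by fun_prop))
    _ = ∫⁻ y, ‖f y‖ₑ := by
        congr 1 with y
        rw [lintegral_const_mul _ (by fun_prop),
          lintegral_sub_right_eq_self (fun x => ‖ρ x‖ₑ) y, h.lintegral_enorm, mul_one]

/-- The weak divergence tested against a scalar test function. -/
theorem HasWeakGradient.integral_mul_divergence (hwH : HasWeakGradient w H)
    {η : EuclideanSpace ℝ (Fin d) → ℝ} (hη : ContDiff ℝ ((⊤ : ℕ∞) : WithTop ℕ∞) η)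
    (hηc : HasCompactSupport η) :
    ∫ x, η x * divergence (H x) = -∫ x, fderiv ℝ η x (w x) := by
  obtain ⟨hw, hH, hweak⟩ := hwH
  have hη1 : ContDiff ℝ 1 η := hη.of_le (by exact_mod_cast le_top)
  have hDηc : Continuous (fderiv ℝ η) := hη1.continuous_fderiv (by simp)
  let e : Fin d → EuclideanSpace ℝ (Fin d) := fun i => EuclideanSpace.single i 1
  let P : Fin d → EuclideanSpace ℝ (Fin d) →L[ℝ] ℝ := fun i =>
    EuclideanSpace.proj i
  have hHe : ∀ i, LocallyIntegrable fun x => H x (e i) := fun i =>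
    locallyIntegrable_of_forall_ball fun R =>
      (LocallyIntegrable.integrableOn_ball hH R).apply_continuousLinearMap _
  have a1 : ∀ i, Integrable fun x => η x • H x (e i) := fun i =>
    (hHe i).integrable_smul_left_of_hasCompactSupport hη.continuous hηc
  have a2 : ∀ i, Integrable fun x => (fderiv ℝ η x (e i)) • w x := fun i =>
    hw.integrable_smul_left_of_hasCompactSupport (by fun_prop) (hηc.fderiv_apply (𝕜 := ℝ) _)
  have c1 : ∀ i, Integrable fun x => η x * H x (e i) i := fun i => (P i).integrable_comp (a1 i)
  have c2 : ∀ i, Integrable fun x => fderiv ℝ η x (e i) * w x i := fun i =>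
    (P i).integrable_comp (a2 i)
  have k1 : ∀ i, ∫ x, η x * H x (e i) i = -∫ x, fderiv ℝ η x (e i) * w x i := by
    intro i
    have b1 : ∫ x, η x * H x (e i) i = P i (∫ x, η x • H x (e i)) :=
      (P i).integral_comp_comm (a1 i)
    have b2 : ∫ x, fderiv ℝ η x (e i) * w x i = P i (∫ x, fderiv ℝ η x (e i) • w x) :=
      (P i).integral_comp_comm (a2 i)
    rw [b1, b2, hweak η hη hηc (e i), map_neg]
  have e1 : ∀ x, fderiv ℝ η x (w x) = ∑ i, fderiv ℝ η x (e i) * w x i := by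
    intro x
    conv_lhs => rw [← (EuclideanSpace.basisFun (Fin d) ℝ).sum_repr (w x)]
    simp [mul_comm, e]
  simp_rw [e1, divergence, Finset.mul_sum]
  rw [integral_finsetSum _ fun i _ => c1 i, integral_finsetSum _ fun i _ => c2 i,
    ← Finset.sum_neg_distrib]
  exact Finset.sum_congr rfl fun i _ => k1 i

set_option maxHeartbeats 1000000 in
/-- Renormalised energy inequality at a fixed time for the mollified equation. -/
theorem ofReal_integral_mul_mollifiedFlux_le (h : IsMollifier ρ ε) (hf : Integrable f)
    (hfm : Measurable f) (hwH : HasWeakGradient w H)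
    (hfw : LocallyIntegrable fun y => f y • w y) (hfH : LocallyIntegrable fun y => f y • H y)
    (hφ : ContDiff ℝ ((⊤ : ℕ∞) : WithTop ℕ∞) φ) (hφc : HasCompactSupport φ) (hφ0 : ∀ x, 0 ≤ φ x)
    {δ α : ℝ} (hδ : 0 < δ) (hα₀ : 0 < α) (hα₂ : α ≤ 2) :
    ENNReal.ofReal (∫ x, φ x * deriv (smoothNegPart δ) (mollify ρ f x) * mollifiedFlux α ρ w f x) ≤
      (∫⁻ x, ‖φ x‖ₑ * commutatorDefect ρ f w H x) +
      (∫⁻ x, ‖φ x‖ₑ * (‖f x - mollify ρ f x‖ₑ * ‖divergence (H x)‖ₑ)) +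
      (∫⁻ x, ‖φ x‖ₑ * (ENNReal.ofReal δ * ‖divergence (H x)‖ₑ)) +
      (∫⁻ x, ‖mollify ρ f x‖ₑ * (‖fderiv ℝ φ x‖ₑ * ‖w x‖ₑ)) +
      ENNReal.ofReal (fracLaplacianBound α φ) * ∫⁻ x, ‖f x‖ₑ := by
  obtain ⟨hw, hH, -⟩ := id hwH
  set u := mollify ρ f with hu
  have hus : ContDiff ℝ ((⊤ : ℕ∞) : WithTop ℕ∞) u := h.contDiff_mollify hf
  have hu1 : ContDiff ℝ 1 u := hus.of_le (by exact_mod_cast le_top)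
  have hφ1 : ContDiff ℝ 1 φ := hφ.of_le (by exact_mod_cast le_top)
  have huc : Continuous u := hus.continuous
  have hDu : Continuous (fderiv ℝ u) := hu1.continuous_fderiv (by simp)
  have hDφ : Continuous (fderiv ℝ φ) := hφ1.continuous_fderiv (by simp)
  have hui : Integrable u := h.integrable_mollify hf
  set β := smoothNegPart δ with hβ
  have hβs : ContDiff ℝ ((⊤ : ℕ∞) : WithTop ℕ∞) β := contDiff_smoothNegPart hδ
  have hβc : Continuous β := hβs.continuous
  have hβ'c : Continuous (deriv β) :=
    (contDiff_smoothNegPart hδ (n := 1)).continuous_deriv (by simp)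
  have hβ'le : ∀ v, |deriv β v| ≤ 1 := abs_deriv_smoothNegPart_le hδ
  have hβd : Differentiable ℝ β := fun v => (hasDerivAt_smoothNegPart hδ v).differentiableAt
  have hβsub : ∀ v, |β v - v * deriv β v| ≤ δ := abs_mul_deriv_smoothNegPart_sub_le hδ
  have hβabs : ∀ v, |β v| ≤ |v| := abs_smoothNegPart_le hδ
  have hcord := neg_integral_mul_fracLaplacian_le h hf hφ hφc hφ0 hδ hα₀ hα₂
  rw [← hu, ← hβ] at hcord
  clear_value β
  have hφC := hφ.continuous
  let χ : EuclideanSpace ℝ (Fin d) → ℝ := fun x => φ x * deriv β (u x)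
  have hχc : Continuous χ := by fun_prop
  have hχs : HasCompactSupport χ := hφc.mul_right
  have hχle : ∀ x, ‖χ x‖ₑ ≤ ‖φ x‖ₑ := fun x => by
    simp only [χ, enorm_mul]
    refine mul_le_of_le_one_right' ?_
    rw [Real.enorm_eq_ofReal_abs]
    exact ENNReal.ofReal_le_one.2 (hβ'le _)
  let A : EuclideanSpace ℝ (Fin d) → ℝ := fun x => ∫ y, f y * fderiv ℝ ρ (x - y) (w y)
  have hAc : Continuous A := h.continuous_integral_mul_fderiv hfw
  let B : EuclideanSpace ℝ (Fin d) → ℝ := fun x =>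
    ∫ y, f y * fracLaplacian α (fun y => ρ (x - y)) y
  have hBc : Continuous B := continuous_integral_mul_fracLaplacian h hf hα₀ hα₂
  -- local integrability of the divergence and its products
  have hdivC := continuous_divergence (d := d)
  have hdiv : LocallyIntegrable fun x => divergence (H x) := by
    refine locallyIntegrable_of_forall_ball fun R => ?_
    have hR := LocallyIntegrable.integrableOn_ball hH R
    refine Integrable.mono' (hR.norm.const_mul d) (hdivC.comp_aestronglyMeasurable hR.1)
      (Eventually.of_forall fun x => norm_divergence_le _)
  have hfdiv : LocallyIntegrable fun x => f x * divergence (H x) := by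
    refine locallyIntegrable_of_forall_ball fun R => ?_
    have hR := LocallyIntegrable.integrableOn_ball hfH R
    have e : ∀ x, f x * divergence (H x) = divergence (f x • H x) := fun x => by
      simp [divergence, Finset.mul_sum]
    simp_rw [e]
    refine Integrable.mono' (hR.norm.const_mul d) (hdivC.comp_aestronglyMeasurable hR.1)
      (Eventually.of_forall fun x => norm_divergence_le _)
  have hDw : ∀ {g : EuclideanSpace ℝ (Fin d) → EuclideanSpace ℝ (Fin d) →L[ℝ] ℝ}, Continuous g →
      HasCompactSupport g → Integrable fun x => g x (w x) := by
    intro g hg hgc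
    obtain ⟨R, -, hR⟩ := HasCompactSupport.exists_support_subset_ball hgc
    obtain ⟨C, hC⟩ := hg.bounded_above_of_compact_support hgc
    have hwR := LocallyIntegrable.integrableOn_ball hw R
    have : IntegrableOn (fun x => g x (w x)) (Metric.ball 0 R) := by
      refine Integrable.mono' (hwR.norm.const_mul C) ?_ (Eventually.of_forall fun x => ?_)
      · exact isBoundedBilinearMap_apply.continuous.comp_aestronglyMeasurable
          (hg.aestronglyMeasurable.prodMk hwR.1)
      · exact ((g x).le_opNorm _).trans (by gcongr; exact hC x)
    refine (integrableOn_iff_integrable_of_support_subset fun x hx => hR ?_).1 this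
    refine subset_tsupport _ fun h0 => hx ?_
    simp [h0]
  have j1 : Integrable fun x => χ x * (-A x) :=
    Continuous.integrable_of_hasCompactSupport (by fun_prop) hχs.mul_right
  have j2 : Integrable fun x => χ x * fderiv ℝ u x (w x) := by
    have := hDw (g := fun x => χ x • fderiv ℝ u x) (by fun_prop) hχs.smul_right
    simpa using this
  have j3 : Integrable fun x => χ x * (f x * divergence (H x)) := by
    simpa using hfdiv.integrable_smul_left_of_hasCompactSupport hχc hχs
  have j4 : Integrable fun x => χ x * (u x * divergence (H x)) := by
    have := hdiv.integrable_smul_left_of_hasCompactSupport (g := fun x => χ x * u x)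
      (by fun_prop) hχs.mul_right
    simpa [mul_assoc] using this
  have j5 : Integrable fun x => φ x * β (u x) * divergence (H x) := by
    have := hdiv.integrable_smul_left_of_hasCompactSupport (g := fun x => φ x * β (u x))
      (by fun_prop) hφc.mul_right
    simpa using this
  have j6 : Integrable fun x => β (u x) * fderiv ℝ φ x (w x) := by
    have := hDw (g := fun x => β (u x) • fderiv ℝ φ x) (by fun_prop)
      ((hφc.fderiv ℝ).mono fun x hx h0 => hx (by simp [h0]))
    simpa using this
  have j7 : Integrable fun x => χ x * B x :=
    Continuous.integrable_of_hasCompactSupport (by fun_prop) hχs.mul_right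
  -- weak formulation of the divergence
  have hη : ContDiff ℝ ((⊤ : ℕ∞) : WithTop ℕ∞) fun x => φ x * β (u x) := hφ.mul (hβs.comp hus)
  have hηc : HasCompactSupport fun x => φ x * β (u x) := hφc.mul_right
  have hDη : ∀ x e, fderiv ℝ (fun x => φ x * β (u x)) x e =
      χ x * fderiv ℝ u x e + β (u x) * fderiv ℝ φ x e := by
    intro x e
    have d1 := (hφ1.differentiable (by simp) x).hasFDerivAt
    have d2 := (hu1.differentiable (by simp) x).hasFDerivAt
    have d3 := (hβd (u x)).hasDerivAt
    have d4 : HasFDerivAt (fun x => φ x * β (u x)) _ x := d1.mul (d3.comp_hasFDerivAt x d2)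
    rw [d4.fderiv]
    simp [χ]
    ring
  have hwk : ∫ x, φ x * β (u x) * divergence (H x) =
      -∫ x, (χ x * fderiv ℝ u x (w x) + β (u x) * fderiv ℝ φ x (w x)) := by
    rw [hwH.integral_mul_divergence hη hηc]
    simp_rw [hDη]
  -- `X1` is the commutator, `X2` the cost of replacing `f` by `u` in front of the divergence, `X3`
  -- the homogeneity defect of `β`, and `X4` the flux through the gradient of `φ`. By the weak
  -- divergence identity for `φ β(u)`, their integrals add up to the transport contribution.
  let X1 : EuclideanSpace ℝ (Fin d) → ℝ := fun x =>
    χ x * (-A x + fderiv ℝ u x (w x) + f x * divergence (H x))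
  let X2 : EuclideanSpace ℝ (Fin d) → ℝ := fun x => -(χ x * ((f x - u x) * divergence (H x)))
  let X3 : EuclideanSpace ℝ (Fin d) → ℝ := fun x =>
    φ x * ((β (u x) - u x * deriv β (u x)) * divergence (H x))
  let X4 : EuclideanSpace ℝ (Fin d) → ℝ := fun x => β (u x) * fderiv ℝ φ x (w x)
  have hX1 : Integrable X1 := ((j1.add j2).add j3).congr (Eventually.of_forall fun x => by
    simp only [X1, Pi.add_apply]; ring)
  have hX2 : Integrable X2 := (j4.sub j3).congr (Eventually.of_forall fun x => by
    simp only [X2, Pi.sub_apply]; ring)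
  have hX3 : Integrable X3 := (j5.sub j4).congr (Eventually.of_forall fun x => by
    simp only [X3, Pi.sub_apply, χ]; ring)
  have main : ∫ x, χ x * mollifiedFlux α ρ w f x =
      (∫ x, X1 x) + (∫ x, X2 x) + (∫ x, X3 x) + (∫ x, X4 x) - ∫ x, χ x * B x := by
    have e1 : ∫ x, χ x * mollifiedFlux α ρ w f x = (∫ x, χ x * (-A x)) - ∫ x, χ x * B x := by
      rw [← integral_sub j1 j7]
      congr 1 with x
      rw [mollifiedFlux_eq h hf hfw hα₀ hα₂]
      simp only [A, B]
      ring
    have e2 : (∫ x, χ x * (-A x)) = (∫ x, X1 x) + (∫ x, X2 x) + (∫ x, X3 x) -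
        ∫ x, (φ x * β (u x) * divergence (H x) + χ x * fderiv ℝ u x (w x)) := by
      have hX12 : Integrable fun x => X1 x + X2 x := hX1.add hX2
      have hX123 : Integrable fun x => X1 x + X2 x + X3 x := hX12.add hX3
      have j52 : Integrable fun x =>
          φ x * β (u x) * divergence (H x) + χ x * fderiv ℝ u x (w x) := j5.add j2
      rw [← integral_add hX1 hX2, ← integral_add hX12 hX3, ← integral_sub hX123 j52]
      congr 1 with x
      simp only [X1, X2, X3, χ]
      ring
    rw [e1, e2, integral_add j5 j2, hwk, integral_add j2 j6]
    ring
  have hfin : -∫ x, χ x * B x ≤ -∫ x, β (u x) * fracLaplacian α φ x := hcord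
  have bound : ∀ {X : EuclideanSpace ℝ (Fin d) → ℝ} {Y : EuclideanSpace ℝ (Fin d) → ℝ≥0∞},
      (∀ x, ‖X x‖ₑ ≤ Y x) → ENNReal.ofReal (∫ x, X x) ≤ ∫⁻ x, Y x := fun hXY =>
    (Real.ofReal_le_enorm _).trans
      ((enorm_integral_le_lintegral_enorm _).trans (lintegral_mono hXY))
  have b1 : ENNReal.ofReal (∫ x, X1 x) ≤ ∫⁻ x, ‖φ x‖ₑ * commutatorDefect ρ f w H x :=
    bound fun x => by
      simp only [X1]
      rw [enorm_mul (χ x)]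
      exact mul_le_mul' (hχle x) (enorm_commutator_le h hf hfw x)
  have b2 : ENNReal.ofReal (∫ x, X2 x) ≤
      ∫⁻ x, ‖φ x‖ₑ * (‖f x - u x‖ₑ * ‖divergence (H x)‖ₑ) := bound fun x => by
    simp only [X2]
    rw [enorm_neg, enorm_mul (χ x), enorm_mul (f x - u x)]
    exact mul_le_mul' (hχle x) le_rfl
  have b3 : ENNReal.ofReal (∫ x, X3 x) ≤
      ∫⁻ x, ‖φ x‖ₑ * (ENNReal.ofReal δ * ‖divergence (H x)‖ₑ) := bound fun x => by
    simp only [X3]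
    rw [enorm_mul, enorm_mul, Real.enorm_eq_ofReal_abs (β (u x) - _)]
    gcongr
    exact hβsub _
  have hβle : ∀ x, ‖β (u x)‖ₑ ≤ ‖u x‖ₑ := fun x => by
    rw [Real.enorm_eq_ofReal_abs, Real.enorm_eq_ofReal_abs]
    exact ENNReal.ofReal_le_ofReal (hβabs _)
  have b4 : ENNReal.ofReal (∫ x, X4 x) ≤ ∫⁻ x, ‖u x‖ₑ * (‖fderiv ℝ φ x‖ₑ * ‖w x‖ₑ) :=
    bound fun x => by
      simp only [X4]
      rw [enorm_mul]
      exact mul_le_mul' (hβle x) (ContinuousLinearMap.le_opENorm _ _)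
  have b5 : ENNReal.ofReal (-∫ x, χ x * B x) ≤
      ENNReal.ofReal (fracLaplacianBound α φ) * ∫⁻ x, ‖f x‖ₑ := by
    refine (ENNReal.ofReal_le_ofReal hfin).trans ?_
    rw [← integral_neg]
    refine (bound (Y := fun x => ENNReal.ofReal (fracLaplacianBound α φ) * ‖u x‖ₑ)
      fun x => ?_).trans ?_
    · rw [enorm_neg, enorm_mul, mul_comm]
      refine mul_le_mul' ?_ (hβle x)
      rw [Real.enorm_eq_ofReal_abs]
      exact ENNReal.ofReal_le_ofReal (abs_fracLaplacian_le α φ x)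
    · rw [lintegral_const_mul _ (by fun_prop)]
      exact mul_le_mul_right (h.lintegral_enorm_mollify_le hfm) _
  calc ENNReal.ofReal (∫ x, χ x * mollifiedFlux α ρ w f x)
      ≤ ENNReal.ofReal (∫ x, X1 x) + ENNReal.ofReal (∫ x, X2 x) + ENNReal.ofReal (∫ x, X3 x) +
        ENNReal.ofReal (∫ x, X4 x) + ENNReal.ofReal (-∫ x, χ x * B x) := by
        rw [main, sub_eq_add_neg]
        refine ENNReal.ofReal_add_le.trans (add_le_add_left ?_ _)
        refine ENNReal.ofReal_add_le.trans (add_le_add_left ?_ _)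
        refine ENNReal.ofReal_add_le.trans (add_le_add_left ?_ _)
        exact ENNReal.ofReal_add_le
    _ ≤ _ := add_le_add (add_le_add (add_le_add (add_le_add b1 b2) b3) b4) b5

end FixedTime

/-! ### The local modulus of continuity of products of translates. -/

section Modulus

theorem memLp_indicator_ball {d : ℕ} {F : Type*} [NormedAddCommGroup F]
    {h : EuclideanSpace ℝ (Fin d) → F} {r : ℝ≥0∞} {R : ℝ}
    (hh : ∀ R, MemLp h r (volume.restrict (Metric.ball 0 R))) :
    MemLp ((Metric.ball 0 R).indicator h) r :=
  (memLp_indicator_iff_restrict measurableSet_ball).2 (hh R)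

variable {d : ℕ} {F : Type*} [NormedAddCommGroup F] [NormedSpace ℝ F]

/-- The `L¹` distance on a ball between a product and its translate. -/
noncomputable def productModulus (R : ℝ) (f : EuclideanSpace ℝ (Fin d) → ℝ)
    (h : EuclideanSpace ℝ (Fin d) → F) (p : EuclideanSpace ℝ (Fin d) × EuclideanSpace ℝ (Fin d)) :
    ℝ≥0∞ :=
  ∫⁻ x in Metric.ball 0 R, ‖f (x - p.1) • h (x - p.2) - f x • h x‖ₑ

variable {q r : ℝ≥0∞} [hqr : ENNReal.HolderConjugate q r] {f : EuclideanSpace ℝ (Fin d) → ℝ}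
  {h : EuclideanSpace ℝ (Fin d) → F} {R : ℝ}

/-- Truncating `h` to the ball of radius `R + 1` makes it globally `L^r`. For shifts of `h` of
length at most one, the truncation is invisible from the ball of radius `R`. The density needs no
truncation. -/
theorem productModulus_le_indicator {p : EuclideanSpace ℝ (Fin d) × EuclideanSpace ℝ (Fin d)}
    (hp : ‖p.2‖ ≤ 1) :
    productModulus R f h p ≤ eLpNorm (fun x => f (x - p.1) •
      (Metric.ball 0 (R + 1)).indicator h (x - p.2) -
        f x • (Metric.ball 0 (R + 1)).indicator h x) 1 volume := by
  rw [eLpNorm_one_eq_lintegral_enorm]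
  refine le_trans (le_of_eq (setLIntegral_congr_fun measurableSet_ball fun x hx => ?_))
    (setLIntegral_le_lintegral _ _)
  have h1 : x ∈ Metric.ball (0 : EuclideanSpace ℝ (Fin d)) (R + 1) := by
    simp only [mem_ball_zero_iff] at hx ⊢; linarith
  have h2 : x - p.2 ∈ Metric.ball (0 : EuclideanSpace ℝ (Fin d)) (R + 1) := by
    simp only [mem_ball_zero_iff] at hx ⊢; linarith [norm_sub_le x p.2]
  simp only [indicator_of_mem h1, indicator_of_mem h2]

theorem tendsto_productModulus (hf : MemLp f q)
    (hh : ∀ R, MemLp h r (volume.restrict (Metric.ball 0 R))) :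
    Tendsto (productModulus R f h) (𝓝 0) (𝓝 0) := by
  have ht := tendsto_eLpNorm_translate_smul_sub (q := q) (r := r) hf
    (memLp_indicator_ball (R := R + 1) hh)
  refine tendsto_of_tendsto_of_tendsto_of_le_of_le' tendsto_const_nhds ht
    (Eventually.of_forall fun _ => zero_le) ?_
  have : ∀ᶠ p : EuclideanSpace ℝ (Fin d) × EuclideanSpace ℝ (Fin d) in 𝓝 0, ‖p.2‖ < 1 :=
    (isOpen_lt (by fun_prop) continuous_const).mem_nhds (by simp)
  filter_upwards [this] with p hp using productModulus_le_indicator hp.le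

/-- The triangle inequality and Hölder, with translation invariance of the norms. The bound does not
depend on the shifts, and for time slices its right-hand side is integrable in time, so it serves as
a majorant when the mollifiers shrink. -/
theorem productModulus_le (hf : MemLp f q)
    (hh : ∀ R, MemLp h r (volume.restrict (Metric.ball 0 R)))
    {p : EuclideanSpace ℝ (Fin d) × EuclideanSpace ℝ (Fin d)} (hp : ‖p.2‖ ≤ 1) :
    productModulus R f h p ≤
      2 * (eLpNorm f q volume * eLpNorm h r (volume.restrict (Metric.ball 0 (R + 1)))) := by
  have hk := memLp_indicator_ball (R := R + 1) hh
  have hkn := eLpNorm_indicator_eq_eLpNorm_restrict (μ := volume) (p := r) (f := h)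
    (measurableSet_ball (x := (0 : EuclideanSpace ℝ (Fin d))) (ε := R + 1))
  rw [← hkn]
  refine (productModulus_le_indicator hp).trans ?_
  set k := (Metric.ball 0 (R + 1)).indicator h
  have hfa := MemLp.comp_sub hf p.1
  have hkb := MemLp.comp_sub hk p.2
  refine (eLpNorm_sub_le (hfa.1.smul hkb.1) (hf.1.smul hk.1) le_rfl).trans ?_
  rw [two_mul]
  refine add_le_add ?_ ?_
  · refine (eLpNorm_smul_le_mul_eLpNorm (p := q) (q := r) hkb.1 hfa.1).trans ?_
    rw [eLpNorm_comp_sub hf.1, eLpNorm_comp_sub hk.1]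
  · exact eLpNorm_smul_le_mul_eLpNorm (p := q) (q := r) hk.1 hf.1

end Modulus

/-! ### Vanishing of the commutator and of the mollification error at a fixed time. -/

section Limits

variable {d : ℕ} {F : Type*} [NormedAddCommGroup F] [NormedSpace ℝ F]
  {f φ ρ : EuclideanSpace ℝ (Fin d) → ℝ}
  {w : EuclideanSpace ℝ (Fin d) → EuclideanSpace ℝ (Fin d)}
  {H : EuclideanSpace ℝ (Fin d) → EuclideanSpace ℝ (Fin d) →L[ℝ] EuclideanSpace ℝ (Fin d)}
  {h : EuclideanSpace ℝ (Fin d) → F} {R ε : ℝ}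

/-- Integrate in `x` first: for fixed `z` the segment estimate gains a factor `‖z‖`, which pairs
with the gradient of the mollifier to form its first moment. Only `‖z‖ ≤ ε` matters, since the
gradient vanishes beyond. -/
theorem lintegral_commutatorDefect_le (hρ : IsMollifier ρ ε) (hf : StronglyMeasurable f)
    (hw : StronglyMeasurable w) (hH : StronglyMeasurable H) (hwH : HasWeakGradient w H) {M : ℝ≥0∞}
    (hM : ∀ z : EuclideanSpace ℝ (Fin d), ‖z‖ ≤ ε → ∀ θ ∈ Ioc (0 : ℝ) 1,
      productModulus R f H (z, θ • z) ≤ M) :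
    ∫⁻ x in Metric.ball 0 R, commutatorDefect ρ f w H x ≤
      (∫⁻ z, ‖fderiv ℝ ρ z‖ₑ * ‖z‖ₑ) * M := by
  have hD := hρ.continuous_fderiv.measurable
  have hm : Measurable fun p : EuclideanSpace ℝ (Fin d) × EuclideanSpace ℝ (Fin d) =>
      ‖f (p.1 - p.2) • (w p.1 - w (p.1 - p.2)) - f p.1 • H p.1 p.2‖ₑ := by
    refine StronglyMeasurable.enorm (StronglyMeasurable.sub ?_ ?_)
    · exact (hf.comp_measurable (by fun_prop)).smul
        ((hw.comp_measurable (by fun_prop)).sub (hw.comp_measurable (by fun_prop)))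
    · refine (hf.comp_measurable (by fun_prop)).smul ?_
      exact isBoundedBilinearMap_apply.continuous.comp_stronglyMeasurable
        ((hH.comp_measurable measurable_fst).prodMk measurable_snd.stronglyMeasurable)
  unfold commutatorDefect
  rw [lintegral_lintegral_swap
    (((hD.comp measurable_snd).enorm.mul hm).aemeasurable), ← lintegral_mul_const _ (by fun_prop)]
  refine lintegral_mono fun z => ?_
  rw [lintegral_const_mul _ (by exact hm.comp (f := fun x => (x, z)) (by fun_prop)), mul_assoc]
  rcases le_or_gt ‖z‖ ε with hz | hz
  · gcongr
    exact hwH.lintegral_defect_le hw hH hf _ z M (hM z hz)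
  · have e0 : ‖fderiv ℝ ρ z‖ₑ = 0 := by
      rw [← ofReal_norm, hρ.fderiv_eq_zero hz, norm_zero, ENNReal.ofReal_zero]
    rw [e0, zero_mul, zero_mul]

/-- The error is the average of `f x - f (x - z)` against the probability density `ρ`, and the
weight `h` is not translated, hence the pair of shifts `(z, 0)`. Keeping the product with `h` also
covers a density in `L^∞`, whose mollifications need not converge in norm. -/
theorem lintegral_sub_mollify_mul_le (hρ : IsMollifier ρ ε) (hfi : Integrable f)
    (hf : StronglyMeasurable f) (hh : StronglyMeasurable h) {M : ℝ≥0∞}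
    (hM : ∀ z : EuclideanSpace ℝ (Fin d), ‖z‖ ≤ ε → productModulus R f h (z, 0) ≤ M) :
    ∫⁻ x in Metric.ball 0 R, ‖f x - mollify ρ f x‖ₑ * ‖h x‖ₑ ≤ M := by
  have hρm := hρ.continuous.measurable
  have hfm := hf.measurable
  have hhm := hh.enorm
  have e1 : ∀ x, ‖f x - mollify ρ f x‖ₑ ≤ ∫⁻ z, ‖ρ z‖ₑ * ‖f (x - z) - f x‖ₑ := by
    intro x
    have i1 : Integrable fun z => f (x - z) * ρ z := by
      obtain ⟨C, hC⟩ := hρ.continuous.bounded_above_of_compact_support hρ.hasCompactSupport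
      exact (hfi.comp_sub_left x).mul_bdd (c := C) hρ.continuous.aestronglyMeasurable
        (Eventually.of_forall hC)
    have e2 : mollify ρ f x = ∫ z, f (x - z) * ρ z := by
      unfold mollify
      rw [← integral_sub_left_eq_self _ volume x]
      simp
    have e3 : f x = ∫ z, f x * ρ z := by
      rw [integral_const_mul, hρ.integral_eq_one, mul_one]
    rw [e2]
    nth_rw 1 [e3]
    rw [← integral_sub (hρ.integrable.const_mul _) i1]
    refine (enorm_integral_le_lintegral_enorm _).trans (lintegral_mono fun z => ?_)
    rw [← enorm_mul, ← enorm_neg]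
    exact le_of_eq (congrArg _ (by ring))
  calc ∫⁻ x in Metric.ball 0 R, ‖f x - mollify ρ f x‖ₑ * ‖h x‖ₑ
      ≤ ∫⁻ x in Metric.ball 0 R, ∫⁻ z, ‖ρ z‖ₑ * ‖f (x - z) • h x - f x • h x‖ₑ := by
        refine lintegral_mono fun x => (mul_le_mul_left (e1 x) _).trans ?_
        rw [← lintegral_mul_const _ (by fun_prop)]
        refine lintegral_mono fun z => le_of_eq ?_
        rw [← sub_smul, enorm_smul, mul_assoc]
    _ = ∫⁻ z, ‖ρ z‖ₑ * productModulus R f h (z, 0) := by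
        have hm : Measurable fun p : EuclideanSpace ℝ (Fin d) × EuclideanSpace ℝ (Fin d) =>
            ‖f (p.1 - p.2) • h p.1 - f p.1 • h p.1‖ₑ := by
          refine StronglyMeasurable.enorm (StronglyMeasurable.sub ?_ ?_)
          · exact (hf.comp_measurable (by fun_prop)).smul (hh.comp_measurable (by fun_prop))
          · exact (hf.comp_measurable (by fun_prop)).smul (hh.comp_measurable (by fun_prop))
        rw [lintegral_lintegral_swap (((hρm.comp measurable_snd).enorm.mul hm).aemeasurable)]
        refine lintegral_congr fun z => ?_
        rw [lintegral_const_mul _ (by exact hm.comp (f := fun x => (x, z)) (by fun_prop))]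
        simp [productModulus]
    _ ≤ ∫⁻ z, ‖ρ z‖ₑ * M := by
        refine lintegral_mono fun z => ?_
        rcases le_or_gt ‖z‖ ε with hz | hz
        · exact mul_le_mul_right (hM z hz) _
        · simp [hρ.eq_zero z hz]
    _ = M := by rw [lintegral_mul_const _ (by fun_prop), hρ.lintegral_enorm, one_mul]

variable {q r : ℝ≥0∞} [hqr : ENNReal.HolderConjugate q r]

theorem one_div_nat_add_one_le_one (n : ℕ) : 1 / ((n : ℝ) + 1) ≤ 1 := by
  rw [div_le_one (by positivity)]
  linarith [n.cast_nonneg (α := ℝ)]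

/-- The second shift `b` is left free so that one statement covers `θ • z` in the commutator and `0`
in the mollification error. -/
theorem eventually_forall_productModulus_le (hf : MemLp f q)
    (hh : ∀ R, MemLp h r (volume.restrict (Metric.ball 0 R))) {η : ℝ≥0∞} (hη : 0 < η) :
    ∀ᶠ n : ℕ in atTop, ∀ z b : EuclideanSpace ℝ (Fin d), ‖z‖ ≤ 1 / ((n : ℝ) + 1) → ‖b‖ ≤ ‖z‖ →
      productModulus R f h (z, b) ≤ η := by
  have h1 := (tendsto_productModulus (R := R) hf hh).eventually_le_const hη
  rw [Metric.eventually_nhds_iff] at h1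
  obtain ⟨s, hs, h2⟩ := h1
  have h3 : ∀ᶠ n : ℕ in atTop, 1 / ((n : ℝ) + 1) < s :=
    tendsto_one_div_add_atTop_nhds_zero_nat.eventually_lt_const hs
  filter_upwards [h3] with n hn z b hz hb
  refine h2 ?_
  rw [dist_zero_right, Prod.norm_def]
  exact max_lt (hz.trans_lt hn) ((hb.trans hz).trans_lt hn)

theorem norm_smul_le_of_mem_Ioc {θ : ℝ} (hθ : θ ∈ Ioc (0 : ℝ) 1) (z : EuclideanSpace ℝ (Fin d)) :
    ‖θ • z‖ ≤ ‖z‖ := by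
  rw [norm_smul, Real.norm_of_nonneg hθ.1.le]
  exact mul_le_of_le_one_left (norm_nonneg _) hθ.2

variable {ρs : ℕ → EuclideanSpace ℝ (Fin d) → ℝ} {C : ℝ≥0∞}

theorem lintegral_commutatorDefect_le_of_memLp
    (hρ : ∀ n : ℕ, IsMollifier (ρs n) (1 / (n + 1)) ∧ ∫⁻ z, ‖fderiv ℝ (ρs n) z‖ₑ * ‖z‖ₑ = C)
    (hf : StronglyMeasurable f) (hw : StronglyMeasurable w) (hH : StronglyMeasurable H)
    (hwH : HasWeakGradient w H) (hfq : MemLp f q)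
    (hHr : ∀ R, MemLp H r (volume.restrict (Metric.ball 0 R))) (n : ℕ) :
    ∫⁻ x in Metric.ball 0 R, commutatorDefect (ρs n) f w H x ≤
      C * (2 * (eLpNorm f q volume * eLpNorm H r (volume.restrict (Metric.ball 0 (R + 1))))) := by
  rw [← (hρ n).2]
  refine lintegral_commutatorDefect_le (hρ n).1 hf hw hH hwH fun z hz θ hθ => ?_
  exact productModulus_le hfq hHr
    ((norm_smul_le_of_mem_Ioc hθ z).trans (hz.trans (one_div_nat_add_one_le_one n)))

theorem tendsto_lintegral_commutatorDefect (hC : C ≠ ∞)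
    (hρ : ∀ n : ℕ, IsMollifier (ρs n) (1 / (n + 1)) ∧ ∫⁻ z, ‖fderiv ℝ (ρs n) z‖ₑ * ‖z‖ₑ = C)
    (hf : StronglyMeasurable f) (hw : StronglyMeasurable w) (hH : StronglyMeasurable H)
    (hwH : HasWeakGradient w H) (hfq : MemLp f q)
    (hHr : ∀ R, MemLp H r (volume.restrict (Metric.ball 0 R))) :
    Tendsto (fun n => ∫⁻ x in Metric.ball 0 R, commutatorDefect (ρs n) f w H x) atTop (𝓝 0) := by
  rw [ENNReal.tendsto_nhds_zero]
  intro η hη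
  -- Dividing by `C + 1` rather than `C` avoids separating the case `C = 0`.
  have hη' : 0 < η / (C + 1) := ENNReal.div_pos hη.ne' (by simp [hC])
  filter_upwards [eventually_forall_productModulus_le (R := R) hfq hHr hη'] with n hn
  calc _ ≤ (∫⁻ z, ‖fderiv ℝ (ρs n) z‖ₑ * ‖z‖ₑ) * (η / (C + 1)) :=
        lintegral_commutatorDefect_le (hρ n).1 hf hw hH hwH fun z hz θ hθ =>
          hn z _ hz (norm_smul_le_of_mem_Ioc hθ z)
    _ ≤ (C + 1) * (η / (C + 1)) := by
        rw [(hρ n).2]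
        gcongr
        exact le_self_add
    _ ≤ η := ENNReal.mul_div_le

theorem lintegral_sub_mollify_mul_le_of_memLp (hρ : ∀ n : ℕ, IsMollifier (ρs n) (1 / (n + 1)))
    (hfi : Integrable f) (hf : StronglyMeasurable f) (hh : StronglyMeasurable h) (hfq : MemLp f q)
    (hhr : ∀ R, MemLp h r (volume.restrict (Metric.ball 0 R))) (n : ℕ) :
    ∫⁻ x in Metric.ball 0 R, ‖f x - mollify (ρs n) f x‖ₑ * ‖h x‖ₑ ≤
      2 * (eLpNorm f q volume * eLpNorm h r (volume.restrict (Metric.ball 0 (R + 1)))) :=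
  lintegral_sub_mollify_mul_le (hρ n) hfi hf hh fun z _ => productModulus_le hfq hhr (by simp)

theorem tendsto_lintegral_sub_mollify_mul (hρ : ∀ n : ℕ, IsMollifier (ρs n) (1 / (n + 1)))
    (hfi : Integrable f) (hf : StronglyMeasurable f) (hh : StronglyMeasurable h) (hfq : MemLp f q)
    (hhr : ∀ R, MemLp h r (volume.restrict (Metric.ball 0 R))) :
    Tendsto (fun n => ∫⁻ x in Metric.ball 0 R, ‖f x - mollify (ρs n) f x‖ₑ * ‖h x‖ₑ)
      atTop (𝓝 0) := by
  rw [ENNReal.tendsto_nhds_zero]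
  intro η hη
  filter_upwards [eventually_forall_productModulus_le (R := R) hfq hhr hη] with n hn
  exact lintegral_sub_mollify_mul_le (hρ n) hfi hf hh fun z hz => hn z 0 hz (by simp)

end Limits

/-! ### Measurability and integrability of time slices. -/

section Slices

/-- For `r = ∞` there is no integral to differentiate under Tonelli, so sublevel sets of the
essential supremum are described by sections of measure zero, and the measure of a section is a
measurable function. -/
theorem measurable_eLpNorm_slice {α β F : Type*} [MeasurableSpace α] [MeasurableSpace β]
    [NormedAddCommGroup F] {f : α → β → F} (hf : StronglyMeasurable (Function.uncurry f))
    (r : ℝ≥0∞) (μ : Measure β) [SFinite μ] : Measurable fun s => eLpNorm (f s) r μ := by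
  have hfe : Measurable fun p : α × β => ‖f p.1 p.2‖ₑ := hf.enorm
  by_cases h0 : r = 0
  · simp [h0]
  by_cases ht : r = ∞
  · subst ht
    simp_rw [eLpNorm_exponent_top, eLpNormEssSup_eq_essSup_enorm]
    refine measurable_of_Ioi fun c => ?_
    have : (fun s => essSup (fun x => ‖f s x‖ₑ) μ) ⁻¹' Ioi c =
        {s | μ (Prod.mk s ⁻¹' {p : α × β | c < ‖f p.1 p.2‖ₑ}) = 0}ᶜ := by
      ext s
      simp only [mem_preimage, mem_Ioi, mem_compl_iff, mem_ofPred_eq, ← not_le, not_iff_not]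
      constructor
      · intro h
        have h1 : ∀ᵐ x ∂μ, ‖f s x‖ₑ ≤ c := by
          filter_upwards [ENNReal.ae_le_essSup fun x => ‖f s x‖ₑ] with x hx using hx.trans h
        rw [ae_iff] at h1
        exact h1
      · intro h
        exact essSup_le_of_ae_le _ (by rw [EventuallyLE, ae_iff]; exact h)
    rw [this]
    exact ((measurable_measure_prodMk_left (measurableSet_lt measurable_const hfe))
      (measurableSet_singleton 0)).compl
  · simp_rw [eLpNorm_eq_lintegral_rpow_enorm_toReal h0 ht]
    exact (Measurable.lintegral_prod_right' (hfe.pow_const r.toReal)).pow_const _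

theorem MemL1TimeLp.of_ae_eq {d : ℕ} {F : Type*} [NormedAddCommGroup F] {T : ℝ} {r : ℝ≥0∞}
    {μ : Measure (EuclideanSpace ℝ (Fin d))} [SFinite μ] {f f' : ℝ → EuclideanSpace ℝ (Fin d) → F}
    (h : MemL1TimeLp T r μ f)
    (heq : Function.uncurry f =ᵐ[(volume.restrict (Icc 0 T)).prod μ] Function.uncurry f') :
    MemL1TimeLp T r μ f' := by
  refine ⟨h.1.congr heq, lt_of_le_of_lt (le_of_eq (lintegral_congr_ae ?_)) h.2⟩
  filter_upwards [Measure.ae_ae_of_ae_prod heq] with s hs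
  exact (eLpNorm_congr_ae hs).symm

theorem MemL1TimeLp.ae_memLp {d : ℕ} {F : Type*} [NormedAddCommGroup F] {T : ℝ} {r : ℝ≥0∞}
    {μ : Measure (EuclideanSpace ℝ (Fin d))} [SFinite μ] {f : ℝ → EuclideanSpace ℝ (Fin d) → F}
    (h : MemL1TimeLp T r μ f) (hf : StronglyMeasurable (Function.uncurry f)) :
    ∀ᵐ s ∂(volume.restrict (Icc 0 T)), MemLp (f s) r μ := by
  filter_upwards [ae_lt_top (measurable_eLpNorm_slice hf r μ) h.2.ne] with s hs
  exact ⟨(hf.comp_measurable measurable_prodMk_left).aestronglyMeasurable, hs⟩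

theorem ae_forall_memLp_ball {d : ℕ} {F : Type*} [NormedAddCommGroup F] {T : ℝ} {r : ℝ≥0∞}
    {f : ℝ → EuclideanSpace ℝ (Fin d) → F} (hf : StronglyMeasurable (Function.uncurry f))
    (h : ∀ R : ℝ, MemL1TimeLp T r (volume.restrict (Metric.ball 0 R)) f) :
    ∀ᵐ s ∂(volume.restrict (Icc 0 T)), ∀ R : ℝ, MemLp (f s) r (volume.restrict (Metric.ball 0 R)) := by
  have : ∀ᵐ s ∂(volume.restrict (Icc 0 T)),
      ∀ n : ℕ, MemLp (f s) r (volume.restrict (Metric.ball 0 (n : ℝ))) :=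
    ae_all_iff.2 fun n => (h n).ae_memLp hf
  filter_upwards [this] with s hs R
  obtain ⟨n, hn⟩ := exists_nat_ge R
  exact (hs n).mono_measure (Measure.restrict_mono (Metric.ball_subset_ball hn) le_rfl)

theorem prod_restrict_ball_eq {d : ℕ} (μ : Measure ℝ) [SFinite μ] (R : ℝ) :
    μ.prod (volume.restrict (Metric.ball (0 : EuclideanSpace ℝ (Fin d)) R)) =
      (μ.prod volume).restrict (univ ×ˢ Metric.ball 0 R) := by
  rw [← Measure.prod_restrict, Measure.restrict_univ]

theorem iUnion_univ_prod_ball (d : ℕ) :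
    ⋃ n : ℕ, (univ : Set ℝ) ×ˢ Metric.ball (0 : EuclideanSpace ℝ (Fin d)) n = univ := by
  rw [← prod_iUnion, Metric.iUnion_ball_nat, univ_prod_univ]

theorem aestronglyMeasurable_of_forall_ball {d : ℕ} {F : Type*} [NormedAddCommGroup F]
    {μ : Measure ℝ} [SFinite μ] {f : ℝ → EuclideanSpace ℝ (Fin d) → F}
    (h : ∀ R : ℝ, AEStronglyMeasurable (Function.uncurry f)
      (μ.prod (volume.restrict (Metric.ball 0 R)))) :
    AEStronglyMeasurable (Function.uncurry f) (μ.prod volume) := by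
  rw [← Measure.restrict_univ (μ := μ.prod volume), ← iUnion_univ_prod_ball d,
    aestronglyMeasurable_iUnion_iff]
  intro n
  rw [← prod_restrict_ball_eq]
  exact h n

theorem ae_eq_restrict_ball {d : ℕ} {F : Type*} {μ : Measure ℝ} [SFinite μ]
    {f g : ℝ × EuclideanSpace ℝ (Fin d) → F} (h : f =ᵐ[μ.prod volume] g) (R : ℝ) :
    f =ᵐ[μ.prod (volume.restrict (Metric.ball 0 R))] g := by
  rw [prod_restrict_ball_eq]
  exact ae_restrict_of_ae h

/-- Hölder's inequality for an integral over a set. -/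
theorem setLIntegral_enorm_mul_enorm_le {X F : Type*} [MeasurableSpace X] {μ : Measure X}
    [NormedAddCommGroup F] [NormedSpace ℝ F] {q r : ℝ≥0∞} [hqr : ENNReal.HolderConjugate q r]
    {f : X → ℝ} {h : X → F} (hf : AEStronglyMeasurable f μ) {s : Set X}
    (hh : AEStronglyMeasurable h (μ.restrict s)) :
    ∫⁻ x in s, ‖f x‖ₑ * ‖h x‖ₑ ∂μ ≤ eLpNorm f q μ * eLpNorm h r (μ.restrict s) := by
  have := eLpNorm_smul_le_mul_eLpNorm (p := q) (q := r) (r := 1) hh hf.restrict (μ := μ.restrict s)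
  rw [eLpNorm_one_eq_lintegral_enorm] at this
  simp only [Pi.smul_apply', enorm_smul] at this
  refine this.trans ?_
  gcongr
  exact Measure.restrict_le_self

theorem locallyIntegrable_smul_of_memLp {d : ℕ} {F : Type*} [NormedAddCommGroup F]
    [NormedSpace ℝ F] {q r : ℝ≥0∞} [hqr : ENNReal.HolderConjugate q r]
    {f : EuclideanSpace ℝ (Fin d) → ℝ} {h : EuclideanSpace ℝ (Fin d) → F} (hf : MemLp f q)
    (hh : ∀ R : ℝ, MemLp h r (volume.restrict (Metric.ball 0 R))) :
    LocallyIntegrable fun x => f x • h x :=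
  locallyIntegrable_of_forall_ball fun R => memLp_one_iff_integrable.1
    (MemLp.smul (p := q) (q := r) (r := 1) (hh R) (hf.restrict _))

end Slices

/-! ### Borel data for the transport problem and bounds on the mollified flux. -/

section TransportData

variable {d : ℕ}

/-- A Borel density `f` and a Borel field `w` with weak gradient `H`, in dual Lebesgue spaces. -/
structure IsRegularSlice (q r C : ℝ≥0∞)
    (w : EuclideanSpace ℝ (Fin d) → EuclideanSpace ℝ (Fin d))
    (H : EuclideanSpace ℝ (Fin d) → EuclideanSpace ℝ (Fin d) →L[ℝ] EuclideanSpace ℝ (Fin d))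
    (f : EuclideanSpace ℝ (Fin d) → ℝ) : Prop where
  field_measurable : StronglyMeasurable w
  grad_measurable : StronglyMeasurable H
  density_measurable : StronglyMeasurable f
  weakGradient : HasWeakGradient w H
  field_memLp : ∀ R : ℝ, MemLp w r (volume.restrict (Metric.ball 0 R))
  grad_memLp : ∀ R : ℝ, MemLp H r (volume.restrict (Metric.ball 0 R))
  integrable : Integrable f
  memLp : MemLp f q
  lintegral_le : ∫⁻ x, ‖f x‖ₑ ≤ C
  eLpNorm_le : eLpNorm f q volume ≤ C

/-- Borel representatives of a density bounded in `L¹ ∩ L^q` and of a field in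
`L¹(0,T; W^{1,r}_loc)`. -/
structure IsTransportData (T : ℝ) (q r C : ℝ≥0∞)
    (v : ℝ → EuclideanSpace ℝ (Fin d) → EuclideanSpace ℝ (Fin d))
    (G : ℝ → EuclideanSpace ℝ (Fin d) → EuclideanSpace ℝ (Fin d) →L[ℝ] EuclideanSpace ℝ (Fin d))
    (ψ : ℝ → EuclideanSpace ℝ (Fin d) → ℝ) : Prop where
  field_measurable : StronglyMeasurable (Function.uncurry v)
  grad_measurable : StronglyMeasurable (Function.uncurry G)
  density_measurable : StronglyMeasurable (Function.uncurry ψ)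
  field_memL1 : ∀ R : ℝ, MemL1TimeLp T r (volume.restrict (Metric.ball 0 R)) v
  grad_memL1 : ∀ R : ℝ, MemL1TimeLp T r (volume.restrict (Metric.ball 0 R)) G
  weakGradient : ∀ᵐ s ∂(volume.restrict (Icc 0 T)), HasWeakGradient (v s) (G s)
  eLpNorm_le : ∀ᵐ s ∂(volume.restrict (Icc 0 T)),
    eLpNorm (ψ s) 1 volume ≤ C ∧ eLpNorm (ψ s) q volume ≤ C

variable {T : ℝ} {q r C : ℝ≥0∞}
  {v : ℝ → EuclideanSpace ℝ (Fin d) → EuclideanSpace ℝ (Fin d)}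
  {G : ℝ → EuclideanSpace ℝ (Fin d) → EuclideanSpace ℝ (Fin d) →L[ℝ] EuclideanSpace ℝ (Fin d)}
  {ψ : ℝ → EuclideanSpace ℝ (Fin d) → ℝ}

theorem IsTransportData.ae_isRegularSlice (h : IsTransportData T q r C v G ψ) (hC : C ≠ ∞) :
    ∀ᵐ s ∂(volume.restrict (Icc 0 T)), IsRegularSlice q r C (v s) (G s) (ψ s) := by
  filter_upwards [h.weakGradient, h.eLpNorm_le,
    ae_forall_memLp_ball h.field_measurable h.field_memL1,
    ae_forall_memLp_ball h.grad_measurable h.grad_memL1] with s h1 h2 h3 h4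
  have hm : StronglyMeasurable (ψ s) := h.density_measurable.comp_measurable measurable_prodMk_left
  exact
    { field_measurable := h.field_measurable.comp_measurable measurable_prodMk_left
      grad_measurable := h.grad_measurable.comp_measurable measurable_prodMk_left
      density_measurable := hm
      weakGradient := h1
      field_memLp := h3
      grad_memLp := h4
      integrable := memLp_one_iff_integrable.1 ⟨hm.aestronglyMeasurable, h2.1.trans_lt hC.lt_top⟩
      memLp := ⟨hm.aestronglyMeasurable, h2.2.trans_lt hC.lt_top⟩
      lintegral_le := by rw [← eLpNorm_one_eq_lintegral_enorm]; exact h2.1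
      eLpNorm_le := h2.2 }

section Measurability

variable {ρ : EuclideanSpace ℝ (Fin d) → ℝ} {ε α : ℝ}

theorem IsMollifier.stronglyMeasurable_mollify (hρ : IsMollifier ρ ε)
    (hψ : StronglyMeasurable (Function.uncurry ψ)) :
    StronglyMeasurable fun p : ℝ × EuclideanSpace ℝ (Fin d) => mollify ρ (ψ p.1) p.2 := by
  have : StronglyMeasurable fun p : (ℝ × EuclideanSpace ℝ (Fin d)) × EuclideanSpace ℝ (Fin d) =>
      ψ p.1.1 p.2 * ρ (p.1.2 - p.2) :=
    StronglyMeasurable.mul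
      (hψ.comp_measurable (g := fun p : (ℝ × EuclideanSpace ℝ (Fin d)) × EuclideanSpace ℝ (Fin d) =>
        (p.1.1, p.2)) (by fun_prop))
      (hρ.continuous.stronglyMeasurable.comp_measurable (by fun_prop))
  exact this.integral_prod_right'

theorem IsMollifier.stronglyMeasurable_mollifiedFlux (hρ : IsMollifier ρ ε) (hα₀ : 0 < α)
    (hα₂ : α ≤ 2) (hψ : StronglyMeasurable (Function.uncurry ψ))
    (hv : StronglyMeasurable (Function.uncurry v)) :
    StronglyMeasurable fun p : ℝ × EuclideanSpace ℝ (Fin d) =>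
      mollifiedFlux α ρ (v p.1) (ψ p.1) p.2 := by
  have hg : Measurable fun p : (ℝ × EuclideanSpace ℝ (Fin d)) × EuclideanSpace ℝ (Fin d) =>
      (p.1.1, p.2) := by fun_prop
  have : StronglyMeasurable fun p : (ℝ × EuclideanSpace ℝ (Fin d)) × EuclideanSpace ℝ (Fin d) =>
      ψ p.1.1 p.2 * (-fderiv ℝ ρ (p.1.2 - p.2) (v p.1.1 p.2) -
        fracLaplacian α ρ (p.2 - p.1.2)) := by
    refine (hψ.comp_measurable hg).mul (StronglyMeasurable.sub (StronglyMeasurable.neg ?_) ?_)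
    · exact isBoundedBilinearMap_apply.continuous.comp_stronglyMeasurable
        ((hρ.continuous_fderiv.stronglyMeasurable.comp_measurable
          (g := fun p : (ℝ × EuclideanSpace ℝ (Fin d)) × EuclideanSpace ℝ (Fin d) => p.1.2 - p.2)
          (by fun_prop)).prodMk (hv.comp_measurable hg))
    · exact (continuous_fracLaplacian hρ.contDiff hρ.hasCompactSupport hα₀
        hα₂).stronglyMeasurable.comp_measurable (by fun_prop)
  have h2 := this.integral_prod_right' (ν := volume)
  simp only [mollifiedFlux, hρ.fderiv_comp_sub_left_apply, fracLaplacian_comp_sub hρ]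
  exact h2

theorem IsMollifier.measurable_commutatorDefect (hρ : IsMollifier ρ ε)
    (hψ : StronglyMeasurable (Function.uncurry ψ)) (hv : StronglyMeasurable (Function.uncurry v))
    (hG : StronglyMeasurable (Function.uncurry G)) :
    Measurable fun p : ℝ × EuclideanSpace ℝ (Fin d) =>
      commutatorDefect ρ (ψ p.1) (v p.1) (G p.1) p.2 := by
  have m1 : Measurable fun p : (ℝ × EuclideanSpace ℝ (Fin d)) × EuclideanSpace ℝ (Fin d) =>
      (p.1.1, p.1.2) := by fun_prop
  have m2 : Measurable fun p : (ℝ × EuclideanSpace ℝ (Fin d)) × EuclideanSpace ℝ (Fin d) =>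
      (p.1.1, p.1.2 - p.2) := by fun_prop
  have : Measurable fun p : (ℝ × EuclideanSpace ℝ (Fin d)) × EuclideanSpace ℝ (Fin d) =>
      ‖fderiv ℝ ρ p.2‖ₑ * ‖ψ p.1.1 (p.1.2 - p.2) • (v p.1.1 p.1.2 - v p.1.1 (p.1.2 - p.2)) -
        ψ p.1.1 p.1.2 • G p.1.1 p.1.2 p.2‖ₑ := by
    refine Measurable.mul ?_ (StronglyMeasurable.enorm (StronglyMeasurable.sub ?_ ?_))
    · exact (hρ.continuous_fderiv.measurable.comp measurable_snd).enorm
    · exact (hψ.comp_measurable m2).smul ((hv.comp_measurable m1).sub (hv.comp_measurable m2))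
    · refine (hψ.comp_measurable m1).smul ?_
      exact isBoundedBilinearMap_apply.continuous.comp_stronglyMeasurable
        ((hG.comp_measurable m1).prodMk measurable_snd.stronglyMeasurable)
  exact this.lintegral_prod_right'

end Measurability

theorem IsTransportData.lintegral_flux_bound_lt_top {C₁ C₂ : ℝ≥0∞} (h₁ : C₁ ≠ ∞) (h₂ : C₂ ≠ ∞)
    (h : IsTransportData T q r C v G ψ) (R : ℝ) :
    ∫⁻ s in Icc 0 T, (C₁ * eLpNorm (v s) r (volume.restrict (Metric.ball 0 R)) + C₂) < ∞ := by
  rw [lintegral_add_right _ measurable_const, lintegral_const_mul' _ _ h₁]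
  refine ENNReal.add_lt_top.2 ⟨ENNReal.mul_lt_top h₁.lt_top (h.field_memL1 R).2, ?_⟩
  rw [lintegral_const]
  exact ENNReal.mul_lt_top h₂.lt_top (measure_lt_top _ _)

section Flux

variable {ρ f : EuclideanSpace ℝ (Fin d) → ℝ} {α : ℝ}
  {w : EuclideanSpace ℝ (Fin d) → EuclideanSpace ℝ (Fin d)}
  {H : EuclideanSpace ℝ (Fin d) → EuclideanSpace ℝ (Fin d) →L[ℝ] EuclideanSpace ℝ (Fin d)}
  [hqr : ENNReal.HolderConjugate q r]

/-- A crude bound for one fixed mollifier; it need not be uniform in `ρ`. It only makes the flux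
integrable in time and space, as required by the chain rule in time and by Fubini. -/
theorem IsRegularSlice.enorm_mollifiedFlux_le {ε K : ℝ} (h : IsRegularSlice q r C w H f)
    (hρ : IsMollifier ρ ε) (hK : ∀ z, ‖fderiv ℝ ρ z‖ ≤ K) {R : ℝ}
    {x : EuclideanSpace ℝ (Fin d)} (hx : ‖x‖ ≤ R) :
    ‖mollifiedFlux α ρ w f x‖ₑ ≤
      ENNReal.ofReal K * (C * eLpNorm w r (volume.restrict (Metric.ball 0 (R + ε + 1)))) +
        ENNReal.ofReal (fracLaplacianBound α ρ) * C := by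
  have hfm := h.density_measurable.enorm
  have hwm := h.field_measurable.enorm
  have hb : ∀ y, ‖f y * (fderiv ℝ (fun y => ρ (x - y)) y (w y) -
      fracLaplacian α (fun y => ρ (x - y)) y)‖ₑ ≤
      (Metric.ball 0 (R + ε + 1)).indicator (fun y => ENNReal.ofReal K * (‖f y‖ₑ * ‖w y‖ₑ)) y +
        ENNReal.ofReal (fracLaplacianBound α ρ) * ‖f y‖ₑ := by
    intro y
    have e1 : ‖fderiv ℝ (fun y => ρ (x - y)) y (w y)‖ₑ * ‖f y‖ₑ ≤
        (Metric.ball 0 (R + ε + 1)).indicator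
          (fun y => ENNReal.ofReal K * (‖f y‖ₑ * ‖w y‖ₑ)) y := by
      rw [hρ.fderiv_comp_sub_left_apply, enorm_neg]
      by_cases hy : y ∈ Metric.ball (0 : EuclideanSpace ℝ (Fin d)) (R + ε + 1)
      · rw [indicator_of_mem hy, mul_comm ‖f y‖ₑ, ← mul_assoc]
        gcongr
        refine (ContinuousLinearMap.le_opENorm _ _).trans ?_
        gcongr
        rw [← ofReal_norm]
        exact ENNReal.ofReal_le_ofReal (hK _)
      -- The extra `1` in the radius makes this inequality strict, as the vanishing of the gradient
      -- of `ρ` requires.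
      · have : ε < ‖x - y‖ := by
          rw [mem_ball_zero_iff, not_lt] at hy
          have := norm_sub_norm_le y x
          rw [norm_sub_rev] at this
          linarith
        rw [hρ.fderiv_eq_zero this]
        simp
    have e2 : ‖fracLaplacian α (fun y => ρ (x - y)) y‖ₑ ≤
        ENNReal.ofReal (fracLaplacianBound α ρ) := by
      rw [← ofReal_norm, ← fracLaplacianBound_comp_sub hρ α x]
      exact ENNReal.ofReal_le_ofReal (abs_fracLaplacian_le α _ y)
    rw [enorm_mul, mul_comm]
    calc _ ≤ (‖fderiv ℝ (fun y => ρ (x - y)) y (w y)‖ₑ +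
          ‖fracLaplacian α (fun y => ρ (x - y)) y‖ₑ) * ‖f y‖ₑ := by
          gcongr
          exact enorm_sub_le
      _ ≤ _ := by
          rw [add_mul]
          gcongr
  unfold mollifiedFlux
  refine (enorm_integral_le_lintegral_enorm _).trans ((lintegral_mono hb).trans ?_)
  rw [lintegral_add_right _ (by fun_prop), lintegral_indicator measurableSet_ball,
    lintegral_const_mul _ (by fun_prop), lintegral_const_mul _ (by fun_prop)]
  have e3 : ∫⁻ y in Metric.ball 0 (R + ε + 1), ‖f y‖ₑ * ‖w y‖ₑ ≤
      C * eLpNorm w r (volume.restrict (Metric.ball 0 (R + ε + 1))) := by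
    refine (setLIntegral_enorm_mul_enorm_le (q := q) (r := r)
      h.density_measurable.aestronglyMeasurable
      h.field_measurable.aestronglyMeasurable).trans ?_
    gcongr
    exact h.eLpNorm_le
  gcongr
  exact h.lintegral_le

theorem IsTransportData.exists_ae_enorm_mollifiedFlux_le {ε : ℝ}
    (h : IsTransportData T q r C v G ψ) (hC : C ≠ ∞) (hρ : IsMollifier ρ ε) (R : ℝ) :
    ∃ B : ℝ → ℝ≥0∞, ∫⁻ s in Icc 0 T, B s < ∞ ∧
      ∀ᵐ s ∂(volume.restrict (Icc 0 T)), ∀ x ∈ Metric.ball (0 : EuclideanSpace ℝ (Fin d)) R,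
        ‖mollifiedFlux α ρ (v s) (ψ s) x‖ₑ ≤ B s := by
  obtain ⟨K, hK⟩ := hρ.continuous_fderiv.bounded_above_of_compact_support
    (hρ.hasCompactSupport.fderiv ℝ)
  refine ⟨fun s => ENNReal.ofReal K * C *
    eLpNorm (v s) r (volume.restrict (Metric.ball 0 (R + ε + 1))) +
      ENNReal.ofReal (fracLaplacianBound α ρ) * C,
    h.lintegral_flux_bound_lt_top (ENNReal.mul_ne_top ENNReal.ofReal_ne_top hC)
      (ENNReal.mul_ne_top ENNReal.ofReal_ne_top hC) _, ?_⟩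
  filter_upwards [h.ae_isRegularSlice hC] with s hs x hx
  rw [mul_assoc]
  exact hs.enorm_mollifiedFlux_le hρ hK (mem_ball_zero_iff.1 hx).le

theorem IsTransportData.integrable_mollifiedFlux {ε : ℝ}
    (h : IsTransportData T q r C v G ψ) (hC : C ≠ ∞) (hρ : IsMollifier ρ ε) (hα₀ : 0 < α)
    (hα₂ : α ≤ 2) (R : ℝ) :
    Integrable (fun p : ℝ × EuclideanSpace ℝ (Fin d) => mollifiedFlux α ρ (v p.1) (ψ p.1) p.2)
      ((volume.restrict (Icc 0 T)).prod (volume.restrict (Metric.ball 0 R))) := by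
  have hm := hρ.stronglyMeasurable_mollifiedFlux hα₀ hα₂ h.density_measurable h.field_measurable
  refine ⟨hm.aestronglyMeasurable, ?_⟩
  obtain ⟨B, hB, hle⟩ := h.exists_ae_enorm_mollifiedFlux_le (α := α) hC hρ R
  rw [hasFiniteIntegral_iff_enorm, lintegral_prod _ hm.enorm.aemeasurable]
  refine lt_of_le_of_lt (lintegral_mono_ae (g := fun s => B s *
    volume (Metric.ball (0 : EuclideanSpace ℝ (Fin d)) R)) ?_) ?_
  · filter_upwards [hle] with s hs
    rw [← setLIntegral_const]
    exact setLIntegral_mono' measurableSet_ball hs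
  · rw [lintegral_mul_const' _ _ measure_ball_lt_top.ne]
    exact ENNReal.mul_lt_top hB measure_ball_lt_top

theorem IsTransportData.integrableOn_mollifiedFlux {ε : ℝ}
    (h : IsTransportData T q r C v G ψ) (hC : C ≠ ∞) (hρ : IsMollifier ρ ε) (hα₀ : 0 < α)
    (hα₂ : α ≤ 2) (x : EuclideanSpace ℝ (Fin d)) :
    IntegrableOn (fun s => mollifiedFlux α ρ (v s) (ψ s) x) (Icc 0 T) := by
  have hm := hρ.stronglyMeasurable_mollifiedFlux hα₀ hα₂ h.density_measurable h.field_measurable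
  refine ⟨(hm.comp_measurable (measurable_prodMk_right (y := x))).aestronglyMeasurable, ?_⟩
  obtain ⟨B, hB, hle⟩ := h.exists_ae_enorm_mollifiedFlux_le (α := α) hC hρ (‖x‖ + 1)
  rw [hasFiniteIntegral_iff_enorm]
  refine lt_of_le_of_lt (lintegral_mono_ae ?_) hB
  filter_upwards [hle] with s hs using hs x (by simp)

end Flux

end TransportData

/-! ### The energy inequality integrated in time. -/

section Energy

variable {d : ℕ}

/-- `g` is the value at time `t` of the weak formulation with initial datum `f₀`, density `ψ` and
field `v`. -/
def IsWeakEvolution (α : ℝ) (v : ℝ → EuclideanSpace ℝ (Fin d) → EuclideanSpace ℝ (Fin d))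
    (ψ : ℝ → EuclideanSpace ℝ (Fin d) → ℝ) (f₀ : EuclideanSpace ℝ (Fin d) → ℝ) (t : ℝ)
    (g : EuclideanSpace ℝ (Fin d) → ℝ) : Prop :=
  ∀ φ : EuclideanSpace ℝ (Fin d) → ℝ, ContDiff ℝ ((⊤ : ℕ∞) : WithTop ℕ∞) φ →
    HasCompactSupport φ → ∫ x, g x * φ x = (∫ x, f₀ x * φ x) +
      ∫ τ in 0..t, ∫ x, ψ τ x * (fderiv ℝ φ x (v τ x) - fracLaplacian α φ x)

theorem ofReal_integral_le_lintegral_ofReal {X : Type*} [MeasurableSpace X] {μ : Measure X}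
    {f : X → ℝ} (hf : Integrable f μ) :
    ENNReal.ofReal (∫ x, f x ∂μ) ≤ ∫⁻ x, ENNReal.ofReal (f x) ∂μ := by
  rw [integral_eq_lintegral_pos_part_sub_lintegral_neg_part hf]
  refine (ENNReal.ofReal_le_ofReal (sub_le_self _ ENNReal.toReal_nonneg)).trans ?_
  exact ENNReal.ofReal_toReal_le

variable {T α ε δ R s : ℝ} {q r C : ℝ≥0∞} [hqr : ENNReal.HolderConjugate q r]
  {v : ℝ → EuclideanSpace ℝ (Fin d) → EuclideanSpace ℝ (Fin d)}
  {G : ℝ → EuclideanSpace ℝ (Fin d) → EuclideanSpace ℝ (Fin d) →L[ℝ] EuclideanSpace ℝ (Fin d)}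
  {ψ : ℝ → EuclideanSpace ℝ (Fin d) → ℝ}
  {ρ f₀ g φ : EuclideanSpace ℝ (Fin d) → ℝ}

theorem IsWeakEvolution.mollify_eq (h : IsWeakEvolution α v ψ f₀ s g) (hρ : IsMollifier ρ ε)
    (x : EuclideanSpace ℝ (Fin d)) :
    mollify ρ g x = mollify ρ f₀ x + ∫ τ in 0..s, mollifiedFlux α ρ (v τ) (ψ τ) x :=
  h _ (hρ.contDiff_comp_sub x) (hρ.hasCompactSupport_comp_sub x)

/-- The chain rule is applied to the primitive of the flux at the point `x`, which agrees with the
mollification of `ψ t` at almost every time and with that of `g` at the time `s`. The function `g`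
is separate from `ψ s` because the Borel representative may be wrong at the particular time `s`. The
initial term is dropped by its sign. -/
theorem smoothNegPart_mollify_le (hδ : 0 < δ) (hα₀ : 0 < α) (hα₂ : α ≤ 2) (hC : C ≠ ∞)
    (hρ : IsMollifier ρ ε) (h : IsTransportData T q r C v G ψ)
    (hψ : ∀ᵐ t ∂(volume.restrict (Icc 0 T)), IsWeakEvolution α v ψ f₀ t (ψ t))
    (hs : s ∈ Icc 0 T) (hg : IsWeakEvolution α v ψ f₀ s g) (hf₀ : ∀ᵐ x, 0 ≤ f₀ x)
    (x : EuclideanSpace ℝ (Fin d)) :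
    smoothNegPart δ (mollify ρ g x) ≤ ∫ τ in Ioc 0 s,
      deriv (smoothNegPart δ) (mollify ρ (ψ τ) x) * mollifiedFlux α ρ (v τ) (ψ τ) x := by
  have hF := h.integrableOn_mollifiedFlux hC hρ hα₀ hα₂ x
  have hFs : IntervalIntegrable (fun τ => mollifiedFlux α ρ (v τ) (ψ τ) x) volume 0 s := by
    rw [intervalIntegrable_iff_integrableOn_Ioc_of_le hs.1]
    exact hF.mono_set (Ioc_subset_Icc_self.trans (Icc_subset_Icc_right hs.2))
  have hch := integral_deriv_comp_mul_eq_sub (u₀ := mollify ρ f₀ x) (lipschitzWith_smoothNegPart hδ)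
    ((contDiff_smoothNegPart hδ (n := 1)).differentiable one_ne_zero) hFs
  rw [← hg.mollify_eq hρ] at hch
  have h0 : smoothNegPart δ (mollify ρ f₀ x) ≤ 0 := by
    refine smoothNegPart_nonpos hδ (integral_nonneg_of_ae ?_)
    filter_upwards [hf₀] with y hy using mul_nonneg hy (hρ.nonneg _)
  have h1 : smoothNegPart δ (mollify ρ g x) ≤ ∫ t in 0..s, deriv (smoothNegPart δ)
      (mollify ρ f₀ x + ∫ τ in 0..t, mollifiedFlux α ρ (v τ) (ψ τ) x) *
        mollifiedFlux α ρ (v t) (ψ t) x := by linarith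
  refine h1.trans (le_of_eq ?_)
  rw [intervalIntegral.integral_of_le hs.1]
  refine integral_congr_ae ?_
  filter_upwards [ae_restrict_of_ae_restrict_of_subset
    (Ioc_subset_Icc_self.trans (Icc_subset_Icc_right hs.2)) hψ] with t ht
  rw [ht.mollify_eq hρ]

/-- Integrate the pointwise inequality against `φ` and exchange the integrals. Taking positive parts
at each time then allows the time interval to be enlarged to `[0, T]`, so the right-hand side no
longer depends on `s`. -/
theorem ofReal_integral_mul_smoothNegPart_le (hδ : 0 < δ) (hα₀ : 0 < α) (hα₂ : α ≤ 2) (hC : C ≠ ∞)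
    (hρ : IsMollifier ρ ε) (h : IsTransportData T q r C v G ψ)
    (hψ : ∀ᵐ t ∂(volume.restrict (Icc 0 T)), IsWeakEvolution α v ψ f₀ t (ψ t))
    (hs : s ∈ Icc 0 T) (hg : IsWeakEvolution α v ψ f₀ s g) (hgi : Integrable g)
    (hf₀ : ∀ᵐ x, 0 ≤ f₀ x)
    (hφ : ContDiff ℝ ((⊤ : ℕ∞) : WithTop ℕ∞) φ) (hφc : HasCompactSupport φ) (hφ0 : ∀ x, 0 ≤ φ x) :
    ENNReal.ofReal (∫ x, φ x * smoothNegPart δ (mollify ρ g x)) ≤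
      ∫⁻ τ in Icc 0 T, ENNReal.ofReal (∫ x, φ x * deriv (smoothNegPart δ) (mollify ρ (ψ τ) x) *
        mollifiedFlux α ρ (v τ) (ψ τ) x) := by
  obtain ⟨R, hR, hsupp⟩ := hφc.exists_support_subset_ball
  have hz : ∀ x, x ∉ Metric.ball (0 : EuclideanSpace ℝ (Fin d)) R → φ x = 0 := fun x hx =>
    image_eq_zero_of_notMem_tsupport fun h => hx (hsupp h)
  have hβ : ContDiff ℝ 1 (smoothNegPart δ) := contDiff_smoothNegPart hδ
  have hsub : Ioc 0 s ⊆ Icc 0 T := Ioc_subset_Icc_self.trans (Icc_subset_Icc_right hs.2)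
  obtain ⟨K, hK⟩ := hφ.continuous.bounded_above_of_compact_support hφc
  let P : ℝ × EuclideanSpace ℝ (Fin d) → ℝ := fun p =>
    φ p.2 * deriv (smoothNegPart δ) (mollify ρ (ψ p.1) p.2) * mollifiedFlux α ρ (v p.1) (ψ p.1) p.2
  have hP : Integrable P ((volume.restrict (Ioc 0 s)).prod (volume.restrict (Metric.ball 0 R))) := by
    have h1 := (h.integrable_mollifiedFlux hC hρ hα₀ hα₂ R).mono_measure
      (Measure.prod_mono (Measure.restrict_mono hsub le_rfl) le_rfl)
    refine h1.bdd_mul (c := K * 1) (StronglyMeasurable.aestronglyMeasurable ?_)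
      (Eventually.of_forall fun p => ?_)
    · exact (hφ.continuous.stronglyMeasurable.comp_measurable measurable_snd).mul
        ((hβ.continuous_deriv (by simp)).comp_stronglyMeasurable
          (hρ.stronglyMeasurable_mollify h.density_measurable))
    · rw [norm_mul]
      exact mul_le_mul (hK _) (abs_deriv_smoothNegPart_le hδ _) (norm_nonneg _)
        ((norm_nonneg _).trans (hK p.2))
  have hcont : Continuous fun x => φ x * smoothNegPart δ (mollify ρ g x) :=
    hφ.continuous.mul (hβ.continuous.comp (hρ.contDiff_mollify hgi).continuous)
  have hint : Integrable fun x => φ x * smoothNegPart δ (mollify ρ g x) :=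
    hcont.integrable_of_hasCompactSupport hφc.mul_right
  have hle : ∫ x, φ x * smoothNegPart δ (mollify ρ g x) ≤
      ∫ τ in Ioc 0 s, ∫ x in Metric.ball 0 R, P (τ, x) := by
    rw [integral_integral_swap hP, ← setIntegral_eq_integral_of_forall_compl_eq_zero
      (s := Metric.ball 0 R) fun x hx => by rw [hz x hx, zero_mul]]
    refine integral_mono hint.integrableOn hP.integral_prod_right fun x => ?_
    have := mul_le_mul_of_nonneg_left
      (smoothNegPart_mollify_le hδ hα₀ hα₂ hC hρ h hψ hs hg hf₀ x) (hφ0 x)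
    refine this.trans (le_of_eq ?_)
    rw [← integral_const_mul]
    simp only [P, mul_assoc]
  refine (ENNReal.ofReal_le_ofReal hle).trans
    ((ofReal_integral_le_lintegral_ofReal hP.integral_prod_left).trans ?_)
  refine le_trans (le_of_eq (lintegral_congr fun τ => ?_)) (lintegral_mono_set hsub)
  congr 1
  exact setIntegral_eq_integral_of_forall_compl_eq_zero fun x hx => by
    simp only [P, hz x hx, zero_mul]

/-- The fixed-time bound is rearranged so that each term either vanishes with the mollification
scale, carries a factor `δ`, or depends on neither. Terms of the last kind are the flux of `f`
through the gradient of `φ` and the fractional Laplacian of `φ`. -/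
theorem IsRegularSlice.ofReal_integral_mul_mollifiedFlux_le {f : EuclideanSpace ℝ (Fin d) → ℝ}
    {w : EuclideanSpace ℝ (Fin d) → EuclideanSpace ℝ (Fin d)}
    {H : EuclideanSpace ℝ (Fin d) → EuclideanSpace ℝ (Fin d) →L[ℝ] EuclideanSpace ℝ (Fin d)}
    (h : IsRegularSlice q r C w H f) (hρ : IsMollifier ρ ε) (hδ : 0 < δ) (hα₀ : 0 < α) (hα₂ : α ≤ 2)
    (hφ : ContDiff ℝ ((⊤ : ℕ∞) : WithTop ℕ∞) φ) (hφc : HasCompactSupport φ) (hφ0 : ∀ x, 0 ≤ φ x)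
    (hsupp : tsupport φ ⊆ Metric.ball 0 R) {K : ℝ≥0∞} (hK : ∀ x, ‖φ x‖ₑ ≤ K)
    (hK' : ∀ x, ‖fderiv ℝ φ x‖ₑ ≤ K) :
    ENNReal.ofReal (∫ x, φ x * deriv (smoothNegPart δ) (mollify ρ f x) * mollifiedFlux α ρ w f x) ≤
      K * (∫⁻ x in Metric.ball 0 R, commutatorDefect ρ f w H x) +
      K * d * (∫⁻ x in Metric.ball 0 R, ‖f x - mollify ρ f x‖ₑ * ‖H x‖ₑ) +
      ENNReal.ofReal δ * (K * d * (∫⁻ x in Metric.ball 0 R, ‖H x‖ₑ)) +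
      K * (∫⁻ x in Metric.ball 0 R, ‖f x - mollify ρ f x‖ₑ * ‖w x‖ₑ) +
      (∫⁻ x, ‖f x‖ₑ * (‖fderiv ℝ φ x‖ₑ * ‖w x‖ₑ)) +
      ENNReal.ofReal (fracLaplacianBound α φ) * C := by
  have hz : ∀ x, x ∉ Metric.ball (0 : EuclideanSpace ℝ (Fin d)) R → φ x = 0 := fun x hx =>
    image_eq_zero_of_notMem_tsupport fun h => hx (hsupp h)
  have hz' : ∀ x, x ∉ Metric.ball (0 : EuclideanSpace ℝ (Fin d)) R → fderiv ℝ φ x = 0 :=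
    fun x hx => image_eq_zero_of_notMem_tsupport fun h => hx (hsupp (tsupport_fderiv_subset ℝ h))
  have loc : ∀ {a b : EuclideanSpace ℝ (Fin d) → ℝ≥0∞} {c : ℝ≥0∞}, Measurable b →
      (∀ x ∉ Metric.ball (0 : EuclideanSpace ℝ (Fin d)) R, a x = 0) → (∀ x, a x ≤ c * b x) →
      ∫⁻ x, a x ≤ c * ∫⁻ x in Metric.ball 0 R, b x := by
    intro a b c hb ha hab
    rw [← lintegral_const_mul _ hb, ← lintegral_indicator measurableSet_ball]
    refine lintegral_mono fun x => ?_
    by_cases hx : x ∈ Metric.ball (0 : EuclideanSpace ℝ (Fin d)) R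
    · rw [indicator_of_mem hx]; exact hab x
    · rw [ha x hx]; exact zero_le
  have hfm := h.density_measurable.measurable
  have hwm := h.field_measurable.measurable
  have hHm := h.grad_measurable.enorm
  have hwe := h.field_measurable.enorm
  have hfe := h.density_measurable.enorm
  have hmm : Measurable (mollify ρ f) := (hρ.contDiff_mollify h.integrable).continuous.measurable
  have hcm : Measurable (commutatorDefect ρ f w H) := by
    have := hρ.measurable_commutatorDefect (ψ := fun _ => f) (v := fun _ => w) (G := fun _ => H)
      (h.density_measurable.comp_measurable measurable_snd)
      (h.field_measurable.comp_measurable measurable_snd)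
      (h.grad_measurable.comp_measurable measurable_snd)
    have h0 : Measurable fun x : EuclideanSpace ℝ (Fin d) => ((0 : ℝ), x) := by fun_prop
    have h2 := this.comp h0
    simp only [Function.comp_def] at h2
    exact h2
  have hdiv : ∀ x, ‖divergence (H x)‖ₑ ≤ d * ‖H x‖ₑ := fun x => by
    rw [← ofReal_norm, ← ofReal_norm, ← ENNReal.ofReal_natCast,
      ← ENNReal.ofReal_mul (Nat.cast_nonneg d)]
    exact ENNReal.ofReal_le_ofReal (norm_divergence_le _)
  refine (_root_.ofReal_integral_mul_mollifiedFlux_le hρ h.integrable hfm h.weakGradient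
    (locallyIntegrable_smul_of_memLp h.memLp h.field_memLp)
    (locallyIntegrable_smul_of_memLp h.memLp h.grad_memLp) hφ hφc hφ0 hδ hα₀ hα₂).trans ?_
  have e5 : ∀ a b c x y z : ℝ≥0∞, a + b + c + x + y + z = a + b + c + (x + y) + z := by
    intros; ring
  rw [e5]
  refine add_le_add (add_le_add (add_le_add (add_le_add ?_ ?_) ?_) ?_) ?_
  · refine loc hcm (fun x hx => by simp [hz x hx]) fun x => ?_
    gcongr
    exact hK x
  · refine loc (by fun_prop) (fun x hx => by simp [hz x hx]) fun x => ?_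
    calc _ ≤ K * (‖f x - mollify ρ f x‖ₑ * (d * ‖H x‖ₑ)) := by
          gcongr
          exacts [hK x, hdiv x]
      _ = _ := by ring
  · rw [← mul_assoc]
    refine loc (by fun_prop) (fun x hx => by simp [hz x hx]) fun x => ?_
    calc _ ≤ K * (ENNReal.ofReal δ * (d * ‖H x‖ₑ)) := by
          gcongr
          exacts [hK x, hdiv x]
      _ = _ := by ring
  -- In the flux through the gradient of `φ`, the mollified density is split into `f` plus an error
  -- weighted by the field.
  · have hD : Measurable fun x => ‖fderiv ℝ φ x‖ₑ :=
      (hφ.continuous_fderiv (by simp)).measurable.enorm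
    calc ∫⁻ x, ‖mollify ρ f x‖ₑ * (‖fderiv ℝ φ x‖ₑ * ‖w x‖ₑ)
        ≤ ∫⁻ x, (‖f x - mollify ρ f x‖ₑ * (‖fderiv ℝ φ x‖ₑ * ‖w x‖ₑ) +
            ‖f x‖ₑ * (‖fderiv ℝ φ x‖ₑ * ‖w x‖ₑ)) := by
          refine lintegral_mono fun x => ?_
          rw [← add_mul]
          gcongr
          have : mollify ρ f x = f x - (f x - mollify ρ f x) := by ring
          nth_rw 1 [this]
          exact enorm_sub_le.trans_eq (add_comm _ _)
      _ ≤ _ := by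
          rw [lintegral_add_right _ (by fun_prop)]
          refine add_le_add_left (loc (by fun_prop) (fun x hx => ?_) fun x => ?_) _
          · rw [← ofReal_norm (fderiv ℝ φ x), hz' x hx]
            simp
          · calc _ ≤ ‖f x - mollify ρ f x‖ₑ * (K * ‖w x‖ₑ) := by
                  gcongr
                  exact hK' x
              _ = _ := by ring
  · gcongr
    exact h.lintegral_le

end Energy

/-! ### Removing the regularisation. -/

section EnergyLimit

variable {d : ℕ} {T α ε δ R s : ℝ} {q r C : ℝ≥0∞}
  {v : ℝ → EuclideanSpace ℝ (Fin d) → EuclideanSpace ℝ (Fin d)}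
  {G : ℝ → EuclideanSpace ℝ (Fin d) → EuclideanSpace ℝ (Fin d) →L[ℝ] EuclideanSpace ℝ (Fin d)}
  {ψ : ℝ → EuclideanSpace ℝ (Fin d) → ℝ}
  {ρ f₀ g φ : EuclideanSpace ℝ (Fin d) → ℝ}

/-- The negative part is 1-Lipschitz, and that of the mollified function is at most `smoothNegPart
δ` plus `δ`. The factor `‖(1 : ℝ)‖ₑ` gives the error the form of a weighted mollification error with
constant weight. -/
theorem lintegral_mul_ofReal_neg_le (hδ : 0 < δ) (hρ : IsMollifier ρ ε) (hg : StronglyMeasurable g)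
    (hgi : Integrable g)
    (hφ : ContDiff ℝ ((⊤ : ℕ∞) : WithTop ℕ∞) φ) (hφc : HasCompactSupport φ) (hφ0 : ∀ x, 0 ≤ φ x)
    (hsupp : tsupport φ ⊆ Metric.ball 0 R) {K : ℝ≥0∞} (hK : ∀ x, ‖φ x‖ₑ ≤ K) :
    ∫⁻ x, ‖φ x‖ₑ * ENNReal.ofReal (-g x) ≤
      K * (∫⁻ x in Metric.ball 0 R, ‖g x - mollify ρ g x‖ₑ * ‖(1 : ℝ)‖ₑ) +
        ENNReal.ofReal δ * (∫⁻ x, ‖φ x‖ₑ) +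
        ENNReal.ofReal (∫ x, φ x * smoothNegPart δ (mollify ρ g x)) := by
  have hmc : Continuous (mollify ρ g) := (hρ.contDiff_mollify hgi).continuous
  obtain ⟨c, hc⟩ := hφ.continuous.bounded_above_of_compact_support hφc
  have i1 : Integrable fun x => φ x * |g x - mollify ρ g x| :=
    (hgi.sub (hρ.integrable_mollify hgi)).abs.bdd_mul (c := c)
      hφ.continuous.aestronglyMeasurable (Eventually.of_forall hc)
  have i2 : Integrable fun x => δ * φ x :=
    (hφ.continuous.integrable_of_hasCompactSupport hφc).const_mul δ
  have i3 : Integrable fun x => φ x * smoothNegPart δ (mollify ρ g x) :=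
    (hφ.continuous.mul ((contDiff_smoothNegPart hδ (n := 1)).continuous.comp
      hmc)).integrable_of_hasCompactSupport hφc.mul_right
  have i0 : Integrable fun x => φ x * max (-g x) 0 :=
    hgi.neg.pos_part.bdd_mul (c := c) hφ.continuous.aestronglyMeasurable (Eventually.of_forall hc)
  have hle : ∫ x, φ x * max (-g x) 0 ≤ (∫ x, φ x * |g x - mollify ρ g x|) + (∫ x, δ * φ x) +
      ∫ x, φ x * smoothNegPart δ (mollify ρ g x) := by
    have i12 : Integrable fun x => φ x * |g x - mollify ρ g x| + δ * φ x := i1.add i2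
    rw [← integral_add i1 i2, ← integral_add i12 i3]
    refine integral_mono i0 (i12.add i3) fun x => ?_
    have h1 := max_neg_zero_le_smoothNegPart hδ (mollify ρ g x)
    have h2 : max (-g x) 0 ≤ |g x - mollify ρ g x| + max (-mollify ρ g x) 0 := by
      refine max_le ?_ (by positivity)
      have := neg_abs_le (g x - mollify ρ g x)
      have := le_max_left (-mollify ρ g x) 0
      linarith
    have := mul_le_mul_of_nonneg_left (h2.trans (add_le_add_right h1 _)) (hφ0 x)
    refine this.trans (le_of_eq ?_)
    ring
  have e0 : ∫⁻ x, ‖φ x‖ₑ * ENNReal.ofReal (-g x) = ENNReal.ofReal (∫ x, φ x * max (-g x) 0) := by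
    rw [ofReal_integral_eq_lintegral_ofReal i0
      (Eventually.of_forall fun x => mul_nonneg (hφ0 x) (le_max_right _ _))]
    refine lintegral_congr fun x => ?_
    rw [ENNReal.ofReal_mul (hφ0 x), Real.enorm_eq_ofReal (hφ0 x)]
    congr 1
    rw [ENNReal.ofReal_max, ENNReal.ofReal_zero, max_eq_left zero_le]
  rw [e0]
  refine (ENNReal.ofReal_le_ofReal hle).trans (ENNReal.ofReal_add_le.trans
    (add_le_add_left (ENNReal.ofReal_add_le.trans (add_le_add ?_ ?_)) _))
  · have hme : Measurable fun x => ‖g x - mollify ρ g x‖ₑ * ‖(1 : ℝ)‖ₑ :=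
      (hg.measurable.sub hmc.measurable).enorm.mul measurable_const
    rw [ofReal_integral_eq_lintegral_ofReal i1
      (Eventually.of_forall fun x => mul_nonneg (hφ0 x) (abs_nonneg _)),
      ← lintegral_const_mul _ hme,
      ← lintegral_indicator measurableSet_ball]
    refine lintegral_mono fun x => ?_
    by_cases hx : x ∈ Metric.ball (0 : EuclideanSpace ℝ (Fin d)) R
    · rw [indicator_of_mem hx, ENNReal.ofReal_mul (hφ0 x), ← Real.enorm_eq_ofReal (hφ0 x),
        ← Real.enorm_eq_ofReal_abs, enorm_one, mul_one]
      gcongr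
      exact hK x
    · rw [image_eq_zero_of_notMem_tsupport fun h => hx (hsupp h)]
      simp
  · rw [integral_const_mul, ENNReal.ofReal_mul hδ.le, ofReal_integral_eq_lintegral_ofReal
      (hφ.continuous.integrable_of_hasCompactSupport hφc) (Eventually.of_forall hφ0)]
    refine le_of_eq (congrArg _ (lintegral_congr fun x => ?_))
    rw [Real.enorm_eq_ofReal (hφ0 x)]

theorem tendsto_lintegral_zero_of_dominated {X : Type*} [MeasurableSpace X] {μ : Measure X}
    {F : ℕ → X → ℝ≥0∞} (bound : X → ℝ≥0∞) (hF : ∀ n, Measurable (F n))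
    (hle : ∀ n, ∀ᵐ x ∂μ, F n x ≤ bound x) (hb : ∫⁻ x, bound x ∂μ < ∞)
    (hlim : ∀ᵐ x ∂μ, Tendsto (fun n => F n x) atTop (𝓝 0)) :
    Tendsto (fun n => ∫⁻ x, F n x ∂μ) atTop (𝓝 0) := by
  have := tendsto_lintegral_of_dominated_convergence' (f := fun _ => 0) bound
    (fun n => (hF n).aemeasurable) hle hb.ne hlim
  simpa using this

theorem setLIntegral_enorm_le_mul_eLpNorm {F : Type*} [NormedAddCommGroup F] [NormedSpace ℝ F]
    [hqr : ENNReal.HolderConjugate q r]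
    {h : EuclideanSpace ℝ (Fin d) → F}
    (hh : AEStronglyMeasurable h (volume.restrict (Metric.ball 0 R))) :
    ∫⁻ x in Metric.ball 0 R, ‖h x‖ₑ ≤
      eLpNorm ((Metric.ball (0 : EuclideanSpace ℝ (Fin d)) R).indicator fun _ => (1 : ℝ)) q volume *
        eLpNorm h r (volume.restrict (Metric.ball 0 R)) := by
  refine le_trans (le_of_eq (setLIntegral_congr_fun measurableSet_ball fun x hx => ?_))
    (setLIntegral_enorm_mul_enorm_le (q := q) (r := r)
      (stronglyMeasurable_const.indicator measurableSet_ball).aestronglyMeasurable hh)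
  simp only [indicator_of_mem hx, enorm_one, one_mul]

/-- Each regularisation error tends to zero for almost every time and is dominated, uniformly in the
scale, by an integrable function of time. In the limit only the terms produced by the cutoff `φ`
remain. -/
theorem IsTransportData.lintegral_neg_le [hqr : ENNReal.HolderConjugate q r] (hα₀ : 0 < α)
    (hα₂ : α ≤ 2) (hC : C ≠ ∞) (h : IsTransportData T q r C v G ψ)
    (hψ : ∀ᵐ t ∂(volume.restrict (Icc 0 T)), IsWeakEvolution α v ψ f₀ t (ψ t))
    (hs : s ∈ Icc 0 T) (hg : IsWeakEvolution α v ψ f₀ s g) (hgm : StronglyMeasurable g)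
    (hgi : Integrable g) (hf₀ : ∀ᵐ x, 0 ≤ f₀ x)
    (hφ : ContDiff ℝ ((⊤ : ℕ∞) : WithTop ℕ∞) φ) (hφc : HasCompactSupport φ) (hφ0 : ∀ x, 0 ≤ φ x) :
    ∫⁻ x, ‖φ x‖ₑ * ENNReal.ofReal (-g x) ≤
      (∫⁻ τ in Icc 0 T, ∫⁻ x, ‖ψ τ x‖ₑ * (‖fderiv ℝ φ x‖ₑ * ‖v τ x‖ₑ)) +
        ENNReal.ofReal T * (ENNReal.ofReal (fracLaplacianBound α φ) * C) := by
  obtain ⟨R, hR, hsupp⟩ := hφc.exists_support_subset_ball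
  obtain ⟨K₁, hK₁⟩ := hφ.continuous.bounded_above_of_compact_support hφc
  obtain ⟨K₂, hK₂⟩ := (hφ.continuous_fderiv (by simp)).bounded_above_of_compact_support
    (hφc.fderiv ℝ)
  obtain ⟨K, hK, hKφ, hKD⟩ : ∃ K : ℝ≥0∞, K ≠ ∞ ∧ (∀ x, ‖φ x‖ₑ ≤ K) ∧
      ∀ x, ‖fderiv ℝ φ x‖ₑ ≤ K := by
    refine ⟨ENNReal.ofReal (max K₁ K₂), ENNReal.ofReal_ne_top, fun x => ?_, fun x => ?_⟩
    · rw [← ofReal_norm]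
      exact ENNReal.ofReal_le_ofReal ((hK₁ x).trans (le_max_left _ _))
    · rw [← ofReal_norm]
      exact ENNReal.ofReal_le_ofReal ((hK₂ x).trans (le_max_right _ _))
  obtain ⟨ρ, c, hc, hρc⟩ := exists_isMollifier_seq d
  have hρ : ∀ n : ℕ, IsMollifier (ρ n) (1 / (n + 1)) := fun n => (hρc n).1
  have hsl := h.ae_isRegularSlice hC
  have mψ := h.density_measurable
  have mv := h.field_measurable
  have mG := h.grad_measurable
  have mm : ∀ n, StronglyMeasurable
      fun p : ℝ × EuclideanSpace ℝ (Fin d) => ψ p.1 p.2 - mollify (ρ n) (ψ p.1) p.2 := fun n =>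
    mψ.sub ((hρ n).stronglyMeasurable_mollify mψ)
  let Q₁ : ℕ → ℝ → ℝ≥0∞ := fun n τ =>
    ∫⁻ x in Metric.ball 0 R, commutatorDefect (ρ n) (ψ τ) (v τ) (G τ) x
  let Q₂ : ℕ → ℝ → ℝ≥0∞ := fun n τ =>
    ∫⁻ x in Metric.ball 0 R, ‖ψ τ x - mollify (ρ n) (ψ τ) x‖ₑ * ‖G τ x‖ₑ
  let Q₃ : ℝ → ℝ≥0∞ := fun τ => ∫⁻ x in Metric.ball 0 R, ‖G τ x‖ₑ
  let Q₄ : ℕ → ℝ → ℝ≥0∞ := fun n τ =>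
    ∫⁻ x in Metric.ball 0 R, ‖ψ τ x - mollify (ρ n) (ψ τ) x‖ₑ * ‖v τ x‖ₑ
  let V : ℝ → ℝ≥0∞ := fun τ => ∫⁻ x, ‖ψ τ x‖ₑ * (‖fderiv ℝ φ x‖ₑ * ‖v τ x‖ₑ)
  have m₁ : ∀ n, Measurable (Q₁ n) := fun n =>
    ((hρ n).measurable_commutatorDefect mψ mv mG).lintegral_prod_right'
  have m₂ : ∀ n, Measurable (Q₂ n) := fun n =>
    Measurable.lintegral_prod_right' (f := fun p : ℝ × EuclideanSpace ℝ (Fin d) =>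
      ‖ψ p.1 p.2 - mollify (ρ n) (ψ p.1) p.2‖ₑ * ‖G p.1 p.2‖ₑ) ((mm n).enorm.mul mG.enorm)
  have m₃ : Measurable Q₃ := Measurable.lintegral_prod_right'
    (f := fun p : ℝ × EuclideanSpace ℝ (Fin d) => ‖G p.1 p.2‖ₑ) mG.enorm
  have m₄ : ∀ n, Measurable (Q₄ n) := fun n =>
    Measurable.lintegral_prod_right' (f := fun p : ℝ × EuclideanSpace ℝ (Fin d) =>
      ‖ψ p.1 p.2 - mollify (ρ n) (ψ p.1) p.2‖ₑ * ‖v p.1 p.2‖ₑ) ((mm n).enorm.mul mv.enorm)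
  have mV : Measurable V := Measurable.lintegral_prod_right'
    (f := fun p : ℝ × EuclideanSpace ℝ (Fin d) =>
      ‖ψ p.1 p.2‖ₑ * (‖fderiv ℝ φ p.2‖ₑ * ‖v p.1 p.2‖ₑ))
    (mψ.enorm.mul (((hφ.continuous_fderiv (by simp)).measurable.comp measurable_snd).enorm.mul
      mv.enorm))
  -- The common time majorant for all errors: it is applied with the gradient for the commutator and
  -- the divergence term, and with the field for the flux.
  have fin : ∀ {F : Type} [NormedAddCommGroup F] {f : ℝ → EuclideanSpace ℝ (Fin d) → F} (a : ℝ≥0∞),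
      a ≠ ∞ → (∀ R : ℝ, MemL1TimeLp T r (volume.restrict (Metric.ball 0 R)) f) →
      ∫⁻ τ in Icc 0 T, a * (2 * (C * eLpNorm (f τ) r (volume.restrict (Metric.ball 0 (R + 1))))) <
        ∞ := by
    intro F _ f a ha hf
    rw [lintegral_const_mul' _ _ ha, lintegral_const_mul' _ _ ENNReal.ofNat_ne_top,
      lintegral_const_mul' _ _ hC]
    exact ENNReal.mul_lt_top ha.lt_top (ENNReal.mul_lt_top ENNReal.ofNat_lt_top
      (ENNReal.mul_lt_top hC.lt_top (hf _).2))
  have t₁ : Tendsto (fun n => ∫⁻ τ in Icc 0 T, Q₁ n τ) atTop (𝓝 0) := by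
    refine tendsto_lintegral_zero_of_dominated _ m₁ (fun n => ?_) (fin c hc h.grad_memL1) ?_
    · filter_upwards [hsl] with τ hτ
      refine (lintegral_commutatorDefect_le_of_memLp hρc hτ.density_measurable hτ.field_measurable
        hτ.grad_measurable hτ.weakGradient hτ.memLp hτ.grad_memLp n).trans ?_
      gcongr
      exact hτ.eLpNorm_le
    · filter_upwards [hsl] with τ hτ
      exact tendsto_lintegral_commutatorDefect hc hρc hτ.density_measurable hτ.field_measurable
        hτ.grad_measurable hτ.weakGradient hτ.memLp hτ.grad_memLp
  have t₂ : Tendsto (fun n => ∫⁻ τ in Icc 0 T, Q₂ n τ) atTop (𝓝 0) := by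
    refine tendsto_lintegral_zero_of_dominated _ m₂ (fun n => ?_)
      (fin 1 ENNReal.one_ne_top h.grad_memL1) ?_
    · filter_upwards [hsl] with τ hτ
      rw [one_mul]
      refine (lintegral_sub_mollify_mul_le_of_memLp hρ hτ.integrable hτ.density_measurable
        hτ.grad_measurable hτ.memLp hτ.grad_memLp n).trans ?_
      gcongr
      exact hτ.eLpNorm_le
    · filter_upwards [hsl] with τ hτ
      exact tendsto_lintegral_sub_mollify_mul hρ hτ.integrable hτ.density_measurable
        hτ.grad_measurable hτ.memLp hτ.grad_memLp
  have t₄ : Tendsto (fun n => ∫⁻ τ in Icc 0 T, Q₄ n τ) atTop (𝓝 0) := by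
    refine tendsto_lintegral_zero_of_dominated _ m₄ (fun n => ?_)
      (fin 1 ENNReal.one_ne_top h.field_memL1) ?_
    · filter_upwards [hsl] with τ hτ
      rw [one_mul]
      refine (lintegral_sub_mollify_mul_le_of_memLp hρ hτ.integrable hτ.density_measurable
        hτ.field_measurable hτ.memLp hτ.field_memLp n).trans ?_
      gcongr
      exact hτ.eLpNorm_le
    · filter_upwards [hsl] with τ hτ
      exact tendsto_lintegral_sub_mollify_mul hρ hτ.integrable hτ.density_measurable
        hτ.field_measurable hτ.memLp hτ.field_memLp
  have f₃ : ∫⁻ τ in Icc 0 T, Q₃ τ ≠ ∞ := by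
    have hind : eLpNorm ((Metric.ball (0 : EuclideanSpace ℝ (Fin d)) R).indicator
        fun _ => (1 : ℝ)) q volume ≠ ∞ :=
      (memLp_indicator_const q measurableSet_ball 1 (Or.inr measure_ball_lt_top.ne)).2.ne
    refine (lt_of_le_of_lt (lintegral_mono_ae (hsl.mono fun τ hτ =>
      setLIntegral_enorm_le_mul_eLpNorm (q := q) (r := r) (hτ.grad_memLp R).1)) ?_).ne
    rw [lintegral_const_mul' _ _ hind]
    exact ENNReal.mul_lt_top hind.lt_top (h.grad_memL1 R).2
  -- Convergence of mollifications in `L¹` on the ball, as the case of exponents `1` and `∞` with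
  -- constant weight.
  have tg : Tendsto (fun n => ∫⁻ x in Metric.ball 0 R,
      ‖g x - mollify (ρ n) g x‖ₑ * ‖(1 : ℝ)‖ₑ) atTop (𝓝 0) :=
    tendsto_lintegral_sub_mollify_mul (q := 1) (r := ∞) (h := fun _ => (1 : ℝ)) hρ hgi hgm
      stronglyMeasurable_const (memLp_one_iff_integrable.2 hgi) fun R => memLp_top_const 1
  have tδ : Tendsto (fun n : ℕ => ENNReal.ofReal (1 / ((n : ℝ) + 1))) atTop (𝓝 0) := by
    rw [← ENNReal.ofReal_zero]
    exact (ENNReal.continuous_ofReal.tendsto 0).comp tendsto_one_div_add_atTop_nhds_zero_nat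
  have fφ : ∫⁻ x, ‖φ x‖ₑ ≠ ∞ :=
    (hφ.continuous.integrable_of_hasCompactSupport hφc).2.ne
  have hKd : K * d ≠ ∞ := ENNReal.mul_ne_top hK (ENNReal.natCast_ne_top d)
  have key : ∀ n : ℕ, ∫⁻ x, ‖φ x‖ₑ * ENNReal.ofReal (-g x) ≤
      K * (∫⁻ x in Metric.ball 0 R, ‖g x - mollify (ρ n) g x‖ₑ * ‖(1 : ℝ)‖ₑ) +
        ENNReal.ofReal (1 / ((n : ℝ) + 1)) * (∫⁻ x, ‖φ x‖ₑ) +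
        (K * (∫⁻ τ in Icc 0 T, Q₁ n τ) + K * d * (∫⁻ τ in Icc 0 T, Q₂ n τ) +
          ENNReal.ofReal (1 / ((n : ℝ) + 1)) * (K * d * (∫⁻ τ in Icc 0 T, Q₃ τ)) +
          K * (∫⁻ τ in Icc 0 T, Q₄ n τ) + (∫⁻ τ in Icc 0 T, V τ) +
          ENNReal.ofReal T * (ENNReal.ofReal (fracLaplacianBound α φ) * C)) := by
    intro n
    -- The parameter `δ` is tied to the mollification scale for convenience only: the terms carrying
    -- `δ` are multiplied by quantities that do not involve the mollifier.
    have hδ : (0 : ℝ) < 1 / ((n : ℝ) + 1) := by positivity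
    refine (lintegral_mul_ofReal_neg_le hδ (hρ n) hgm hgi hφ hφc hφ0 hsupp hKφ).trans
      (add_le_add_right ?_ _)
    refine (ofReal_integral_mul_smoothNegPart_le hδ hα₀ hα₂ hC (hρ n) h hψ hs hg hgi hf₀ hφ hφc
      hφ0).trans ?_
    refine (lintegral_mono_ae (hsl.mono fun τ hτ => hτ.ofReal_integral_mul_mollifiedFlux_le (hρ n)
      hδ hα₀ hα₂ hφ hφc hφ0 hsupp hKφ hKD)).trans (le_of_eq ?_)
    change ∫⁻ τ in Icc 0 T, (K * Q₁ n τ + K * d * Q₂ n τ +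
      ENNReal.ofReal (1 / ((n : ℝ) + 1)) * (K * d * Q₃ τ) + K * Q₄ n τ + V τ +
      ENNReal.ofReal (fracLaplacianBound α φ) * C) = _
    have mm₁ := m₁ n
    have mm₂ := m₂ n
    have mm₄ := m₄ n
    clear_value Q₁ Q₂ Q₃ Q₄ V
    rw [lintegral_add_right _ measurable_const, lintegral_add_right _ mV,
      lintegral_add_right _ (by fun_prop), lintegral_add_right _ (by fun_prop),
      lintegral_add_right _ (by fun_prop), lintegral_const_mul _ mm₁, lintegral_const_mul _ mm₂,
      lintegral_const_mul _ (by fun_prop), lintegral_const_mul _ m₃, lintegral_const_mul _ mm₄,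
      lintegral_const, Measure.restrict_apply_univ, Real.volume_Icc, sub_zero, mul_comm _ (ENNReal.ofReal T)]
  refine ge_of_tendsto' (f := fun _ => _) (x := atTop) ?_ key
  have l0 := (ENNReal.Tendsto.const_mul tg (Or.inr hK)).add
    (ENNReal.Tendsto.mul_const tδ (Or.inr fφ))
  have l1 := (ENNReal.Tendsto.const_mul t₁ (Or.inr hK)).add
    (ENNReal.Tendsto.const_mul t₂ (Or.inr hKd))
  have l2 := (l1.add (ENNReal.Tendsto.mul_const tδ (Or.inr (ENNReal.mul_ne_top hKd f₃)))).add
    (ENNReal.Tendsto.const_mul t₄ (Or.inr hK))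
  have l3 := l0.add ((l2.add_const (∫⁻ τ in Icc 0 T, V τ)).add_const
    (ENNReal.ofReal T * (ENNReal.ofReal (fracLaplacianBound α φ) * C)))
  simp only [mul_zero, zero_mul, add_zero, zero_add] at l3
  exact l3

end EnergyLimit

/-! ### Removing the cutoff. -/

section Cutoff

variable {d : ℕ}

theorem fourier_comp_const_smul (f : EuclideanSpace ℝ (Fin d) → ℂ) {c : ℝ} (hc : c ≠ 0)
    (ξ : EuclideanSpace ℝ (Fin d)) :
    𝓕 (fun x => f (c • x)) ξ = |(c ^ d)⁻¹| • 𝓕 f (c⁻¹ • ξ) := by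
  rw [Real.fourier_eq, Real.fourier_eq]
  have := Measure.integral_comp_smul (volume : Measure (EuclideanSpace ℝ (Fin d)))
    (fun y => Real.fourierChar (-inner ℝ y (c⁻¹ • ξ)) • f y) c
  rw [finrank_euclideanSpace_fin] at this
  rw [← this]
  refine integral_congr_ae (Eventually.of_forall fun x => ?_)
  simp only [real_inner_smul_left, real_inner_smul_right]
  rw [inv_mul_cancel_left₀ hc]

/-- The symbol is homogeneous of degree `α`, while the Jacobian of the dilation and the scaling of
the transform cancel. As `α > 0`, wide cutoffs have uniformly small fractional Laplacian. -/
theorem fracLaplacianBound_comp_smul (α : ℝ) (f : EuclideanSpace ℝ (Fin d) → ℝ) {c : ℝ}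
    (hc : 0 < c) :
    fracLaplacianBound α (fun x => f (c • x)) = c ^ α * fracLaplacianBound α f := by
  unfold fracLaplacianBound
  have h1 := Measure.integral_comp_smul (volume : Measure (EuclideanSpace ℝ (Fin d)))
    (fun ξ => (2 * Real.pi * ‖ξ‖) ^ α * ‖𝓕 (fun y => (f y : ℂ)) ξ‖) c⁻¹
  rw [finrank_euclideanSpace_fin] at h1
  have h2 : ∀ ξ : EuclideanSpace ℝ (Fin d),
      (2 * Real.pi * ‖ξ‖) ^ α * ‖𝓕 (fun y => (f (c • y) : ℂ)) ξ‖ =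
      |(c ^ d)⁻¹| * c ^ α * ((2 * Real.pi * ‖c⁻¹ • ξ‖) ^ α * ‖𝓕 (fun y => (f y : ℂ)) (c⁻¹ • ξ)‖) := by
    intro ξ
    have h3 : 2 * Real.pi * ‖ξ‖ = c * (2 * Real.pi * ‖c⁻¹ • ξ‖) := by
      rw [norm_smul, Real.norm_of_nonneg (inv_nonneg.2 hc.le)]
      field_simp
    rw [fourier_comp_const_smul (fun y => (f y : ℂ)) hc.ne', norm_smul, Real.norm_eq_abs, abs_abs, h3,
      Real.mul_rpow hc.le (by positivity)]
    ring
  simp_rw [h2]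
  rw [integral_const_mul, h1, inv_pow, inv_inv, abs_inv, smul_eq_mul]
  have : |c ^ d| ≠ 0 := by positivity
  field_simp

/-- There are smooth cutoffs equal to one on the ball of radius `n + 1`, whose gradients decay
fast enough to absorb linear growth, and whose fractional Laplacians tend to zero uniformly. -/
theorem exists_cutoff_seq (d : ℕ) {α : ℝ} (hα₀ : 0 < α) :
    ∃ φ : ℕ → EuclideanSpace ℝ (Fin d) → ℝ,
      (∀ n, ContDiff ℝ ((⊤ : ℕ∞) : WithTop ℕ∞) (φ n)) ∧ (∀ n, HasCompactSupport (φ n)) ∧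
      (∀ n x, 0 ≤ φ n x) ∧ (∀ (n : ℕ) x, ‖x‖ < n + 1 → φ n x = 1) ∧
      (∀ (n : ℕ) x, ‖x‖ < n + 1 → fderiv ℝ (φ n) x = 0) ∧
      (∃ K : ℝ, ∀ n x, ‖fderiv ℝ (φ n) x‖ * (1 + ‖x‖) ≤ K) ∧
      Tendsto (fun n => fracLaplacianBound α (φ n)) atTop (𝓝 0) := by
  let η : ContDiffBump (0 : EuclideanSpace ℝ (Fin d)) := ⟨1, 2, one_pos, one_lt_two⟩
  have hη : ContDiff ℝ ((⊤ : ℕ∞) : WithTop ℕ∞) η := η.contDiff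
  have hc : ∀ n : ℕ, (0 : ℝ) < 1 / ((n : ℝ) + 1) := fun n => by positivity
  have hnorm : ∀ (n : ℕ) (x : EuclideanSpace ℝ (Fin d)),
      ‖(1 / ((n : ℝ) + 1)) • x‖ = ‖x‖ / (n + 1) := fun n x => by
    rw [norm_smul, Real.norm_of_nonneg (hc n).le]; ring
  have hone : ∀ (n : ℕ) (x : EuclideanSpace ℝ (Fin d)), ‖x‖ < n + 1 →
      η ((1 / ((n : ℝ) + 1)) • x) = 1 := by
    intro n x hx
    refine η.one_of_mem_closedBall ?_
    rw [mem_closedBall_zero_iff, hnorm, div_le_iff₀ (by positivity)]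
    change ‖x‖ ≤ 1 * _
    linarith
  have hsm : ∀ n : ℕ, ContDiff ℝ ((⊤ : ℕ∞) : WithTop ℕ∞)
      fun x : EuclideanSpace ℝ (Fin d) => η ((1 / ((n : ℝ) + 1)) • x) := fun n =>
    hη.comp (contDiff_const_smul (1 / ((n : ℝ) + 1)))
  refine ⟨fun n x => η ((1 / ((n : ℝ) + 1)) • x), hsm, fun n => ?_, fun n x => η.nonneg, hone,
    fun n x hx => ?_, ?_, ?_⟩
  · exact η.hasCompactSupport.comp_smul (hc n).ne'
  · have : (fun x : EuclideanSpace ℝ (Fin d) => η ((1 / ((n : ℝ) + 1)) • x)) =ᶠ[𝓝 x]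
        fun _ => (1 : ℝ) := by
      filter_upwards [(isOpen_lt continuous_norm continuous_const).mem_nhds hx] with y hy
        using hone n y hy
    rw [this.fderiv_eq]
    simp
  · obtain ⟨K, hK⟩ := (hη.continuous_fderiv (by simp)).bounded_above_of_compact_support
      (η.hasCompactSupport.fderiv ℝ)
    -- The gradient carries a factor `1/(n + 1)` and is supported in `‖x‖ ≤ 2(n + 1)`, where `1 +
    -- ‖x‖ ≤ 3(n + 1)`.
    refine ⟨K * 3, fun n x => ?_⟩
    have hK0 : 0 ≤ K := (norm_nonneg _).trans (hK 0)
    have hder : fderiv ℝ (fun x : EuclideanSpace ℝ (Fin d) => η ((1 / ((n : ℝ) + 1)) • x)) x =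
        (1 / ((n : ℝ) + 1)) • fderiv ℝ η ((1 / ((n : ℝ) + 1)) • x) :=
      fderiv_comp_smul (1 / ((n : ℝ) + 1))
    rw [hder, norm_smul, Real.norm_of_nonneg (hc n).le]
    by_cases hx : ‖x‖ ≤ 2 * (n + 1)
    · calc 1 / ((n : ℝ) + 1) * ‖fderiv ℝ η ((1 / ((n : ℝ) + 1)) • x)‖ * (1 + ‖x‖)
          ≤ 1 / ((n : ℝ) + 1) * K * (1 + ‖x‖) := by
            gcongr
            exact hK _
        _ = K * ((1 + ‖x‖) / (n + 1)) := by ring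
        _ ≤ K * 3 := by
            gcongr
            rw [div_le_iff₀ (by positivity)]
            linarith [n.cast_nonneg (α := ℝ)]
    · have h0 : fderiv ℝ η ((1 / ((n : ℝ) + 1)) • x) = 0 := by
        refine image_eq_zero_of_notMem_tsupport fun h => hx ?_
        have h3 := tsupport_fderiv_subset ℝ h
        rw [η.tsupport_eq, mem_closedBall_zero_iff, hnorm, div_le_iff₀ (by positivity)] at h3
        exact h3
      rw [h0, norm_zero]
      simpa using mul_nonneg hK0 (by norm_num : (0 : ℝ) ≤ 3)
  · have : ∀ n : ℕ, fracLaplacianBound α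
        (fun x : EuclideanSpace ℝ (Fin d) => η ((1 / ((n : ℝ) + 1)) • x)) =
        (1 / ((n : ℝ) + 1)) ^ α * fracLaplacianBound α η := fun n =>
      fracLaplacianBound_comp_smul α η (hc n)
    simp_rw [this]
    have h1 : Tendsto (fun n : ℕ => (1 / ((n : ℝ) + 1)) ^ α) atTop (𝓝 0) := by
      have := tendsto_one_div_add_atTop_nhds_zero_nat (𝕜 := ℝ).rpow_const (p := α) (Or.inr hα₀.le)
      rwa [Real.zero_rpow hα₀.ne'] at this
    simpa using h1.mul_const (fracLaplacianBound α η)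

variable {T α s : ℝ} {q r C : ℝ≥0∞}
  {v a b : ℝ → EuclideanSpace ℝ (Fin d) → EuclideanSpace ℝ (Fin d)}
  {G : ℝ → EuclideanSpace ℝ (Fin d) → EuclideanSpace ℝ (Fin d) →L[ℝ] EuclideanSpace ℝ (Fin d)}
  {ψ : ℝ → EuclideanSpace ℝ (Fin d) → ℝ} {f₀ g : EuclideanSpace ℝ (Fin d) → ℝ}

/-- The part of the field in `L^r` is paired with the `L^q` bound on the density, the bounded part
with the `L¹` bound. -/
theorem lintegral_enorm_mul_add_le [hqr : ENNReal.HolderConjugate q r]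
    {f : EuclideanSpace ℝ (Fin d) → ℝ} {u w : EuclideanSpace ℝ (Fin d) → EuclideanSpace ℝ (Fin d)}
    (hf : StronglyMeasurable f) (hu : StronglyMeasurable u) (hw : StronglyMeasurable w)
    (h₁ : ∫⁻ x, ‖f x‖ₑ ≤ C) (h₂ : eLpNorm f q volume ≤ C) :
    ∫⁻ x, ‖f x‖ₑ * (‖u x‖ₑ + ‖w x‖ₑ) ≤
      C * (eLpNorm u r volume + eLpNorm w ∞ volume) := by
  have hfe := hf.enorm
  have hwe := hw.enorm
  simp_rw [mul_add]
  rw [lintegral_add_right _ (by fun_prop)]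
  refine add_le_add ?_ ?_
  · have := setLIntegral_enorm_mul_enorm_le (μ := volume) (q := q) (r := r) (s := univ)
      hf.aestronglyMeasurable hu.aestronglyMeasurable
    rw [Measure.restrict_univ] at this
    exact this.trans (by gcongr)
  · have := setLIntegral_enorm_mul_enorm_le (μ := volume) (q := 1) (r := ∞) (s := univ)
      hf.aestronglyMeasurable hw.aestronglyMeasurable
    rw [Measure.restrict_univ, eLpNorm_one_eq_lintegral_enorm] at this
    exact this.trans (by gcongr)

/-- The decay of the cutoff gradients cancels the weight `1 + ‖x‖` in the growth condition, leaving
the majorant `‖ψ‖ (‖a‖ + ‖b‖)`, integrable in time and space. The gradients vanish on growing balls,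
so the flux tends to zero by dominated convergence, in space at almost every time and then in time.
-/
theorem IsTransportData.ae_nonneg [hqr : ENNReal.HolderConjugate q r] (hα₀ : 0 < α)
    (hα₂ : α ≤ 2) (hC : C ≠ ∞) (h : IsTransportData T q r C v G ψ)
    (ha : StronglyMeasurable (Function.uncurry a)) (hb : StronglyMeasurable (Function.uncurry b))
    (haL : MemL1TimeLp T r volume a) (hbL : MemL1TimeLp T ∞ volume b)
    (hv : ∀ᵐ s ∂(volume.restrict (Icc 0 T)), ∀ᵐ x, v s x = (1 + ‖x‖) • (a s x + b s x))
    (hψ : ∀ᵐ t ∂(volume.restrict (Icc 0 T)), IsWeakEvolution α v ψ f₀ t (ψ t))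
    (hs : s ∈ Icc 0 T) (hg : IsWeakEvolution α v ψ f₀ s g) (hgm : StronglyMeasurable g)
    (hgi : Integrable g) (hf₀ : ∀ᵐ x, 0 ≤ f₀ x) : ∀ᵐ x, 0 ≤ g x := by
  obtain ⟨φ, hφ, hφc, hφ0, hφ1, hD, ⟨K, hK⟩, hlap⟩ := exists_cutoff_seq d hα₀
  have mψ := h.density_measurable
  have hDm : ∀ n, Measurable fun x => ‖fderiv ℝ (φ n) x‖ₑ := fun n =>
    ((hφ n).continuous_fderiv (by simp)).measurable.enorm
  let B : ℝ → ℝ≥0∞ := fun τ => ∫⁻ x, ‖ψ τ x‖ₑ * (‖a τ x‖ₑ + ‖b τ x‖ₑ)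
  have mB : Measurable B := Measurable.lintegral_prod_right'
    (f := fun p : ℝ × EuclideanSpace ℝ (Fin d) => ‖ψ p.1 p.2‖ₑ * (‖a p.1 p.2‖ₑ + ‖b p.1 p.2‖ₑ))
    (mψ.enorm.mul (ha.enorm.add hb.enorm))
  have hB : ∫⁻ τ in Icc 0 T, B τ < ∞ := by
    refine lt_of_le_of_lt (lintegral_mono_ae ((h.ae_isRegularSlice hC).mono fun τ hτ =>
      lintegral_enorm_mul_add_le (q := q) (r := r) hτ.density_measurable
        (ha.comp_measurable measurable_prodMk_left) (hb.comp_measurable measurable_prodMk_left)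
        hτ.lintegral_le hτ.eLpNorm_le)) ?_
    rw [lintegral_const_mul' _ _ hC, lintegral_add_right _ (measurable_eLpNorm_slice hb ∞ volume)]
    exact ENNReal.mul_lt_top hC.lt_top (ENNReal.add_lt_top.2 ⟨haL.2, hbL.2⟩)
  have hpt : ∀ τ, (∀ᵐ x, v τ x = (1 + ‖x‖) • (a τ x + b τ x)) → ∀ n, ∀ᵐ x,
      ‖ψ τ x‖ₑ * (‖fderiv ℝ (φ n) x‖ₑ * ‖v τ x‖ₑ) ≤
        ENNReal.ofReal K * (‖ψ τ x‖ₑ * (‖a τ x‖ₑ + ‖b τ x‖ₑ)) := by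
    intro τ hτ n
    filter_upwards [hτ] with x hx
    have e1 : ‖fderiv ℝ (φ n) x‖ₑ * ‖(1 + ‖x‖ : ℝ)‖ₑ ≤ ENNReal.ofReal K := by
      rw [Real.enorm_eq_ofReal (by positivity), ← ofReal_norm, ← ENNReal.ofReal_mul (norm_nonneg _)]
      exact ENNReal.ofReal_le_ofReal (hK n x)
    rw [hx, enorm_smul]
    calc ‖ψ τ x‖ₑ * (‖fderiv ℝ (φ n) x‖ₑ * (‖(1 + ‖x‖ : ℝ)‖ₑ * ‖a τ x + b τ x‖ₑ))
        = (‖fderiv ℝ (φ n) x‖ₑ * ‖(1 + ‖x‖ : ℝ)‖ₑ) * (‖ψ τ x‖ₑ * ‖a τ x + b τ x‖ₑ) := by ring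
      _ ≤ _ := by
        gcongr
        exact enorm_add_le _ _
  have hlim : Tendsto (fun n => ∫⁻ τ in Icc 0 T, ∫⁻ x,
      ‖ψ τ x‖ₑ * (‖fderiv ℝ (φ n) x‖ₑ * ‖v τ x‖ₑ)) atTop (𝓝 0) := by
    refine tendsto_lintegral_zero_of_dominated (fun τ => ENNReal.ofReal K * B τ) (fun n => ?_)
      (fun n => ?_) ?_ ?_
    · exact Measurable.lintegral_prod_right' (f := fun p : ℝ × EuclideanSpace ℝ (Fin d) =>
        ‖ψ p.1 p.2‖ₑ * (‖fderiv ℝ (φ n) p.2‖ₑ * ‖v p.1 p.2‖ₑ))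
        (mψ.enorm.mul (((hDm n).comp measurable_snd).mul h.field_measurable.enorm))
    · filter_upwards [hv] with τ hτ
      refine (lintegral_mono_ae (hpt τ hτ n)).trans_eq ?_
      rw [lintegral_const_mul' _ _ ENNReal.ofReal_ne_top]
    · rw [lintegral_const_mul' _ _ ENNReal.ofReal_ne_top]
      exact ENNReal.mul_lt_top ENNReal.ofReal_lt_top hB
    · filter_upwards [hv, ae_lt_top mB hB.ne] with τ hτ hBτ
      refine tendsto_lintegral_zero_of_dominated
        (fun x => ENNReal.ofReal K * (‖ψ τ x‖ₑ * (‖a τ x‖ₑ + ‖b τ x‖ₑ)))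
        (fun n => ?_) (hpt τ hτ) ?_ (Eventually.of_forall fun x => ?_)
      · exact ((mψ.comp_measurable measurable_prodMk_left).enorm).mul
          ((hDm n).mul (h.field_measurable.comp_measurable measurable_prodMk_left).enorm)
      · rw [lintegral_const_mul' _ _ ENNReal.ofReal_ne_top]
        exact ENNReal.mul_lt_top ENNReal.ofReal_lt_top hBτ
      -- At a given point the sequence is eventually zero, since the cutoffs are constant on the
      -- ball of radius `n + 1`.
      · obtain ⟨N, hN⟩ := exists_nat_gt ‖x‖
        refine tendsto_const_nhds.congr' ?_
        filter_upwards [eventually_ge_atTop N] with n hn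
        have h1 : (N : ℝ) ≤ n := by exact_mod_cast hn
        rw [← ofReal_norm (fderiv ℝ (φ n) x), hD n x (by linarith)]
        simp
  have hlap' : Tendsto (fun n => ENNReal.ofReal T *
      (ENNReal.ofReal (fracLaplacianBound α (φ n)) * C)) atTop (𝓝 0) := by
    have h1 := (ENNReal.continuous_ofReal.tendsto 0).comp hlap
    rw [ENNReal.ofReal_zero] at h1
    have h2 := ENNReal.Tendsto.const_mul (ENNReal.Tendsto.mul_const h1 (Or.inr hC))
      (Or.inr (ENNReal.ofReal_ne_top (r := T)))
    simpa only [zero_mul, mul_zero, Function.comp_apply] using h2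
  have hsum := hlim.add hlap'
  rw [add_zero] at hsum
  refine ae_of_forall_ae_ball fun m => ?_
  -- For `n ≥ m` the cutoff is one on this ball, so the localised estimate dominates the whole
  -- negative part there.
  have hle : ∫⁻ x in Metric.ball 0 (m : ℝ), ENNReal.ofReal (-g x) ≤ 0 := by
    refine ge_of_tendsto hsum ?_
    filter_upwards [eventually_ge_atTop m] with n hn
    refine le_trans ?_ (h.lintegral_neg_le hα₀ hα₂ hC hψ hs hg hgm hgi hf₀ (hφ n) (hφc n) (hφ0 n))
    refine le_trans (le_of_eq (setLIntegral_congr_fun measurableSet_ball fun x hx => ?_))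
      (setLIntegral_le_lintegral _ _)
    have h1 : (m : ℝ) ≤ n := by exact_mod_cast hn
    rw [mem_ball_zero_iff] at hx
    simp only [hφ1 n x (by linarith), enorm_one, one_mul]
  have h0 := (lintegral_eq_zero_iff hgm.measurable.neg.ennreal_ofReal).1 (le_antisymm hle zero_le)
  filter_upwards [h0] with x hx
  exact neg_nonpos.1 (ENNReal.ofReal_eq_zero.1 hx)

end Cutoff

/-! ### Passing to Borel representatives. -/

section Representatives

variable {d : ℕ}

theorem HasWeakGradient.congr_ae {w w' : EuclideanSpace ℝ (Fin d) → EuclideanSpace ℝ (Fin d)}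
    {H H' : EuclideanSpace ℝ (Fin d) → EuclideanSpace ℝ (Fin d) →L[ℝ] EuclideanSpace ℝ (Fin d)}
    (h : HasWeakGradient w H) (hw : w =ᵐ[volume] w') (hH : H =ᵐ[volume] H') :
    HasWeakGradient w' H' := by
  refine ⟨h.1.congr hw, h.2.1.congr hH, fun φ hφ hφc e => ?_⟩
  have e1 : ∫ x, φ x • H' x e = ∫ x, φ x • H x e :=
    integral_congr_ae (hH.mono fun x hx => by simp only [hx])
  have e2 : ∫ x, (fderiv ℝ φ x e) • w' x = ∫ x, (fderiv ℝ φ x e) • w x :=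
    integral_congr_ae (hw.mono fun x hx => by simp only [hx])
  rw [e1, e2]
  exact h.2.2 φ hφ hφc e

/-- A function of time and space with a jointly measurable representative has a curried Borel
representative. -/
theorem exists_stronglyMeasurable_curry {F : Type*} [NormedAddCommGroup F] {μ : Measure ℝ}
    [SFinite μ] {f : ℝ → EuclideanSpace ℝ (Fin d) → F}
    (hf : AEStronglyMeasurable (Function.uncurry f) (μ.prod volume)) :
    ∃ f' : ℝ → EuclideanSpace ℝ (Fin d) → F, StronglyMeasurable (Function.uncurry f') ∧
      Function.uncurry f =ᵐ[μ.prod volume] Function.uncurry f' :=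
  ⟨Function.curry (hf.mk _), by rw [Function.uncurry_curry]; exact hf.stronglyMeasurable_mk,
    by rw [Function.uncurry_curry]; exact hf.ae_eq_mk⟩

theorem ae_ae_eq_of_uncurry {F : Type*} {μ : Measure ℝ} [SFinite μ]
    {f f' : ℝ → EuclideanSpace ℝ (Fin d) → F}
    (h : Function.uncurry f =ᵐ[μ.prod volume] Function.uncurry f') :
    ∀ᵐ s ∂μ, f s =ᵐ[volume] f' s :=
  Measure.ae_ae_of_ae_prod h

theorem IsWeakEvolution.congr_ae {α T s : ℝ}
    {v v' : ℝ → EuclideanSpace ℝ (Fin d) → EuclideanSpace ℝ (Fin d)}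
    {ψ ψ' : ℝ → EuclideanSpace ℝ (Fin d) → ℝ} {f₀ g g' : EuclideanSpace ℝ (Fin d) → ℝ}
    (h : IsWeakEvolution α v ψ f₀ s g) (hs : s ∈ Icc 0 T)
    (hv : ∀ᵐ t ∂(volume.restrict (Icc 0 T)), v t =ᵐ[volume] v' t)
    (hψ : ∀ᵐ t ∂(volume.restrict (Icc 0 T)), ψ t =ᵐ[volume] ψ' t) (hg : g =ᵐ[volume] g') :
    IsWeakEvolution α v' ψ' f₀ s g' := by
  intro φ hφ hφc
  have e1 : ∫ x, g' x * φ x = ∫ x, g x * φ x :=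
    integral_congr_ae (hg.mono fun x hx => by simp only [hx])
  rw [e1, h φ hφ hφc, intervalIntegral.integral_of_le hs.1, intervalIntegral.integral_of_le hs.1]
  congr 1
  have hsub : Ioc 0 s ⊆ Icc 0 T := Ioc_subset_Icc_self.trans (Icc_subset_Icc_right hs.2)
  refine integral_congr_ae ?_
  filter_upwards [ae_restrict_of_ae_restrict_of_subset hsub hv,
    ae_restrict_of_ae_restrict_of_subset hsub hψ] with t h1 h2
  refine integral_congr_ae ?_
  filter_upwards [h1, h2] with x h3 h4
  rw [h3, h4]

end Representatives

theorem proposition3p1 (d : ℕ) (hd : 1 ≤ d) (α : ℝ) (hα₀ : 0 < α) (hα₂ : α ≤ 2)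
    (q r : ℝ≥0∞) (hqr : ENNReal.HolderConjugate q r) (T : ℝ) (hT : 0 < T)
    (v : ℝ → EuclideanSpace ℝ (Fin d) → EuclideanSpace ℝ (Fin d))
    (hv : IsTransportField T r v)
    (ψ₀ : EuclideanSpace ℝ (Fin d) → ℝ) (ψ : ℝ → EuclideanSpace ℝ (Fin d) → ℝ)
    (hψ : IsWeakSolution α T q v ψ₀ ψ) (hψ₀ : ∀ᵐ x, 0 ≤ ψ₀ x) :
    ∀ s ∈ Icc 0 T, ∀ᵐ x, 0 ≤ ψ s x := by
  intro s hs
  obtain ⟨G, hG, hGL⟩ := hv.weakGradient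
  obtain ⟨a, b, haL, hbL, hab⟩ := hv.growth
  obtain ⟨C, hC⟩ := hψ.bounded
  -- The data are measurable only up to null sets of the product, and for the field and its gradient
  -- only ball by ball. Borel representatives make every slice measurable and change the slices only
  -- at a null set of times, up to null sets in space otherwise.
  obtain ⟨v', mv, ev⟩ := exists_stronglyMeasurable_curry
    (aestronglyMeasurable_of_forall_ball fun R => (hv.memLp_loc R).1)
  obtain ⟨G', mG, eG⟩ := exists_stronglyMeasurable_curry
    (aestronglyMeasurable_of_forall_ball fun R => (hGL R).1)
  obtain ⟨ψ', mψ, eψ⟩ := exists_stronglyMeasurable_curry hψ.aestronglyMeasurable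
  obtain ⟨a', ma, ea⟩ := exists_stronglyMeasurable_curry haL.1
  obtain ⟨b', mb, eb⟩ := exists_stronglyMeasurable_curry hbL.1
  have sv := ae_ae_eq_of_uncurry ev
  have sψ := ae_ae_eq_of_uncurry eψ
  have hmem : ∀ᵐ t ∂(volume.restrict (Icc 0 T)), t ∈ Icc 0 T := ae_restrict_mem measurableSet_Icc
  have hdata : IsTransportData T q r C v' G' ψ' :=
    { field_measurable := mv
      grad_measurable := mG
      density_measurable := mψ
      field_memL1 := fun R => (hv.memLp_loc R).of_ae_eq (ae_eq_restrict_ball ev R)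
      grad_memL1 := fun R => (hGL R).of_ae_eq (ae_eq_restrict_ball eG R)
      weakGradient := by
        filter_upwards [hG, sv, ae_ae_eq_of_uncurry eG] with t h1 h2 h3 using h1.congr_ae h2 h3
      eLpNorm_le := by
        filter_upwards [hmem, sψ] with t h1 h2
        rw [← eLpNorm_congr_ae h2, ← eLpNorm_congr_ae h2]
        exact hC t h1 }
  have hgrow : ∀ᵐ t ∂(volume.restrict (Icc 0 T)), ∀ᵐ x,
      v' t x = (1 + ‖x‖) • (a' t x + b' t x) := by
    filter_upwards [hab, sv, ae_ae_eq_of_uncurry ea, ae_ae_eq_of_uncurry eb] with t h1 h2 h3 h4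
    filter_upwards [h1, h2, h3, h4] with x h5 h6 h7 h8
    rw [← h6, h5, h7, h8]
  have hweak : ∀ t ∈ Icc 0 T, ∀ {g}, ψ t =ᵐ[volume] g → IsWeakEvolution α v' ψ' ψ₀ t g :=
    fun t ht g hg => IsWeakEvolution.congr_ae (T := T) (v := v) (ψ := ψ) (g := ψ t)
      (fun φ hφ hφc => hψ.weak_eq φ hφ hφc t ht) ht sv sψ hg
  -- The slice `ψ' s` may differ from `ψ s` if `s` is an exceptional time, so `ψ s` receives its own
  -- representative. The weak formulation holds at every time, hence also for that representative.
  have hsm := (hψ.memLp_one s hs).1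
  have hpos : ∀ᵐ x, 0 ≤ hsm.mk (ψ s) x :=
    hdata.ae_nonneg hα₀ hα₂ ENNReal.coe_ne_top ma mb (haL.of_ae_eq ea) (hbL.of_ae_eq eb) hgrow
      (by filter_upwards [hmem, sψ] with t h1 h2 using hweak t h1 h2) hs
      (hweak s hs hsm.ae_eq_mk) hsm.stronglyMeasurable_mk
      ((memLp_one_iff_integrable.1 (hψ.memLp_one s hs)).congr hsm.ae_eq_mk) hψ₀
  filter_upwards [hpos, hsm.ae_eq_mk] with x h1 h2
  rw [h2]
  exact h1
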